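/- Let $p \geq 1$ be a computable real, let $\mathbb{K}$ be $\mathbb{R}$ or $\mathbb{C}$, and let $\ell^p$ be the Banach space of all sequences $\{a_n\}_{n\in\mathbb{N}}$ in $\mathbb{K}$ with $\sum_n |a_n|^p < \infty$, with norm $\|\{a_n\}_n\| = (\sum_n |a_n|^p)^{1/p}$. A rational point is a rational number if $\mathbb{K} = \mathbb{R}$, and a complex number with rational real and imaginary parts if $\mathbb{K} = \mathbb{C}$. Let $e_n\in\ell^p$ be the sequence whose $n$th term (counting from $0$) is $1$ and whose other terms are $0$, and let $E = \{e_0, e_1, \ldots\}$. An effective generating set for $\ell^p$ is a sequence $F = \{f_0, f_1, \ldots\}$ of vectors of $\ell^p$ whose linear span is dense in $\ell^p$ and for which there is an algorithm that, given any rational points $\alpha_0,\ldots,\alpha_M$ and any $k\in\mathbb{N}$, computes a rational number $q$ with $q - 2^{-k} < \|\sum_{j=0}^M \alpha_j f_j\| < q + 2^{-k}$. A rational ball with respect to $F$ is (a code of) an open ball $B(\sum_{j=0}^M \alpha_j f_j; r)$ with rational points $\alpha_0,\ldots,\alpha_M$ and a positive rational $r$. A map $T:\ell^p\to\ell^p$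 is computable with respect to $(F,G)$ if there is an algorithm $P$ that, on every input (code of a) rational ball $B$ with respect to $F$, either does not halt or outputs a rational ball with respect to $G$, such that (Correctness) if $P$ outputs $B'$ on input $B$, then $T(f)\in B'$ for all $f\in B$, and (Convergence) for every $f\in\ell^p$ and every neighborhood $U$ of $T(f)$, $f$ belongs to a rational ball $B_1$ with respect to $F$ such that $P$ halts on $B_1$ and outputs a rational ball included in $U$. The space $\ell^p$ is computably categorical if for every effective generating set $F$ for $\ell^p$ there is a surjective linear isometry of $\ell^p$ that is computable with respect to $(E,F)$. Theorem. $\ell^p$ is computably categorical if and only if $p = 2$. -/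

import Mathlib

namespace LpCat

/-- Codes of rational numbers: `(a, b, c)` stands for `(a - b) / (c + 1)`. -/
abbrev RatCode : Type := ℕ × ℕ × ℕ

/-- The rational number with a given code. Every rational number has a code. -/
def RatCode.toRat (c : RatCode) : ℚ := ((c.1 : ℚ) - (c.2.1 : ℚ)) / ((c.2.2 : ℚ) + 1)

/-- Codes of rational points: a pair of rational numbers (real and imaginary part). -/
abbrev PointCode : Type := RatCode × RatCode

/-- The rational point of `𝕜` with a given code. For `𝕜 = ℂ` these are the complex numbers with
rational real and imaginary parts; for `𝕜 = ℝ`, where `RCLike.I = 0`, they are the rational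
numbers (and the second component of the code is ignored). -/
noncomputable def PointCode.toPoint (𝕜 : Type*) [RCLike 𝕜] (c : PointCode) : 𝕜 :=
  (RatCode.toRat c.1 : 𝕜) + (RatCode.toRat c.2 : 𝕜) * RCLike.I

/-- Codes of positive rational numbers: `(a, b)` stands for `(a + 1) / (b + 1)`. -/
abbrev PosRatCode : Type := ℕ × ℕ

/-- The positive rational number with a given code, as a real number. -/
noncomputable def PosRatCode.toReal (c : PosRatCode) : ℝ := ((c.1 : ℝ) + 1) / ((c.2 : ℝ) + 1)

/-- A real number is computable if an algorithm computes rational approximations to it within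
`2 ^ (-k)` from `k`. -/
def IsComputableReal (x : ℝ) : Prop :=
  ∃ q : ℕ → RatCode, Computable q ∧ ∀ k, |(RatCode.toRat (q k) : ℝ) - x| < (2 : ℝ)⁻¹ ^ k

section Banach

variable (𝕜 : Type*) [RCLike 𝕜]
variable {V : Type*} [NormedAddCommGroup V] [NormedSpace 𝕜 V]
variable {W : Type*} [NormedAddCommGroup W] [NormedSpace 𝕜 W]

/-- The rational combination `∑ j, α j • f j` of the initial terms of `f` whose coefficients are
the rational points coded by the list `α`. -/
noncomputable def ratComb (f : ℕ → V) (α : List PointCode) : V :=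
  ∑ j : Fin α.length, (PointCode.toPoint 𝕜 (α.get j)) • f j

/-- `f 0, f 1, …` is a generating set: the closure of its linear span is the whole space. -/
def IsGenerating (f : ℕ → V) : Prop :=
  (Submodule.span 𝕜 (Set.range f)).topologicalClosure = ⊤

/-- `f 0, f 1, …` is an effective generating set: it is a generating set, and an algorithm
computes the norms of its rational combinations, within `2 ^ (-k)`, from the coefficients
and `k`. -/
def IsEffectiveGenerating (f : ℕ → V) : Prop :=
  IsGenerating 𝕜 f ∧
    ∃ N : List PointCode → ℕ → RatCode, Computable₂ N ∧
      ∀ α k, (RatCode.toRat (N α k) : ℝ) - (2 : ℝ)⁻¹ ^ k < ‖ratComb 𝕜 f α‖ ∧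
        ‖ratComb 𝕜 f α‖ < (RatCode.toRat (N α k) : ℝ) + (2 : ℝ)⁻¹ ^ k

/-- Codes of rational balls: the coefficients of the centre, and the radius. -/
abbrev BallCode : Type := List PointCode × PosRatCode

/-- The (open) rational ball, with respect to `f`, with a given code. -/
def ratBall (f : ℕ → V) (B : BallCode) : Set V :=
  Metric.ball (ratComb 𝕜 f B.1) (PosRatCode.toReal B.2)

/-- The map `T` is computable with respect to `(f, g)`: a partial recursive `P` taking rational
balls with respect to `f` to rational balls with respect to `g` satisfies the correctness and
convergence criteria. (The approximation criterion, that outputs are rational balls, holds since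
every element of `BallCode` codes a rational ball.) -/
def IsComputableMap (f : ℕ → V) (g : ℕ → W) (T : V → W) : Prop :=
  ∃ P : BallCode →. BallCode, Partrec P ∧
    (∀ B, ∀ B' ∈ P B, ∀ v ∈ ratBall 𝕜 f B, T v ∈ ratBall 𝕜 g B') ∧
    (∀ v, ∀ U ∈ nhds (T v), ∃ B, v ∈ ratBall 𝕜 f B ∧ ∃ B' ∈ P B, ratBall 𝕜 g B' ⊆ U)

end Banach

/-- The space `ℓ^p` of `p`-summable sequences of elements of `𝕜`, for a real number `p`. -/
abbrev Ellp (𝕜 : Type*) [RCLike 𝕜] (p : ℝ) : Type _ :=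
  lp (fun _ : ℕ => 𝕜) (ENNReal.ofReal p)

theorem fact_one_le_ofReal {p : ℝ} (hp : 1 ≤ p) : Fact (1 ≤ ENNReal.ofReal p) :=
  ⟨ENNReal.one_le_ofReal.mpr hp⟩

/-- The standard generating set `e 0, e 1, …` of `ℓ^p`. -/
noncomputable def stdGen (𝕜 : Type*) [RCLike 𝕜] (p : ℝ) (n : ℕ) : Ellp 𝕜 p :=
  lp.single (ENNReal.ofReal p) n (1 : 𝕜)

/-- `ℓ^p` is computably categorical: for every effective generating set `F` there is a surjective
linear isometry of `ℓ^p` that is computable with respect to `(E, F)`, where `E` is the standard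
generating set. -/
def IsComputablyCategorical (𝕜 : Type*) [RCLike 𝕜] (p : ℝ) (hp : 1 ≤ p) : Prop :=
  haveI := fact_one_le_ofReal hp
  ∀ F : ℕ → Ellp 𝕜 p, IsEffectiveGenerating 𝕜 F →
    ∃ T : Ellp 𝕜 p ≃ₗᵢ[𝕜] Ellp 𝕜 p, IsComputableMap 𝕜 (stdGen 𝕜 p) F T

end LpCat

/-! For `p = 2` the space is a Hilbert space, and an effective form of Gram-Schmidt works. Norms of
rational combinations of `F` determine inner products by polarization, so near orthonormality of a
finite family of such combinations is recursively enumerable. A search produces families of size `n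
= 0, 1, 2, …`, each nearly extending the previous one, whose spans come close to every member of
`F`. The vectors converge at a known rate to a Hilbert basis (`exists_computable_hilbertBasis`), and
the isometry taking `e_i` to its `i`th member is computable because approximations of the images of
the generators yield image balls (`isComputableMap_of_approx`).

For `p ≠ 2` isometries are rigid. The defect of the parallelogram identity for `p`th powers of
scalars has a strict sign unless one scalar vanishes, so disjointness of supports can be read off
norms (`disjoint_iff_norm`). Hence every surjective linear isometry takes some `e_m` to `c • e_0`
with `‖c‖ = 1` (`exists_map_stdGen`), and if it is computable with respect to `(E, F)`, a unimodular
multiple of `e_0` can be approximated by rational combinations of `F`.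

The counterexample is `F = u, e_1, e_2, …`, where `u` is a unit vector whose coordinates from `1` on
are rational weights: each halting program `n` contributes `2⁻¹ ^ (n + 2)` once, at a position that
records when it halts. Coordinate `0` makes `‖u‖ = 1` and is never computed. As `‖u‖` is known
exactly, the `p`th power of the norm of a combination is a finite computable expression
(`norm_ratComb_replaceGen`), so `F` is effective. Removing the first `s` weights from `u` leaves a
multiple of `e_0` plus the weights of late positions. Given approximations of `c • e_0`, one can
therefore search for evidence that those late weights are all smaller than `2⁻¹ ^ (n + 2)`, hence
that `n` does not halt after stage `s`. This would make non-halting recursively enumerable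
(`IsDivergenceCertificate` and the soundness and completeness lemmas for it). Neither `c` nor `u 0`
has to be computable: the scalar in the evidence is itself searched for. -/

namespace LpCat

/-! ### Recursively enumerable predicates and searches. -/

section SemiDec

variable {α β γ : Type*} [Primcodable α] [Primcodable β] [Primcodable γ]

/-- Recursively enumerable predicates, in the normal form `∃ n, R a n` with `R` primitive
recursive. -/
def SemiDec (P : α → Prop) : Prop :=
  ∃ R : α → ℕ → Bool, Primrec₂ R ∧ ∀ a, P a ↔ ∃ n, R a n = true

theorem SemiDec.of_eq {P Q : α → Prop} (h : SemiDec P) (H : ∀ a, P a ↔ Q a) : SemiDec Q := by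
  obtain ⟨R, hR, hP⟩ := h
  exact ⟨R, hR, fun a => (H a).symm.trans (hP a)⟩

theorem SemiDec.of_primrecPred {P : α → Prop} (h : PrimrecPred P) : SemiDec P := by
  obtain ⟨_, h⟩ := h
  exact ⟨fun a _ => decide (P a), (h.comp Primrec.fst).to₂, fun a => by simp⟩

theorem SemiDec.comp {P : β → Prop} (h : SemiDec P) {f : α → β} (hf : Primrec f) :
    SemiDec fun a => P (f a) := by
  obtain ⟨R, hR, hP⟩ := h
  exact ⟨fun a n => R (f a) n, hR.comp (hf.comp Primrec.fst) Primrec.snd, fun a => hP _⟩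

theorem SemiDec.and {P Q : α → Prop} (hP : SemiDec P) (hQ : SemiDec Q) :
    SemiDec fun a => P a ∧ Q a := by
  obtain ⟨R, hR, hP⟩ := hP
  obtain ⟨S, hS, hQ⟩ := hQ
  refine ⟨fun a n => R a n.unpair.1 && S a n.unpair.2, ?_, fun a => ?_⟩
  · exact Primrec.and.comp
      (hR.comp Primrec.fst (Primrec.fst.comp (Primrec.unpair.comp Primrec.snd)))
      (hS.comp Primrec.fst (Primrec.snd.comp (Primrec.unpair.comp Primrec.snd)))
  · beta_reduce
    rw [hP, hQ]
    constructor
    · rintro ⟨⟨n, hn⟩, ⟨m, hm⟩⟩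
      exact ⟨Nat.pair n m, by simp [hn, hm]⟩
    · rintro ⟨n, hn⟩
      rw [Bool.and_eq_true] at hn
      exact ⟨⟨_, hn.1⟩, ⟨_, hn.2⟩⟩

theorem SemiDec.or {P Q : α → Prop} (hP : SemiDec P) (hQ : SemiDec Q) :
    SemiDec fun a => P a ∨ Q a := by
  obtain ⟨R, hR, hP⟩ := hP
  obtain ⟨S, hS, hQ⟩ := hQ
  refine ⟨fun a n => R a n || S a n, Primrec.or.comp hR hS, fun a => ?_⟩
  beta_reduce
  rw [hP, hQ]
  simp only [Bool.or_eq_true, exists_or]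

theorem SemiDec.exists {P : α → β → Prop} (h : SemiDec fun x : α × β => P x.1 x.2) :
    SemiDec fun a => ∃ b, P a b := by
  obtain ⟨R, hR, hP⟩ := h
  refine ⟨fun a n => Option.casesOn (Encodable.decode (α := β) n.unpair.1) false
    fun b => R (a, b) n.unpair.2, ?_, fun a => ?_⟩
  · refine Primrec.option_casesOn
      (Primrec.decode.comp (Primrec.fst.comp (Primrec.unpair.comp Primrec.snd)))
      (Primrec.const false) ?_
    exact hR.comp (Primrec.pair (Primrec.fst.comp Primrec.fst) Primrec.snd)
      (Primrec.snd.comp (Primrec.unpair.comp (Primrec.snd.comp Primrec.fst)))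
  · constructor
    · rintro ⟨b, hb⟩
      obtain ⟨n, hn⟩ := (hP (a, b)).1 hb
      exact ⟨Nat.pair (Encodable.encode b) n, by simp [hn]⟩
    · rintro ⟨n, hn⟩
      cases hd : Encodable.decode (α := β) n.unpair.1 with
      | none => simp [hd] at hn
      | some b =>
        simp only [hd] at hn
        exact ⟨b, (hP (a, b)).2 ⟨_, hn⟩⟩

/-- Finitely many witnesses have a common bound `w`; once it is guessed, both remaining quantifiers
are bounded and the matrix is primitive recursive. -/
theorem SemiDec.forall_lt {P : α → ℕ → Prop} (h : SemiDec fun x : α × ℕ => P x.1 x.2)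
    {f : α → ℕ} (hf : Primrec f) : SemiDec fun a => ∀ i < f a, P a i := by
  obtain ⟨R, hR, hP⟩ := h
  have h1 : PrimrecRel fun (m : ℕ) (x : α × ℕ) => R x m = true :=
    Primrec.eq.comp (hR.comp Primrec.snd Primrec.fst) (Primrec.const true)
  have h2 : PrimrecRel fun (w : ℕ) (x : α × ℕ) => ∃ m < w, R x m = true :=
    (h1.exists_mem_list.comp (Primrec.list_range.comp Primrec.fst) Primrec.snd).of_eq
      fun x => by simp
  have h3 : PrimrecRel fun (i : ℕ) (x : α × ℕ) => ∃ m < x.2, R (x.1, i) m = true :=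
    h2.comp (Primrec.snd.comp Primrec.snd) (Primrec.pair (Primrec.fst.comp Primrec.snd) Primrec.fst)
  have h4 : PrimrecPred fun x : α × ℕ => ∀ i < f x.1, ∃ m < x.2, R (x.1, i) m = true :=
    (h3.forall_mem_list.comp (Primrec.list_range.comp (hf.comp Primrec.fst)) Primrec.id).of_eq
      fun x => by simp
  refine (SemiDec.exists (P := fun a w => ∀ i < f a, ∃ m < w, R (a, i) m = true)
    (SemiDec.of_primrecPred h4)).of_eq fun a => ?_
  constructor
  · rintro ⟨w, hw⟩ i hi
    obtain ⟨m, -, hm⟩ := hw i hi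
    exact (hP (a, i)).2 ⟨m, hm⟩
  · intro H
    have : ∀ i, ∃ m, i < f a → R (a, i) m = true := fun i => by
      by_cases hi : i < f a
      · obtain ⟨m, hm⟩ := (hP (a, i)).1 (H i hi)
        exact ⟨m, fun _ => hm⟩
      · exact ⟨0, fun h => absurd h hi⟩
    choose g hg using this
    refine ⟨(Finset.range (f a)).sup g + 1, fun i hi => ⟨g i, ?_, hg i hi⟩⟩
    exact Nat.lt_succ_of_le (Finset.le_sup (Finset.mem_range.2 hi))

/-- Kleene's normal form: evaluation with a step bound is primitive recursive. -/
theorem SemiDec.of_partrec {f : α →. β} (hf : Partrec f) :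
    SemiDec fun x : α × β => x.2 ∈ f x.1 := by
  obtain ⟨c, hc⟩ := Nat.Partrec.Code.exists_code.1 hf
  refine ⟨fun x n => decide (Nat.Partrec.Code.evaln n c (Encodable.encode x.1) =
    some (Encodable.encode x.2)), ?_, fun x => ?_⟩
  · refine (PrimrecPred.decide (p := fun y : (α × β) × ℕ =>
      Nat.Partrec.Code.evaln y.2 c (Encodable.encode y.1.1) = some (Encodable.encode y.1.2))
      (Primrec.eq.comp ?_ ?_)).to₂
    · exact Nat.Partrec.Code.primrec_evaln.comp (Primrec.pair
        (Primrec.pair Primrec.snd (Primrec.const c))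
        (Primrec.encode.comp (Primrec.fst.comp Primrec.fst)))
    · exact Primrec.option_some.comp (Primrec.encode.comp (Primrec.snd.comp Primrec.fst))
  · have h1 : x.2 ∈ f x.1 ↔ Encodable.encode x.2 ∈ c.eval (Encodable.encode x.1) := by
      rw [hc]
      simp
    refine h1.trans (Nat.Partrec.Code.evaln_complete.trans ?_)
    simp

/-- As `f` need not be primitive recursive, its value is guessed and checked against the recursively
enumerable graph. -/
theorem SemiDec.comp_computable {P : β → Prop} (h : SemiDec P) {f : α → β} (hf : Computable f) :
    SemiDec fun a => P (f a) := by
  refine (SemiDec.exists (P := fun a b => b ∈ (f : α →. β) a ∧ P b)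
    ((SemiDec.of_partrec hf.partrec).and (h.comp Primrec.snd))).of_eq fun a => ?_
  simp

/-- Search for a witness of a recursively enumerable relation. -/
theorem SemiDec.exists_partrec {P : α → β → Prop} (h : SemiDec fun x : α × β => P x.1 x.2) :
    ∃ f : α →. β, Partrec f ∧ (∀ a, ∀ b ∈ f a, P a b) ∧ ∀ a b, P a b → (f a).Dom := by
  obtain ⟨R, hR, hP⟩ := h
  let g : α → ℕ → Option β := fun a n => (Encodable.decode (α := β) n.unpair.1).bind
    fun b => bif R (a, b) n.unpair.2 then some b else none
  have hg : Primrec₂ g := by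
    refine Primrec.option_bind
      (Primrec.decode.comp (Primrec.fst.comp (Primrec.unpair.comp Primrec.snd))) ?_
    refine Primrec.cond ?_ (Primrec.option_some.comp Primrec.snd) (Primrec.const none)
    exact hR.comp (Primrec.pair (Primrec.fst.comp Primrec.fst) Primrec.snd)
      (Primrec.snd.comp (Primrec.unpair.comp (Primrec.snd.comp Primrec.fst)))
  have key : ∀ a n b, b ∈ g a n → P a b := by
    intro a n b hb
    obtain ⟨b', hb', h2⟩ := Option.bind_eq_some_iff.1 hb
    cases hr : R (a, b') n.unpair.2 with
    | false => simp [hr] at h2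
    | true =>
      simp only [hr, cond_true, Option.some.injEq] at h2
      subst h2
      exact (hP (a, b')).2 ⟨_, hr⟩
  refine ⟨fun a => Nat.rfindOpt (g a), Partrec.rfindOpt hg.to_comp, fun a b hb => ?_,
    fun a b hab => ?_⟩
  · obtain ⟨n, hn⟩ := Nat.rfindOpt_spec hb
    exact key a n b hn
  · rw [Nat.rfindOpt_dom]
    obtain ⟨n, hn⟩ := (hP (a, b)).1 hab
    exact ⟨Nat.pair (Encodable.encode b) n, b, by simp [g, hn]⟩

theorem SemiDec.exists_computable {P : α → β → Prop} (h : SemiDec fun x : α × β => P x.1 x.2)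
    (H : ∀ a, ∃ b, P a b) : ∃ f : α → β, Computable f ∧ ∀ a, P a (f a) := by
  obtain ⟨f, hf, h1, h2⟩ := h.exists_partrec
  have hd : ∀ a, (f a).Dom := fun a => (H a).elim fun b hb => h2 a b hb
  exact ⟨fun a => (f a).get (hd a), hf.of_eq_tot fun a => Part.get_mem _,
    fun a => h1 a _ (Part.get_mem _)⟩

/-- A recursively enumerable relation with enough successors has a computable run. -/
theorem SemiDec.exists_computable_run {S : β → β → Prop}
    (h : SemiDec fun x : β × β => S x.1 x.2) {G : β → Prop} {b₀ : β} (h0 : G b₀)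
    (H : ∀ b, G b → ∃ b', S b b') (HG : ∀ b b', G b → S b b' → G b') :
    ∃ f : ℕ → β, Computable f ∧ f 0 = b₀ ∧ ∀ n, G (f n) ∧ S (f n) (f (n + 1)) := by
  obtain ⟨s, hs, h1, h2⟩ := h.exists_partrec
  -- `F` iterates the successor search. The invariant `G` need not be recursively enumerable: it
  -- serves only to show that each search halts.
  let F : ℕ →. β := fun n => n.rec (Part.some b₀) fun _ IH => IH.bind s
  have hF : Partrec F :=
    Partrec.nat_rec Computable.id (Partrec.some.comp (Computable.const b₀))
      ((hs.comp (Computable.snd.comp Computable.snd)).to₂)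
  have hd : ∀ n, ∃ b ∈ F n, G b := by
    intro n
    induction n with
    | zero => exact ⟨b₀, Part.mem_some _, h0⟩
    | succ n ih =>
      obtain ⟨b, hb, hG⟩ := ih
      obtain ⟨b', hb'⟩ := H b hG
      have hD := h2 b b' hb'
      exact ⟨(s b).get hD, Part.mem_bind hb (Part.get_mem _), HG b _ hG (h1 _ _ (Part.get_mem _))⟩
  choose f hf hG using hd
  refine ⟨f, hF.of_eq_tot hf, ?_, fun n => ⟨hG n, ?_⟩⟩
  · exact Part.mem_some_iff.1 (hf 0)
  · have h3 : f (n + 1) ∈ (F n).bind s := hf (n + 1)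
    obtain ⟨b, hb, hb'⟩ := Part.mem_bind_iff.1 h3
    rw [Part.mem_unique hb (hf n)] at hb'
    exact h1 _ _ hb'

theorem SemiDec.rePred {P : α → Prop} (h : SemiDec P) : REPred P := by
  obtain ⟨f, hf, h1, h2⟩ := SemiDec.exists_partrec (β := Unit) (P := fun a _ => P a)
    (h.comp Primrec.fst)
  refine hf.dom_re.of_eq fun a => ⟨fun hd => h1 a _ (Part.get_mem hd), fun h => h2 a () h⟩

end SemiDec

end LpCat

/-! ### Primitive recursive arithmetic of coded rationals and rational points. -/

namespace LpCat

open Finset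

theorem primrec_nat_pow : Primrec₂ ((· ^ ·) : ℕ → ℕ → ℕ) :=
  Primrec₂.unpaired'.1 Nat.Primrec.pow

namespace RatCode

def ofNat (n : ℕ) : RatCode := (n, 0, 0)

/-- The last component is the denominator minus one, and `(c + 1) * (c' + 1) - 1 = c * c' + c + c'`.
-/
def add (x y : RatCode) : RatCode :=
  (x.1 * (y.2.2 + 1) + y.1 * (x.2.2 + 1), x.2.1 * (y.2.2 + 1) + y.2.1 * (x.2.2 + 1),
    x.2.2 * y.2.2 + x.2.2 + y.2.2)

def neg (x : RatCode) : RatCode := (x.2.1, x.1, x.2.2)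

def mul (x y : RatCode) : RatCode :=
  (x.1 * y.1 + x.2.1 * y.2.1, x.1 * y.2.1 + x.2.1 * y.1, x.2.2 * y.2.2 + x.2.2 + y.2.2)

def pow (x : RatCode) (n : ℕ) : RatCode := n.rec (ofNat 1) fun _ y => mul y x

/-- The code of `2⁻¹ ^ k`. -/
def twoInv (k : ℕ) : RatCode := (1, 0, 2 ^ k - 1)

@[simp] theorem toRat_ofNat (n : ℕ) : (ofNat n).toRat = n := by simp [ofNat, toRat]

@[simp] theorem toRat_add (x y : RatCode) : (add x y).toRat = x.toRat + y.toRat := by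
  obtain ⟨a, b, c⟩ := x
  obtain ⟨a', b', c'⟩ := y
  simp only [toRat, add]
  have h1 : (c : ℚ) + 1 ≠ 0 := by positivity
  have h2 : (c' : ℚ) + 1 ≠ 0 := by positivity
  push_cast
  have h3 : (c : ℚ) * c' + c + c' + 1 = (c + 1) * (c' + 1) := by ring
  rw [h3]
  field_simp
  ring

@[simp] theorem toRat_neg (x : RatCode) : (neg x).toRat = -x.toRat := by
  simp only [toRat, neg]
  ring

@[simp] theorem toRat_mul (x y : RatCode) : (mul x y).toRat = x.toRat * y.toRat := by
  obtain ⟨a, b, c⟩ := x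
  obtain ⟨a', b', c'⟩ := y
  simp only [toRat, mul]
  have h1 : (c : ℚ) + 1 ≠ 0 := by positivity
  have h2 : (c' : ℚ) + 1 ≠ 0 := by positivity
  push_cast
  have h3 : (c : ℚ) * c' + c + c' + 1 = (c + 1) * (c' + 1) := by ring
  rw [h3]
  field_simp
  ring

@[simp] theorem toRat_pow (x : RatCode) (n : ℕ) : (pow x n).toRat = x.toRat ^ n := by
  induction n with
  | zero => simp [pow]
  | succ n ih => rw [pow_succ, ← ih, ← toRat_mul]; rfl

@[simp] theorem toRat_twoInv (k : ℕ) : (twoInv k).toRat = 2⁻¹ ^ k := by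
  have : 1 ≤ 2 ^ k := Nat.one_le_two_pow
  simp [toRat, twoInv, Nat.cast_sub this]

theorem toRat_surjective : Function.Surjective toRat := by
  intro q
  refine ⟨(q.num.toNat, (-q.num).toNat, q.den - 1), ?_⟩
  have h1 : ((q.num.toNat : ℤ) : ℚ) - ((-q.num).toNat : ℤ) = q.num := by
    rw [← Int.cast_sub]
    congr 1
    omega
  have h2 : ((q.den - 1 : ℕ) : ℚ) + 1 = q.den := by
    have := q.den_pos
    rw [Nat.cast_sub this]
    simp
  simp only [toRat]
  push_cast at h1
  rw [h1, h2, Rat.num_div_den]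

theorem exists_between {x y : ℝ} (h : x < y) :
    ∃ q : RatCode, x < (q.toRat : ℝ) ∧ (q.toRat : ℝ) < y := by
  obtain ⟨q, h1, h2⟩ := exists_rat_btwn h
  obtain ⟨c, rfl⟩ := toRat_surjective q
  exact ⟨c, h1, h2⟩

variable {α : Type*} [Primcodable α]

theorem primrec_ofNat : Primrec ofNat :=
  Primrec.pair Primrec.id (Primrec.const (0, 0))

theorem primrec_neg : Primrec neg :=
  Primrec.pair (Primrec.fst.comp Primrec.snd)
    (Primrec.pair Primrec.fst (Primrec.snd.comp Primrec.snd))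

section

variable {f g : α → ℕ}

theorem _root_.Primrec.nat_add' (hf : Primrec f) (hg : Primrec g) : Primrec fun a => f a + g a :=
  Primrec.nat_add.comp hf hg

theorem _root_.Primrec.nat_mul' (hf : Primrec f) (hg : Primrec g) : Primrec fun a => f a * g a :=
  Primrec.nat_mul.comp hf hg

end

theorem primrec_add : Primrec₂ add := by
  have a : Primrec fun z : RatCode × RatCode => z.1.1 := Primrec.fst.comp Primrec.fst
  have b : Primrec fun z : RatCode × RatCode => z.1.2.1 :=
    Primrec.fst.comp (Primrec.snd.comp Primrec.fst)
  have c : Primrec fun z : RatCode × RatCode => z.1.2.2 :=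
    Primrec.snd.comp (Primrec.snd.comp Primrec.fst)
  have a' : Primrec fun z : RatCode × RatCode => z.2.1 := Primrec.fst.comp Primrec.snd
  have b' : Primrec fun z : RatCode × RatCode => z.2.2.1 :=
    Primrec.fst.comp (Primrec.snd.comp Primrec.snd)
  have c' : Primrec fun z : RatCode × RatCode => z.2.2.2 :=
    Primrec.snd.comp (Primrec.snd.comp Primrec.snd)
  have d := Primrec.succ.comp c
  have d' := Primrec.succ.comp c'
  exact Primrec.pair ((a.nat_mul' d').nat_add' (a'.nat_mul' d))
    (Primrec.pair ((b.nat_mul' d').nat_add' (b'.nat_mul' d))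
      (((c.nat_mul' c').nat_add' c).nat_add' c'))

theorem primrec_mul : Primrec₂ mul := by
  have a : Primrec fun z : RatCode × RatCode => z.1.1 := Primrec.fst.comp Primrec.fst
  have b : Primrec fun z : RatCode × RatCode => z.1.2.1 :=
    Primrec.fst.comp (Primrec.snd.comp Primrec.fst)
  have c : Primrec fun z : RatCode × RatCode => z.1.2.2 :=
    Primrec.snd.comp (Primrec.snd.comp Primrec.fst)
  have a' : Primrec fun z : RatCode × RatCode => z.2.1 := Primrec.fst.comp Primrec.snd
  have b' : Primrec fun z : RatCode × RatCode => z.2.2.1 :=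
    Primrec.fst.comp (Primrec.snd.comp Primrec.snd)
  have c' : Primrec fun z : RatCode × RatCode => z.2.2.2 :=
    Primrec.snd.comp (Primrec.snd.comp Primrec.snd)
  exact Primrec.pair ((a.nat_mul' a').nat_add' (b.nat_mul' b'))
    (Primrec.pair ((a.nat_mul' b').nat_add' (b.nat_mul' a'))
      (((c.nat_mul' c').nat_add' c).nat_add' c'))

theorem primrec_pow : Primrec₂ pow :=
  Primrec.nat_rec (Primrec.const (ofNat 1))
    (primrec_mul.comp (Primrec.snd.comp Primrec.snd) Primrec.fst).to₂

theorem primrec_twoInv : Primrec twoInv :=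
  Primrec.pair (Primrec.const 1) (Primrec.pair (Primrec.const 0)
    (Primrec.nat_sub.comp (primrec_nat_pow.comp (Primrec.const 2) Primrec.id) (Primrec.const 1)))

/-- After cross multiplication the subtracted terms change sides, which leaves a comparison of
natural numbers. -/
theorem toRat_lt_iff (x y : RatCode) : x.toRat < y.toRat ↔
    x.1 * (y.2.2 + 1) + y.2.1 * (x.2.2 + 1) < y.1 * (x.2.2 + 1) + x.2.1 * (y.2.2 + 1) := by
  simp only [toRat]
  rw [div_lt_div_iff₀ (by positivity) (by positivity), ← @Nat.cast_lt ℚ]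
  push_cast
  constructor <;> intro h <;> linarith

theorem primrec_lt : PrimrecRel fun x y : RatCode => x.toRat < y.toRat := by
  have a : Primrec fun z : RatCode × RatCode => z.1.1 := Primrec.fst.comp Primrec.fst
  have b : Primrec fun z : RatCode × RatCode => z.1.2.1 :=
    Primrec.fst.comp (Primrec.snd.comp Primrec.fst)
  have c : Primrec fun z : RatCode × RatCode => z.1.2.2 :=
    Primrec.snd.comp (Primrec.snd.comp Primrec.fst)
  have a' : Primrec fun z : RatCode × RatCode => z.2.1 := Primrec.fst.comp Primrec.snd
  have b' : Primrec fun z : RatCode × RatCode => z.2.2.1 :=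
    Primrec.fst.comp (Primrec.snd.comp Primrec.snd)
  have c' : Primrec fun z : RatCode × RatCode => z.2.2.2 :=
    Primrec.snd.comp (Primrec.snd.comp Primrec.snd)
  have d := Primrec.succ.comp c
  have d' := Primrec.succ.comp c'
  have := Primrec.nat_lt.comp ((a.nat_mul' d').nat_add' (b'.nat_mul' d))
    ((a'.nat_mul' d).nat_add' (b.nat_mul' d'))
  exact this.of_eq fun z => (toRat_lt_iff z.1 z.2).symm

end RatCode

/-- The truth value (`0` or `1`) of `RCLike.I ≠ 0`. -/
noncomputable def iIndex (𝕜 : Type*) [RCLike 𝕜] : ℕ :=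
  open Classical in if (RCLike.I : 𝕜) = 0 then 0 else 1

theorem I_mul_I_eq (𝕜 : Type*) [RCLike 𝕜] : (RCLike.I : 𝕜) * RCLike.I = -(iIndex 𝕜 : 𝕜) := by
  unfold iIndex
  split_ifs with h
  · simp [h]
  · simpa using RCLike.I_mul_I_of_nonzero h

theorem im_I_sq (𝕜 : Type*) [RCLike 𝕜] :
    RCLike.im (RCLike.I : 𝕜) * RCLike.im (RCLike.I : 𝕜) = (iIndex 𝕜 : ℝ) := by
  have h := congrArg (RCLike.re (K := 𝕜)) (I_mul_I_eq 𝕜)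
  simp only [RCLike.mul_re, RCLike.I_re, map_neg, RCLike.natCast_re] at h
  linarith

namespace PointCode

def ofRat (q : RatCode) : PointCode := (q, RatCode.ofNat 0)

def add (x y : PointCode) : PointCode := (x.1.add y.1, x.2.add y.2)

/-- Multiplication of rational points, where `ι` is `0` over `ℝ` and `1` over `ℂ`. -/
def mul (ι : ℕ) (x y : PointCode) : PointCode :=
  ((x.1.mul y.1).add ((RatCode.ofNat ι).mul (x.2.mul y.2)).neg, (x.1.mul y.2).add (x.2.mul y.1))

/-- The square of the absolute value. -/
def normSq (ι : ℕ) (x : PointCode) : RatCode :=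
  (x.1.mul x.1).add ((RatCode.ofNat ι).mul (x.2.mul x.2))

variable (𝕜 : Type*) [RCLike 𝕜]

@[simp] theorem toPoint_ofRat (q : RatCode) : (ofRat q).toPoint 𝕜 = (q.toRat : 𝕜) := by
  simp [ofRat, toPoint]

@[simp] theorem toPoint_add (x y : PointCode) :
    (add x y).toPoint 𝕜 = x.toPoint 𝕜 + y.toPoint 𝕜 := by
  simp only [add, toPoint, RatCode.toRat_add, Rat.cast_add]
  ring

@[simp] theorem toPoint_mul (x y : PointCode) :
    (mul (iIndex 𝕜) x y).toPoint 𝕜 = x.toPoint 𝕜 * y.toPoint 𝕜 := by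
  simp only [mul, toPoint, RatCode.toRat_add, RatCode.toRat_mul, RatCode.toRat_neg,
    RatCode.toRat_ofNat]
  push_cast
  linear_combination (-(x.2.toRat : 𝕜) * (y.2.toRat : 𝕜)) * I_mul_I_eq 𝕜

theorem toRat_normSq (x : PointCode) :
    ((normSq (iIndex 𝕜) x).toRat : ℝ) = ‖x.toPoint 𝕜‖ ^ 2 := by
  rw [RCLike.norm_sq_eq_def]
  simp only [normSq, toPoint, RatCode.toRat_add, RatCode.toRat_mul, RatCode.toRat_ofNat, map_add,
    RCLike.mul_re, RCLike.mul_im, RCLike.ratCast_re, RCLike.ratCast_im, RCLike.I_re]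
  push_cast
  linear_combination (-(x.2.toRat : ℝ) * (x.2.toRat : ℝ)) * im_I_sq 𝕜

variable {α : Type*} [Primcodable α]

theorem primrec_ofRat : Primrec ofRat := Primrec.pair Primrec.id (Primrec.const _)

theorem primrec_add : Primrec₂ add :=
  Primrec.pair
    (RatCode.primrec_add.comp (Primrec.fst.comp Primrec.fst) (Primrec.fst.comp Primrec.snd))
    (RatCode.primrec_add.comp (Primrec.snd.comp Primrec.fst) (Primrec.snd.comp Primrec.snd))

theorem primrec_mul (ι : ℕ) : Primrec₂ (mul ι) := by
  have a : Primrec fun z : PointCode × PointCode => z.1.1 := Primrec.fst.comp Primrec.fst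
  have b : Primrec fun z : PointCode × PointCode => z.1.2 := Primrec.snd.comp Primrec.fst
  have a' : Primrec fun z : PointCode × PointCode => z.2.1 := Primrec.fst.comp Primrec.snd
  have b' : Primrec fun z : PointCode × PointCode => z.2.2 := Primrec.snd.comp Primrec.snd
  exact Primrec.pair (RatCode.primrec_add.comp (RatCode.primrec_mul.comp a a')
    (RatCode.primrec_neg.comp (RatCode.primrec_mul.comp (Primrec.const _)
      (RatCode.primrec_mul.comp b b'))))
    (RatCode.primrec_add.comp (RatCode.primrec_mul.comp a b') (RatCode.primrec_mul.comp b a'))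

theorem primrec_normSq (ι : ℕ) : Primrec (normSq ι) :=
  RatCode.primrec_add.comp (RatCode.primrec_mul.comp Primrec.fst Primrec.fst)
    (RatCode.primrec_mul.comp (Primrec.const _) (RatCode.primrec_mul.comp Primrec.snd Primrec.snd))

theorem denseRange_toPoint : DenseRange (toPoint 𝕜) := by
  refine Metric.denseRange_iff.2 fun z ε hε => ?_
  have key : ∀ t : ℝ, ∃ q : RatCode, ‖((t - (q.toRat : ℝ) : ℝ) : 𝕜)‖ < ε / 2 := fun t => by
    obtain ⟨q, h1, h2⟩ := RatCode.exists_between (show t - ε / 2 < t by linarith)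
    refine ⟨q, ?_⟩
    rw [RCLike.norm_ofReal, abs_lt]
    constructor <;> linarith
  obtain ⟨q, hq⟩ := key (RCLike.re z)
  obtain ⟨r, hr⟩ := key (RCLike.im z)
  refine ⟨(q, r), ?_⟩
  have h1 : z - toPoint 𝕜 (q, r) = ((RCLike.re z - (q.toRat : ℝ) : ℝ) : 𝕜) +
      ((RCLike.im z - (r.toRat : ℝ) : ℝ) : 𝕜) * RCLike.I := by
    conv_lhs => rw [← RCLike.re_add_im z]
    simp only [toPoint]
    push_cast
    ring
  have h2 : ‖(RCLike.I : 𝕜)‖ ≤ 1 := by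
    rw [RCLike.norm_I]
    split_ifs <;> norm_num
  rw [dist_eq_norm, h1]
  refine (norm_add_le _ _).trans_lt ?_
  rw [norm_mul]
  have := mul_le_of_le_one_right (norm_nonneg ((RCLike.im z - (r.toRat : ℝ) : ℝ) : 𝕜)) h2
  linarith

end PointCode

theorem two_inv_pos (k : ℕ) : (0 : ℝ) < 2⁻¹ ^ k := by positivity

end LpCat

/-! ### Coded rational combinations and enumerable norm comparisons. -/

namespace LpCat

open Finset

theorem exists_two_inv_lt {x : ℝ} (hx : 0 < x) : ∃ k : ℕ, (2 : ℝ)⁻¹ ^ k < x :=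
  exists_pow_lt_of_lt_one hx (by norm_num)

/-- The code of the zero rational point. -/
def PointCode.zero : PointCode := PointCode.ofRat (RatCode.ofNat 0)

namespace Comb

/-- The `j`th coefficient of a coded rational combination. -/
def coeff (α : List PointCode) (j : ℕ) : PointCode := α.getD j PointCode.zero

def add (α β : List PointCode) : List PointCode :=
  (List.range (α.length + β.length)).map fun j => (coeff α j).add (coeff β j)

def smul (ι : ℕ) (z : PointCode) (α : List PointCode) : List PointCode :=
  (List.range α.length).map fun j => z.mul ι (coeff α j)

def basis (i : ℕ) : List PointCode :=
  (List.range (i + 1)).map fun j =>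
    if j = i then PointCode.ofRat (RatCode.ofNat 1) else PointCode.zero

/-- The combination of the first `n` members of `W` with the coefficients `β`. -/
def lin (ι : ℕ) (β : List PointCode) (W : List (List PointCode)) (n : ℕ) : List PointCode :=
  n.rec [] fun j x => add x (smul ι (coeff β j) (W.getD j []))

variable {α : Type*} [Primcodable α]

theorem primrec_coeff : Primrec₂ coeff := Primrec.list_getD _

theorem primrec_add : Primrec₂ add := by
  refine Primrec.list_map (Primrec.list_range.comp
    ((Primrec.list_length.comp Primrec.fst).nat_add' (Primrec.list_length.comp Primrec.snd))) ?_
  exact PointCode.primrec_add.comp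
    (primrec_coeff.comp (Primrec.fst.comp Primrec.fst) Primrec.snd)
    (primrec_coeff.comp (Primrec.snd.comp Primrec.fst) Primrec.snd)

theorem primrec_smul (ι : ℕ) : Primrec₂ (smul ι) := by
  refine Primrec.list_map (Primrec.list_range.comp (Primrec.list_length.comp Primrec.snd)) ?_
  exact (PointCode.primrec_mul ι).comp (Primrec.fst.comp Primrec.fst)
    (primrec_coeff.comp (Primrec.snd.comp Primrec.fst) Primrec.snd)

theorem primrec_basis : Primrec basis := by
  refine Primrec.list_map (Primrec.list_range.comp Primrec.succ) ?_
  exact Primrec.ite (Primrec.eq.comp Primrec.snd Primrec.fst) (Primrec.const _) (Primrec.const _)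

theorem primrec_lin (ι : ℕ) : Primrec fun x : (List PointCode × List (List PointCode)) × ℕ =>
    lin ι x.1.1 x.1.2 x.2 := by
  have h1 : Primrec fun y : ((List PointCode × List (List PointCode)) × ℕ) × ℕ × List PointCode =>
      coeff y.1.1.1 y.2.1 :=
    primrec_coeff.comp (Primrec.fst.comp (Primrec.fst.comp Primrec.fst))
      (Primrec.fst.comp Primrec.snd)
  have h2 : Primrec fun y : ((List PointCode × List (List PointCode)) × ℕ) × ℕ × List PointCode =>
      y.1.1.2.getD y.2.1 [] :=
    (Primrec.list_getD []).comp (Primrec.snd.comp (Primrec.fst.comp Primrec.fst))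
      (Primrec.fst.comp Primrec.snd)
  have h3 : Primrec fun y : ((List PointCode × List (List PointCode)) × ℕ) × ℕ × List PointCode =>
      add y.2.2 (smul ι (coeff y.1.1.1 y.2.1) (y.1.1.2.getD y.2.1 [])) :=
    primrec_add.comp (Primrec.snd.comp Primrec.snd) ((primrec_smul ι).comp h1 h2)
  exact Primrec.nat_rec' (h := fun (x : (List PointCode × List (List PointCode)) × ℕ)
    (p : ℕ × List PointCode) => add p.2 (smul ι (coeff x.1.1 p.1) (x.1.2.getD p.1 [])))
    Primrec.snd (Primrec.const []) h3

variable (𝕜 : Type*) [RCLike 𝕜]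

@[simp] theorem toPoint_zero : PointCode.zero.toPoint 𝕜 = 0 := by simp [PointCode.zero]

theorem coeff_of_length_le {α : List PointCode} {j : ℕ} (h : α.length ≤ j) :
    coeff α j = PointCode.zero := List.getD_eq_default _ _ h

theorem coeff_map_range (g : ℕ → PointCode) (n j : ℕ) :
    coeff ((List.range n).map g) j = if j < n then g j else PointCode.zero := by
  split_ifs with h
  · simp [coeff, List.getD, h]
  · exact coeff_of_length_le (by simpa using h)

variable {V : Type*} [NormedAddCommGroup V] [NormedSpace 𝕜 V] (f : ℕ → V)

/-- Coefficients beyond the end of the list default to zero, so combinations of different lengths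
can be put on a common range. -/
theorem ratComb_eq_sum {α : List PointCode} {n : ℕ} (h : α.length ≤ n) :
    ratComb 𝕜 f α = ∑ j ∈ range n, (coeff α j).toPoint 𝕜 • f j := by
  have h1 : ratComb 𝕜 f α = ∑ j ∈ range α.length, (coeff α j).toPoint 𝕜 • f j := by
    rw [Finset.sum_range]
    refine Finset.sum_congr rfl fun j _ => ?_
    simp [coeff]
  rw [h1]
  refine Finset.sum_subset (by simpa using h) fun j _ hj => ?_
  rw [coeff_of_length_le (by simpa using hj), toPoint_zero, zero_smul]

@[simp] theorem ratComb_nil : ratComb 𝕜 f [] = 0 := by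
  simp [ratComb]

@[simp] theorem ratComb_add (α β : List PointCode) :
    ratComb 𝕜 f (add α β) = ratComb 𝕜 f α + ratComb 𝕜 f β := by
  rw [ratComb_eq_sum 𝕜 f (n := α.length + β.length) (by simp [add]),
    ratComb_eq_sum 𝕜 f (α := α) (n := α.length + β.length) (by simp),
    ratComb_eq_sum 𝕜 f (α := β) (n := α.length + β.length) (by simp), ← Finset.sum_add_distrib]
  refine Finset.sum_congr rfl fun j hj => ?_
  rw [add, coeff_map_range, if_pos (Finset.mem_range.1 hj), PointCode.toPoint_add, add_smul]

@[simp] theorem ratComb_smul (z : PointCode) (α : List PointCode) :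
    ratComb 𝕜 f (smul (iIndex 𝕜) z α) = z.toPoint 𝕜 • ratComb 𝕜 f α := by
  rw [ratComb_eq_sum 𝕜 f (n := α.length) (by simp [smul]), ratComb_eq_sum 𝕜 f le_rfl,
    Finset.smul_sum]
  refine Finset.sum_congr rfl fun j hj => ?_
  rw [smul, coeff_map_range, if_pos (Finset.mem_range.1 hj), PointCode.toPoint_mul, mul_smul]

@[simp] theorem ratComb_basis (i : ℕ) : ratComb 𝕜 f (basis i) = f i := by
  rw [ratComb_eq_sum 𝕜 f (n := i + 1) (by simp [basis]), Finset.sum_eq_single i]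
  · simp [basis, coeff_map_range]
  · intro j hj hji
    rw [basis, coeff_map_range, if_pos (Finset.mem_range.1 hj), if_neg hji, toPoint_zero, zero_smul]
  · simp

theorem ratComb_lin (β : List PointCode) (W : List (List PointCode)) (n : ℕ) :
    ratComb 𝕜 f (lin (iIndex 𝕜) β W n) =
      ∑ j ∈ range n, (coeff β j).toPoint 𝕜 • ratComb 𝕜 f (W.getD j []) := by
  induction n with
  | zero => simp [lin]
  | succ n ih => rw [Finset.sum_range_succ, ← ih, ← ratComb_smul, ← ratComb_add]; rfl

/-- Rational points are dense in `𝕜`, so the closure of the rational combinations is stable under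
all scalars: it is a closed subspace containing `f`. -/
theorem denseRange_ratComb {f : ℕ → V} (hf : IsGenerating 𝕜 f) : DenseRange (ratComb 𝕜 f) := by
  let S : AddSubgroup V :=
    { carrier := closure (Set.range (ratComb 𝕜 f))
      add_mem' := fun {a b} ha hb => by
        refine map_mem_closure₂ continuous_add ha hb ?_
        rintro _ ⟨α, rfl⟩ _ ⟨β, rfl⟩
        exact ⟨add α β, ratComb_add 𝕜 f α β⟩
      zero_mem' := subset_closure ⟨[], ratComb_nil 𝕜 f⟩
      neg_mem' := fun {a} ha => by
        refine map_mem_closure continuous_neg ha ?_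
        rintro _ ⟨α, rfl⟩
        refine ⟨smul (iIndex 𝕜) (PointCode.ofRat (RatCode.ofNat 1).neg) α, ?_⟩
        simp }
  have hsmul : ∀ (c : 𝕜), ∀ x ∈ S, c • x ∈ S := fun c x hx => by
    refine map_mem_closure₂ continuous_smul (PointCode.denseRange_toPoint 𝕜 c) hx ?_
    rintro _ ⟨z, rfl⟩ _ ⟨α, rfl⟩
    exact ⟨smul (iIndex 𝕜) z α, ratComb_smul 𝕜 f z α⟩
  let M : Submodule 𝕜 V := { S with smul_mem' := fun c x hx => hsmul c x hx }
  have h1 : (Submodule.span 𝕜 (Set.range f)).topologicalClosure ≤ M := by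
    refine Submodule.topologicalClosure_minimal _ (Submodule.span_le.2 ?_) isClosed_closure
    rintro _ ⟨i, rfl⟩
    exact subset_closure ⟨basis i, ratComb_basis 𝕜 f i⟩
  intro x
  exact h1 (by rw [hf]; trivial)

end Comb

section Effective

open Comb

variable {𝕜 : Type*} [RCLike 𝕜] {V : Type*} [NormedAddCommGroup V] [NormedSpace 𝕜 V] {f : ℕ → V}

theorem SemiDec.rat_lt {α : Type*} [Primcodable α] {f g : α → RatCode} (hf : Computable f)
    (hg : Computable g) : SemiDec fun a => ((f a).toRat : ℝ) < ((g a).toRat : ℝ) := by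
  have h := (SemiDec.of_primrecPred (P := fun x : RatCode × RatCode => x.1.toRat < x.2.toRat)
    RatCode.primrec_lt).comp_computable (Computable.pair hf hg)
  exact h.of_eq fun a => by simp

/-- A strict inequality is confirmed at some finite precision: the approximation plus its error
already lies below the rational. -/
theorem semiDec_norm_lt (hf : IsEffectiveGenerating 𝕜 f) :
    SemiDec fun x : List PointCode × RatCode => ‖ratComb 𝕜 f x.1‖ < (x.2.toRat : ℝ) := by
  obtain ⟨-, N, hN, h⟩ := hf
  have h1 : SemiDec fun y : (List PointCode × RatCode) × ℕ =>
      (((N y.1.1 y.2).add (RatCode.twoInv y.2)).toRat : ℝ) < (y.1.2.toRat : ℝ) :=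
    SemiDec.rat_lt (RatCode.primrec_add.to_comp.comp
      (hN.comp (Computable.fst.comp Computable.fst) Computable.snd)
      (RatCode.primrec_twoInv.to_comp.comp Computable.snd))
      (Computable.snd.comp Computable.fst)
  refine (SemiDec.exists (P := fun (x : List PointCode × RatCode) k =>
    (((N x.1 k).add (RatCode.twoInv k)).toRat : ℝ) < (x.2.toRat : ℝ)) h1).of_eq fun x => ?_
  simp only [RatCode.toRat_add, RatCode.toRat_twoInv]
  push_cast
  constructor
  · rintro ⟨k, hk⟩
    exact (h x.1 k).2.trans hk
  · intro hx
    -- Half the gap: the error enters once in the approximation and once in the test.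
    obtain ⟨k, hk⟩ := exists_two_inv_lt (half_pos (sub_pos.2 hx))
    have := (h x.1 k).1
    exact ⟨k, by linarith⟩

theorem semiDec_lt_norm (hf : IsEffectiveGenerating 𝕜 f) :
    SemiDec fun x : List PointCode × RatCode => (x.2.toRat : ℝ) < ‖ratComb 𝕜 f x.1‖ := by
  obtain ⟨-, N, hN, h⟩ := hf
  have h1 : SemiDec fun y : (List PointCode × RatCode) × ℕ =>
      ((y.1.2.add (RatCode.twoInv y.2)).toRat : ℝ) < ((N y.1.1 y.2).toRat : ℝ) :=
    SemiDec.rat_lt (RatCode.primrec_add.to_comp.comp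
      (Computable.snd.comp Computable.fst)
      (RatCode.primrec_twoInv.to_comp.comp Computable.snd))
      (hN.comp (Computable.fst.comp Computable.fst) Computable.snd)
  refine (SemiDec.exists (P := fun (x : List PointCode × RatCode) k =>
    ((x.2.add (RatCode.twoInv k)).toRat : ℝ) < ((N x.1 k).toRat : ℝ)) h1).of_eq fun x => ?_
  simp only [RatCode.toRat_add, RatCode.toRat_twoInv]
  push_cast
  constructor
  · rintro ⟨k, hk⟩
    have := (h x.1 k).1
    linarith
  · intro hx
    obtain ⟨k, hk⟩ := exists_two_inv_lt (half_pos (sub_pos.2 hx))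
    have := (h x.1 k).2
    exact ⟨k, by linarith⟩

/-- A real function with recursively enumerable strict rational cuts has computable rational
approximations. -/
theorem exists_computable_approx {α : Type*} [Primcodable α] {F : α → ℝ}
    (h1 : SemiDec fun x : α × RatCode => (x.2.toRat : ℝ) < F x.1)
    (h2 : SemiDec fun x : α × RatCode => F x.1 < (x.2.toRat : ℝ)) :
    ∃ N : α → ℕ → RatCode, Computable₂ N ∧ ∀ a k,
      ((N a k).toRat : ℝ) - (2 : ℝ)⁻¹ ^ k < F a ∧ F a < ((N a k).toRat : ℝ) + (2 : ℝ)⁻¹ ^ k := by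
  have h3 : SemiDec fun x : (α × ℕ) × RatCode =>
      ((x.2.add (RatCode.twoInv x.1.2).neg).toRat : ℝ) < F x.1.1 ∧
        F x.1.1 < ((x.2.add (RatCode.twoInv x.1.2)).toRat : ℝ) := by
    refine (h1.comp (f := fun x : (α × ℕ) × RatCode =>
      (x.1.1, x.2.add (RatCode.twoInv x.1.2).neg)) ?_).and
      (h2.comp (f := fun x : (α × ℕ) × RatCode => (x.1.1, x.2.add (RatCode.twoInv x.1.2))) ?_)
    · exact Primrec.pair (Primrec.fst.comp Primrec.fst) (RatCode.primrec_add.comp Primrec.snd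
        (RatCode.primrec_neg.comp (RatCode.primrec_twoInv.comp (Primrec.snd.comp Primrec.fst))))
    · exact Primrec.pair (Primrec.fst.comp Primrec.fst) (RatCode.primrec_add.comp Primrec.snd
        (RatCode.primrec_twoInv.comp (Primrec.snd.comp Primrec.fst)))
  obtain ⟨N, hN, h4⟩ := h3.exists_computable (P := fun (y : α × ℕ) (q : RatCode) =>
      ((q.add (RatCode.twoInv y.2).neg).toRat : ℝ) < F y.1 ∧
        F y.1 < ((q.add (RatCode.twoInv y.2)).toRat : ℝ)) fun y => by
    have := two_inv_pos y.2
    obtain ⟨q, hq1, hq2⟩ := RatCode.exists_between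
      (show F y.1 - 2⁻¹ ^ y.2 < F y.1 + 2⁻¹ ^ y.2 by linarith)
    refine ⟨q, ?_, ?_⟩ <;> simp only [RatCode.toRat_add, RatCode.toRat_twoInv,
      RatCode.toRat_neg] <;> push_cast <;> linarith
  refine ⟨fun a k => N (a, k), hN.to₂, fun a k => ?_⟩
  have := h4 (a, k)
  simp only [RatCode.toRat_add, RatCode.toRat_twoInv, RatCode.toRat_neg] at this
  push_cast at this
  exact ⟨by linarith, by linarith⟩

theorem isEffectiveGenerating_of_semiDec (hf : IsGenerating 𝕜 f)
    (h1 : SemiDec fun x : List PointCode × RatCode => (x.2.toRat : ℝ) < ‖ratComb 𝕜 f x.1‖)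
    (h2 : SemiDec fun x : List PointCode × RatCode => ‖ratComb 𝕜 f x.1‖ < (x.2.toRat : ℝ)) :
    IsEffectiveGenerating 𝕜 f :=
  ⟨hf, exists_computable_approx h1 h2⟩

end Effective

end LpCat

/-! ### Computable real functions. -/

namespace LpCat

open Finset

section ComputableFun

variable {α β : Type*} [Primcodable α] [Primcodable β]

/-- Real functions with computable rational approximations. -/
def ComputableFun (F : α → ℝ) : Prop :=
  ∃ N : α → ℕ → RatCode, Computable₂ N ∧ ∀ a k, |((N a k).toRat : ℝ) - F a| < (2 : ℝ)⁻¹ ^ k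

theorem ComputableFun.of_semiDec {F : α → ℝ}
    (h1 : SemiDec fun x : α × RatCode => (x.2.toRat : ℝ) < F x.1)
    (h2 : SemiDec fun x : α × RatCode => F x.1 < (x.2.toRat : ℝ)) : ComputableFun F := by
  obtain ⟨N, hN, h⟩ := exists_computable_approx h1 h2
  refine ⟨N, hN, fun a k => abs_lt.2 ?_⟩
  have := h a k
  constructor <;> linarith

theorem ComputableFun.comp {F : β → ℝ} (hF : ComputableFun F) {f : α → β} (hf : Computable f) :
    ComputableFun fun a => F (f a) := by
  obtain ⟨N, hN, h⟩ := hF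
  exact ⟨fun a k => N (f a) k, hN.comp (hf.comp Computable.fst) Computable.snd, fun a => h _⟩

theorem ComputableFun.add {F G : α → ℝ} (hF : ComputableFun F) (hG : ComputableFun G) :
    ComputableFun fun a => F a + G a := by
  obtain ⟨N, hN, h⟩ := hF
  obtain ⟨M, hM, h'⟩ := hG
  refine ⟨fun a k => (N a (k + 1)).add (M a (k + 1)), ?_, fun a k => ?_⟩
  · have hk : Computable fun x : α × ℕ => x.2 + 1 := Computable.succ.comp Computable.snd
    exact RatCode.primrec_add.to_comp.comp (hN.comp Computable.fst hk) (hM.comp Computable.fst hk)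
  · have h1 := abs_lt.1 (h a (k + 1))
    have h2 := abs_lt.1 (h' a (k + 1))
    have h3 : (2 : ℝ)⁻¹ ^ (k + 1) = 2⁻¹ ^ k / 2 := by rw [pow_succ]; ring
    rw [h3] at h1 h2
    rw [RatCode.toRat_add, Rat.cast_add, abs_lt]
    constructor <;> linarith [h1.1, h1.2, h2.1, h2.2]

theorem ComputableFun.neg {F : α → ℝ} (hF : ComputableFun F) : ComputableFun fun a => -F a := by
  obtain ⟨N, hN, h⟩ := hF
  refine ⟨fun a k => (N a k).neg, RatCode.primrec_neg.to_comp.comp hN, fun a k => ?_⟩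
  have h1 := abs_lt.1 (h a k)
  rw [RatCode.toRat_neg, Rat.cast_neg, abs_lt]
  constructor <;> linarith [h1.1, h1.2]

theorem ComputableFun.sub {F G : α → ℝ} (hF : ComputableFun F) (hG : ComputableFun G) :
    ComputableFun fun a => F a - G a := by
  simpa only [sub_eq_add_neg] using hF.add hG.neg

/-- Each of the `n` terms is taken to precision `k + n`; the total error is at most `n * 2⁻¹ ^ n *
2⁻¹ ^ k < 2⁻¹ ^ k`. -/
theorem ComputableFun.sum {F : α → ℕ → ℝ} (hF : ComputableFun fun x : α × ℕ => F x.1 x.2)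
    {n : α → ℕ} (hn : Computable n) : ComputableFun fun a => ∑ j ∈ range (n a), F a j := by
  obtain ⟨N, hN, h⟩ := hF
  let T : α → ℕ → ℕ → RatCode := fun a k m =>
    m.rec (RatCode.ofNat 0) fun j y => y.add (N (a, j) k)
  refine ⟨fun a k => T a (k + n a) (n a), ?_, fun a k => ?_⟩
  · have hk : Computable fun x : α × ℕ => x.2 + n x.1 :=
      Primrec.nat_add.to_comp.comp Computable.snd (hn.comp Computable.fst)
    have h1 : Computable fun y : (α × ℕ) × ℕ × RatCode =>
        y.2.2.add (N (y.1.1, y.2.1) (y.1.2 + n y.1.1)) :=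
      RatCode.primrec_add.to_comp.comp (Computable.snd.comp Computable.snd)
        (hN.comp (Computable.pair (Computable.fst.comp Computable.fst)
          (Computable.fst.comp Computable.snd)) (hk.comp Computable.fst))
    exact Computable.nat_rec (h := fun (x : α × ℕ) (p : ℕ × RatCode) =>
      p.2.add (N (x.1, p.1) (x.2 + n x.1))) (hn.comp Computable.fst) (Computable.const _) h1
  · have key : ∀ k m, |((T a k m).toRat : ℝ) - ∑ j ∈ range m, F a j| ≤ m * 2⁻¹ ^ k := by
      intro k m
      induction m with
      | zero => simp [T]
      | succ m ih =>
        have h1 := (h (a, m) k).le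
        rw [Finset.sum_range_succ]
        change |(((T a k m).add (N (a, m) k)).toRat : ℝ) - _| ≤ _
        rw [RatCode.toRat_add, Rat.cast_add, abs_le]
        rw [abs_le] at ih h1
        push_cast
        constructor <;> linarith [ih.1, ih.2, h1.1, h1.2]
    refine (key _ _).trans_lt ?_
    have h2 : ((n a : ℕ) : ℝ) < 2 ^ n a := by exact_mod_cast Nat.lt_two_pow_self
    have h3 := two_inv_pos k
    have h4 : (2 : ℝ) ^ n a * 2⁻¹ ^ n a = 1 := by rw [← mul_pow]; simp
    calc (n a : ℝ) * 2⁻¹ ^ (k + n a) < 2 ^ n a * 2⁻¹ ^ (k + n a) := by gcongr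
      _ = 2⁻¹ ^ k := by rw [pow_add, mul_left_comm, h4, mul_one]

theorem ComputableFun.semiDec_lt {F G : α → ℝ} (hF : ComputableFun F) (hG : ComputableFun G) :
    SemiDec fun a => F a < G a := by
  obtain ⟨N, hN, h⟩ := hF
  obtain ⟨M, hM, h'⟩ := hG
  have h1 : SemiDec fun x : α × ℕ =>
      ((((N x.1 x.2).add (RatCode.twoInv x.2)).add (RatCode.twoInv x.2)).toRat : ℝ) <
        ((M x.1 x.2).toRat : ℝ) := by
    have ht : Computable fun x : α × ℕ => RatCode.twoInv x.2 :=
      RatCode.primrec_twoInv.to_comp.comp Computable.snd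
    exact SemiDec.rat_lt (RatCode.primrec_add.to_comp.comp
      (RatCode.primrec_add.to_comp.comp hN ht) ht) hM
  refine (SemiDec.exists (P := fun (a : α) (k : ℕ) =>
    ((((N a k).add (RatCode.twoInv k)).add (RatCode.twoInv k)).toRat : ℝ) <
        ((M a k).toRat : ℝ)) h1).of_eq fun a => ?_
  simp only [RatCode.toRat_add, RatCode.toRat_twoInv]
  push_cast
  constructor
  · rintro ⟨k, hk⟩
    have h1 := abs_lt.1 (h a k)
    have h2 := abs_lt.1 (h' a k)
    linarith [h1.1, h1.2, h2.1, h2.2]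
  · intro hlt
    obtain ⟨k, hk⟩ := exists_two_inv_lt (show 0 < (G a - F a) / 4 by linarith)
    have h1 := abs_lt.1 (h a k)
    have h2 := abs_lt.1 (h' a k)
    exact ⟨k, by linarith [h1.1, h1.2, h2.1, h2.2]⟩

theorem IsComputableReal.computableFun {p : ℝ} (hp : IsComputableReal p) :
    ComputableFun fun _ : α => p := by
  obtain ⟨q, hq, h⟩ := hp
  exact ⟨fun _ k => q k, hq.comp Computable.snd, fun _ => h⟩

theorem computableFun_toRat : ComputableFun fun x : RatCode => (x.toRat : ℝ) :=
  ⟨fun x _ => x, Computable.fst, fun x k => by simp⟩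

end ComputableFun

/-! ### Powers with a computable real exponent. -/

section Rpow

theorem exists_nat_div_between {a b : ℝ} (ha : 0 ≤ a) (hab : a < b) :
    ∃ u v : ℕ, a < (u : ℝ) / (v + 1) ∧ (u : ℝ) / (v + 1) < b := by
  obtain ⟨q, h1, h2⟩ := exists_rat_btwn hab
  have hq : 0 < q := by exact_mod_cast ha.trans_lt h1
  have h3 : ((q.num.toNat : ℕ) : ℝ) / (((q.den - 1 : ℕ) : ℝ) + 1) = q := by
    have h4 : ((q.den - 1 : ℕ) : ℝ) + 1 = q.den := by
      rw [Nat.cast_sub q.den_pos]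
      simp
    have h5 : ((q.num.toNat : ℕ) : ℝ) = (q.num : ℝ) := by
      exact_mod_cast congrArg (Int.cast (R := ℝ)) (Int.toNat_of_nonneg (Rat.num_pos.2 hq).le)
    rw [h4, h5]
    exact_mod_cast Rat.num_div_den q
  exact ⟨q.num.toNat, q.den - 1, by rwa [h3], by rwa [h3]⟩

theorem rpow_div_pow {x : ℝ} (hx : 0 ≤ x) (u v : ℕ) :
    (x ^ ((u : ℝ) / (v + 1))) ^ (v + 1) = x ^ u := by
  rw [← Real.rpow_natCast, ← Real.rpow_mul hx, ← Real.rpow_natCast]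
  congr 1
  push_cast
  field_simp

theorem exists_exponents {x p : ℝ} (hp : 0 < p) {s : Set ℝ} (hs : s ∈ nhds (x ^ p)) :
    ∃ u v u' v' : ℕ, (u : ℝ) / (v + 1) < p ∧ p < (u' : ℝ) / (v' + 1) ∧
      x ^ ((u : ℝ) / (v + 1)) ∈ s ∧ x ^ ((u' : ℝ) / (v' + 1)) ∈ s := by
  -- Continuity in the exponent holds also at `x = 0`, because `p ≠ 0`.
  have hc : ContinuousAt (fun t : ℝ => x ^ t) p := Real.continuousAt_const_rpow' hp.ne'
  obtain ⟨ε, hε, h⟩ := Metric.mem_nhds_iff.1 (hc hs)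
  obtain ⟨u, v, h1, h2⟩ := exists_nat_div_between (le_max_left 0 (p - ε))
    (max_lt hp (by linarith : p - ε < p))
  obtain ⟨u', v', h3, h4⟩ := exists_nat_div_between hp.le (by linarith : p < p + ε)
  refine ⟨u, v, u', v', h2, h3, h ?_, h ?_⟩
  · have := (le_max_right 0 (p - ε)).trans_lt h1
    rw [Metric.mem_ball, Real.dist_eq, abs_lt]
    constructor <;> linarith
  · rw [Metric.mem_ball, Real.dist_eq, abs_lt]
    constructor <;> linarith

/-- `x ^ t` increases in `t` for `1 ≤ x` and decreases for `0 < x ≤ 1`. Testing a rational exponent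
on each side of `p` covers both cases without deciding between them, and raising to the power `v +
1` removes the root. -/
theorem lt_rpow_iff {x q p : ℝ} (hx : 0 ≤ x) (hq : 0 ≤ q) (hp : 0 < p) :
    q < x ^ p ↔ ∃ u v u' v' : ℕ, ((u : ℝ) / (v + 1) < p ∧ p < (u' : ℝ) / (v' + 1)) ∧
      q ^ (v + 1) < x ^ u ∧ q ^ (v' + 1) < x ^ u' := by
  constructor
  · intro h
    obtain ⟨u, v, u', v', h1, h2, h3, h4⟩ := exists_exponents hp (Ioi_mem_nhds h)
    refine ⟨u, v, u', v', ⟨h1, h2⟩, ?_, ?_⟩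
    · rw [← rpow_div_pow hx u v]
      exact pow_lt_pow_left₀ h3 hq (by simp)
    · rw [← rpow_div_pow hx u' v']
      exact pow_lt_pow_left₀ h4 hq (by simp)
  · rintro ⟨u, v, u', v', ⟨h1, h2⟩, h3, h4⟩
    rw [← rpow_div_pow hx] at h3 h4
    have h5 := lt_of_pow_lt_pow_left₀ _ (Real.rpow_nonneg hx _) h3
    have h6 := lt_of_pow_lt_pow_left₀ _ (Real.rpow_nonneg hx _) h4
    rcases le_or_gt 1 x with h | h
    · exact h5.trans_le (Real.rpow_le_rpow_of_exponent_le h h1.le)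
    · rcases hx.eq_or_lt with rfl | hx'
      · rw [Real.zero_rpow (hp.trans h2).ne'] at h6
        linarith
      · exact h6.trans_le (Real.rpow_le_rpow_of_exponent_ge hx' h.le h2.le)

theorem rpow_lt_iff {x q p : ℝ} (hx : 0 ≤ x) (hq : 0 ≤ q) (hp : 0 < p) :
    x ^ p < q ↔ ∃ u v u' v' : ℕ, ((u : ℝ) / (v + 1) < p ∧ p < (u' : ℝ) / (v' + 1)) ∧
      x ^ u < q ^ (v + 1) ∧ x ^ u' < q ^ (v' + 1) := by
  constructor
  · intro h
    obtain ⟨u, v, u', v', h1, h2, h3, h4⟩ := exists_exponents hp (Iio_mem_nhds h)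
    refine ⟨u, v, u', v', ⟨h1, h2⟩, ?_, ?_⟩
    · rw [← rpow_div_pow hx u v]
      exact pow_lt_pow_left₀ h3 (Real.rpow_nonneg hx _) (by simp)
    · rw [← rpow_div_pow hx u' v']
      exact pow_lt_pow_left₀ h4 (Real.rpow_nonneg hx _) (by simp)
  · rintro ⟨u, v, u', v', ⟨h1, h2⟩, h3, h4⟩
    rw [← rpow_div_pow hx] at h3 h4
    have h5 := lt_of_pow_lt_pow_left₀ _ hq h3
    have h6 := lt_of_pow_lt_pow_left₀ _ hq h4
    rcases le_or_gt 1 x with h | h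
    · exact (Real.rpow_le_rpow_of_exponent_le h h2.le).trans_lt h6
    · exact (Real.rpow_le_rpow_of_exponent_ge' hx h.le (by positivity) h1.le).trans_lt h5

/-- The absolute value of a rational point may be irrational but its square is rational, so the
comparisons of integer powers are squared. -/
theorem computableFun_norm_rpow (𝕜 : Type*) [RCLike 𝕜] {p : ℝ} (hp : 0 < p)
    (hpc : IsComputableReal p) : ComputableFun fun z : PointCode => ‖z.toPoint 𝕜‖ ^ p := by
  let X := (PointCode × RatCode) × ((ℕ × ℕ) × (ℕ × ℕ))
  have hz : Primrec fun y : X => y.1.1.normSq (iIndex 𝕜) :=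
    (PointCode.primrec_normSq _).comp (Primrec.fst.comp Primrec.fst)
  have hq : Primrec fun y : X => y.1.2 := Primrec.snd.comp Primrec.fst
  have hu : Primrec fun y : X => y.2.1.1 := Primrec.fst.comp (Primrec.fst.comp Primrec.snd)
  have hv : Primrec fun y : X => y.2.1.2 := Primrec.snd.comp (Primrec.fst.comp Primrec.snd)
  have hu' : Primrec fun y : X => y.2.2.1 := Primrec.fst.comp (Primrec.snd.comp Primrec.snd)
  have hv' : Primrec fun y : X => y.2.2.2 := Primrec.snd.comp (Primrec.snd.comp Primrec.snd)
  have hconst : ComputableFun fun _ : X => p := hpc.computableFun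
  have hexp : SemiDec fun y : X => (y.2.1.1 : ℝ) / (y.2.1.2 + 1) < p ∧
      p < (y.2.2.1 : ℝ) / (y.2.2.2 + 1) := by
    have h1 : ComputableFun fun y : X => (y.2.1.1 : ℝ) / (y.2.1.2 + 1) := by
      have := computableFun_toRat.comp
        (Primrec.pair hu (Primrec.pair (Primrec.const 0) hv)).to_comp
      simpa [RatCode.toRat] using this
    have h2 : ComputableFun fun y : X => (y.2.2.1 : ℝ) / (y.2.2.2 + 1) := by
      have := computableFun_toRat.comp
        (Primrec.pair hu' (Primrec.pair (Primrec.const 0) hv')).to_comp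
      simpa [RatCode.toRat] using this
    exact (h1.semiDec_lt hconst).and (hconst.semiDec_lt h2)
  have hqpow : ∀ {g : X → ℕ}, Primrec g → Computable fun y : X => y.1.2.pow (2 * (g y + 1)) :=
    fun hg => (RatCode.primrec_pow.comp hq
      (Primrec.nat_mul.comp (Primrec.const 2) (Primrec.succ.comp hg))).to_comp
  have hzpow : ∀ {g : X → ℕ}, Primrec g →
      Computable fun y : X => (y.1.1.normSq (iIndex 𝕜)).pow (g y) :=
    fun hg => (RatCode.primrec_pow.comp hz hg).to_comp
  have hsq : ∀ {a b : ℝ} (_ : 0 ≤ a) (_ : 0 ≤ b) (m n : ℕ),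
      (a ^ (2 * m) < (b ^ 2) ^ n ↔ a ^ m < b ^ n) := fun {a b} ha hb m n => by
    rw [← pow_mul, mul_comm 2 m, mul_comm 2 n, pow_mul, pow_mul]
    exact pow_lt_pow_iff_left₀ (by positivity) (by positivity) two_ne_zero
  have hsq' : ∀ {a b : ℝ} (_ : 0 ≤ a) (_ : 0 ≤ b) (m n : ℕ),
      ((b ^ 2) ^ n < a ^ (2 * m) ↔ b ^ n < a ^ m) := fun {a b} ha hb m n => by
    rw [← pow_mul, mul_comm 2 m, mul_comm 2 n, pow_mul, pow_mul]
    exact pow_lt_pow_iff_left₀ (by positivity) (by positivity) two_ne_zero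
  have hneg : SemiDec fun x : PointCode × RatCode =>
      (x.2.toRat : ℝ) < ((RatCode.ofNat 0).toRat : ℝ) :=
    SemiDec.rat_lt Computable.snd (Computable.const _)
  have hpos : SemiDec fun x : PointCode × RatCode =>
      ((RatCode.ofNat 0).toRat : ℝ) < (x.2.toRat : ℝ) :=
    SemiDec.rat_lt (Computable.const _) Computable.snd
  refine ComputableFun.of_semiDec ?_ ?_
  · have h1 := hexp.and ((SemiDec.rat_lt (hqpow hv) (hzpow hu)).and
      (SemiDec.rat_lt (hqpow hv') (hzpow hu')))
    refine (hneg.or (SemiDec.exists (P := fun (x : PointCode × RatCode)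
      (e : (ℕ × ℕ) × (ℕ × ℕ)) => ((e.1.1 : ℝ) / (e.1.2 + 1) < p ∧
      p < (e.2.1 : ℝ) / (e.2.2 + 1)) ∧
      ((x.2.pow (2 * (e.1.2 + 1))).toRat : ℝ) < (((x.1.normSq (iIndex 𝕜)).pow e.1.1).toRat : ℝ) ∧
      ((x.2.pow (2 * (e.2.2 + 1))).toRat : ℝ) < (((x.1.normSq (iIndex 𝕜)).pow e.2.1).toRat : ℝ))
      h1)).of_eq fun x => ?_
    have h0 : (0 : ℝ) ≤ ‖x.1.toPoint 𝕜‖ ^ p := Real.rpow_nonneg (norm_nonneg _) _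
    simp only [PointCode.toRat_normSq, RatCode.toRat_pow, Rat.cast_pow, RatCode.toRat_ofNat, Nat.cast_zero,
      Rat.cast_zero]
    rcases lt_or_ge ((x.2.toRat : ℚ) : ℝ) 0 with hx | hx
    · simp only [hx, true_or, true_iff]
      exact hx.trans_le h0
    · simp only [not_lt.2 hx, false_or]
      rw [lt_rpow_iff (norm_nonneg _) hx hp]
      simp only [Prod.exists, hsq hx (norm_nonneg (x.1.toPoint 𝕜))]
  · have h1 := hexp.and ((SemiDec.rat_lt (hzpow hu) (hqpow hv)).and
      (SemiDec.rat_lt (hzpow hu') (hqpow hv')))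
    refine (hpos.and (SemiDec.exists (P := fun (x : PointCode × RatCode)
      (e : (ℕ × ℕ) × (ℕ × ℕ)) => ((e.1.1 : ℝ) / (e.1.2 + 1) < p ∧
      p < (e.2.1 : ℝ) / (e.2.2 + 1)) ∧
      (((x.1.normSq (iIndex 𝕜)).pow e.1.1).toRat : ℝ) < ((x.2.pow (2 * (e.1.2 + 1))).toRat : ℝ) ∧
      (((x.1.normSq (iIndex 𝕜)).pow e.2.1).toRat : ℝ) < ((x.2.pow (2 * (e.2.2 + 1))).toRat : ℝ))
      h1)).of_eq fun x => ?_
    have h0 : (0 : ℝ) ≤ ‖x.1.toPoint 𝕜‖ ^ p := Real.rpow_nonneg (norm_nonneg _) _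
    simp only [PointCode.toRat_normSq, RatCode.toRat_pow, Rat.cast_pow, RatCode.toRat_ofNat, Nat.cast_zero,
      Rat.cast_zero]
    rcases le_or_gt ((x.2.toRat : ℚ) : ℝ) 0 with hx | hx
    · simp only [not_lt.2 hx, false_and, false_iff, not_lt]
      exact hx.trans h0
    · simp only [hx, true_and]
      rw [rpow_lt_iff (norm_nonneg _) hx.le hp]
      simp only [Prod.exists, hsq' hx.le (norm_nonneg (x.1.toPoint 𝕜))]

end Rpow

open Comb

variable {𝕜 : Type*} [RCLike 𝕜] {V : Type*} [NormedAddCommGroup V] [NormedSpace 𝕜 V] {f : ℕ → V}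

/-- The right-hand side of `h` is a finite sum of computable terms. Comparing a nonnegative rational
with the norm amounts to comparing `p`th powers, both of which are computable. -/
theorem isEffectiveGenerating_of_norm_rpow (hf : IsGenerating 𝕜 f) {p : ℝ} (hp : 0 < p)
    (hpc : IsComputableReal p) {w : ℕ → RatCode} (hw : Computable w)
    (h : ∀ α, ‖ratComb 𝕜 f α‖ ^ p = ‖(coeff α 0).toPoint 𝕜‖ ^ p +
      ∑ j ∈ range α.length, (‖(coeff α (j + 1)).toPoint 𝕜 + (coeff α 0).toPoint 𝕜 * (w j).toRat‖ ^ p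
        - ‖(coeff α 0).toPoint 𝕜 * (w j).toRat‖ ^ p)) :
    IsEffectiveGenerating 𝕜 f := by
  have hG := computableFun_norm_rpow 𝕜 hp hpc
  have hS : ComputableFun fun α : List PointCode => ‖ratComb 𝕜 f α‖ ^ p := by
    have h0 : Computable fun x : List PointCode × ℕ => coeff x.1 0 :=
      (primrec_coeff.comp Primrec.fst (Primrec.const 0)).to_comp
    have h1 : Computable fun x : List PointCode × ℕ => coeff x.1 (x.2 + 1) :=
      (primrec_coeff.comp Primrec.fst (Primrec.succ.comp Primrec.snd)).to_comp
    have h2 : Computable fun x : List PointCode × ℕ =>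
        (coeff x.1 0).mul (iIndex 𝕜) (PointCode.ofRat (w x.2)) :=
      (PointCode.primrec_mul _).to_comp.comp h0
        (PointCode.primrec_ofRat.to_comp.comp (hw.comp Computable.snd))
    have h3 : ComputableFun fun x : List PointCode × ℕ =>
        ‖(coeff x.1 (x.2 + 1)).toPoint 𝕜 + (coeff x.1 0).toPoint 𝕜 * (w x.2).toRat‖ ^ p
        - ‖(coeff x.1 0).toPoint 𝕜 * (w x.2).toRat‖ ^ p := by
      have := (hG.comp (PointCode.primrec_add.to_comp.comp h1 h2)).sub (hG.comp h2)
      simpa using this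
    have h4 := (hG.comp (primrec_coeff.comp Primrec.id (Primrec.const 0)).to_comp).add
      (ComputableFun.sum (F := fun α j =>
        ‖(coeff α (j + 1)).toPoint 𝕜 + (coeff α 0).toPoint 𝕜 * (w j).toRat‖ ^ p
        - ‖(coeff α 0).toPoint 𝕜 * (w j).toRat‖ ^ p) h3 Computable.list_length)
    have h5 : (fun α : List PointCode => ‖ratComb 𝕜 f α‖ ^ p) = _ := funext h
    rw [h5]
    exact h4
  have hq : ComputableFun fun x : List PointCode × RatCode => |(x.2.toRat : ℝ)| ^ p := by
    have := hG.comp (α := List PointCode × RatCode)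
      (PointCode.primrec_ofRat.to_comp.comp Computable.snd)
    have h6 : ∀ q : RatCode, ‖((q.toRat : ℚ) : 𝕜)‖ = |(q.toRat : ℝ)| := fun q => by
      rw [← RCLike.ofReal_ratCast, RCLike.norm_ofReal]
    simpa [h6] using this
  refine isEffectiveGenerating_of_semiDec hf ?_ ?_
  · refine ((SemiDec.rat_lt Computable.snd (Computable.const (RatCode.ofNat 0))).or
      (hq.semiDec_lt (hS.comp Computable.fst))).of_eq fun x => ?_
    simp only [RatCode.toRat_ofNat, Nat.cast_zero, Rat.cast_zero]
    rcases lt_or_ge ((x.2.toRat : ℚ) : ℝ) 0 with hx | hx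
    · simp only [hx, true_or, true_iff]
      exact hx.trans_le (norm_nonneg _)
    · simp only [not_lt.2 hx, false_or, abs_of_nonneg hx]
      exact Real.rpow_lt_rpow_iff hx (norm_nonneg _) hp
  · refine ((SemiDec.rat_lt (Computable.const (RatCode.ofNat 0)) Computable.snd).and
      ((hS.comp Computable.fst).semiDec_lt hq)).of_eq fun x => ?_
    simp only [RatCode.toRat_ofNat, Nat.cast_zero, Rat.cast_zero]
    rcases le_or_gt ((x.2.toRat : ℚ) : ℝ) 0 with hx | hx
    · simp only [not_lt.2 hx, false_and, false_iff, not_lt]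
      exact hx.trans (norm_nonneg _)
    · simp only [hx, true_and, abs_of_pos hx]
      exact Real.rpow_lt_rpow_iff (norm_nonneg _) hx.le hp

end LpCat

/-! ### Coordinates in `ℓ^p` and generating sets with a modified initial vector. -/

namespace LpCat

open Finset Comb

section Ellp

set_option linter.unusedSectionVars false

variable {𝕜 : Type*} [RCLike 𝕜] {p : ℝ} [hp : Fact (1 ≤ ENNReal.ofReal p)]

theorem one_le_of_fact (p : ℝ) [hp : Fact (1 ≤ ENNReal.ofReal p)] : 1 ≤ p :=
  ENNReal.one_le_ofReal.1 hp.out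

theorem toReal_ofReal_of_fact (p : ℝ) [Fact (1 ≤ ENNReal.ofReal p)] :
    (ENNReal.ofReal p).toReal = p :=
  ENNReal.toReal_ofReal (zero_le_one.trans (one_le_of_fact p))

theorem pos_of_fact (p : ℝ) [Fact (1 ≤ ENNReal.ofReal p)] : 0 < p :=
  zero_lt_one.trans_le (one_le_of_fact p)

theorem hasSum_norm_rpow (x : Ellp 𝕜 p) : HasSum (fun i => ‖x i‖ ^ p) (‖x‖ ^ p) := by
  have h := toReal_ofReal_of_fact p
  have := lp.hasSum_norm (by rw [h]; exact pos_of_fact p) x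
  rwa [h] at this

theorem ellp_add_apply (x y : Ellp 𝕜 p) (i : ℕ) : (x + y) i = x i + y i := rfl

theorem ellp_sub_apply (x y : Ellp 𝕜 p) (i : ℕ) : (x - y) i = x i - y i := rfl

theorem ellp_smul_apply (c : 𝕜) (x : Ellp 𝕜 p) (i : ℕ) : (c • x) i = c * x i := rfl

theorem ellp_sum_apply {ι : Type*} (s : Finset ι) (x : ι → Ellp 𝕜 p) (i : ℕ) :
    (∑ j ∈ s, x j) i = ∑ j ∈ s, x j i := by
  classical
  induction s using Finset.induction_on with
  | empty => simp
  | insert a s ha ih => rw [Finset.sum_insert ha, Finset.sum_insert ha, ellp_add_apply, ih]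

theorem stdGen_apply (i j : ℕ) : stdGen 𝕜 p i j = if j = i then 1 else 0 := by
  unfold stdGen
  split_ifs with h
  · subst h; exact lp.single_apply_self _ _ _
  · exact lp.single_apply_ne _ _ _ h

theorem norm_stdGen (i : ℕ) : ‖stdGen 𝕜 p i‖ = 1 := by
  unfold stdGen
  rw [lp.norm_single (zero_lt_one.trans_le hp.out), norm_one]

theorem hasSum_stdGen (x : Ellp 𝕜 p) : HasSum (fun i => x i • stdGen 𝕜 p i) x := by
  have h : (fun i => x i • stdGen 𝕜 p i) = fun i => lp.single (ENNReal.ofReal p) i (x i) :=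
    funext fun i => by rw [stdGen, ← lp.single_smul, smul_eq_mul, mul_one]
  rw [h]
  exact lp.hasSum_single ENNReal.ofReal_ne_top x

/-- The standard generating set with its initial vector replaced by `u`. -/
noncomputable def replaceGen (u : Ellp 𝕜 p) : ℕ → Ellp 𝕜 p
  | 0 => u
  | j + 1 => stdGen 𝕜 p (j + 1)

/-- `u - u 0 • e_0` is a limit of combinations of `e_1, e_2, …`, so the closed span contains `u 0 •
e_0`, hence `e_0`. -/
theorem isGenerating_replaceGen {u : Ellp 𝕜 p} (hu : u 0 ≠ 0) :
    IsGenerating 𝕜 (replaceGen u) := by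
  set K := (Submodule.span 𝕜 (Set.range (replaceGen u))).topologicalClosure with hK
  have hcl : IsClosed (K : Set (Ellp 𝕜 p)) := Submodule.isClosed_topologicalClosure _
  have hmem : ∀ j, replaceGen u j ∈ K := fun j =>
    Submodule.le_topologicalClosure _ (Submodule.subset_span ⟨j, rfl⟩)
  have h1 : HasSum (fun i => u (i + 1) • stdGen 𝕜 p (i + 1)) (u - u 0 • stdGen 𝕜 p 0) := by
    simpa using (hasSum_nat_add_iff' 1).2 (hasSum_stdGen u)
  have h2 : u - u 0 • stdGen 𝕜 p 0 ∈ K :=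
    hcl.mem_of_tendsto h1 (Filter.Eventually.of_forall fun s =>
      Submodule.sum_mem _ fun i _ => Submodule.smul_mem _ _ (hmem (i + 1)))
  have h3 : stdGen 𝕜 p 0 ∈ K := by
    have := Submodule.smul_mem K (u 0)⁻¹ (Submodule.sub_mem K (hmem 0) h2)
    simpa [replaceGen, smul_smul, hu] using this
  have h4 : ∀ i, stdGen 𝕜 p i ∈ K := fun i => by
    cases i with
    | zero => exact h3
    | succ i => exact hmem (i + 1)
  rw [IsGenerating, ← hK, eq_top_iff]
  intro x _
  exact hcl.mem_of_tendsto (hasSum_stdGen x) (Filter.Eventually.of_forall fun s =>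
    Submodule.sum_mem _ fun i _ => Submodule.smul_mem _ _ (h4 i))

theorem ratComb_replaceGen (u : Ellp 𝕜 p) (α : List PointCode) :
    ratComb 𝕜 (replaceGen u) α = (coeff α 0).toPoint 𝕜 • u +
      ∑ j ∈ range α.length, (coeff α (j + 1)).toPoint 𝕜 • stdGen 𝕜 p (j + 1) := by
  rw [ratComb_eq_sum 𝕜 _ (Nat.le_succ _), Finset.sum_range_succ', add_comm]
  rfl

theorem ratComb_replaceGen_apply_zero (u : Ellp 𝕜 p) (α : List PointCode) :
    ratComb 𝕜 (replaceGen u) α 0 = (coeff α 0).toPoint 𝕜 * u 0 := by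
  rw [ratComb_replaceGen]
  simp only [ellp_add_apply, ellp_smul_apply, ellp_sum_apply, stdGen_apply]
  simp

theorem ratComb_replaceGen_apply_succ (u : Ellp 𝕜 p) (α : List PointCode) (i : ℕ) :
    ratComb 𝕜 (replaceGen u) α (i + 1) =
      (coeff α 0).toPoint 𝕜 * u (i + 1) + (coeff α (i + 1)).toPoint 𝕜 := by
  rw [ratComb_replaceGen]
  by_cases hi : i < α.length
  · simp only [ellp_add_apply, ellp_smul_apply, ellp_sum_apply, stdGen_apply]
    simp [hi]
  · have h : (coeff α (i + 1)).toPoint 𝕜 = 0 := by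
      rw [coeff_of_length_le (by omega), toPoint_zero]
    simp only [ellp_add_apply, ellp_smul_apply, ellp_sum_apply, stdGen_apply]
    simp [hi, h]

/-- Compare with `c • u`, where `c` is the initial coefficient and `‖c • u‖ = ‖c‖`. The two vectors
agree at coordinate `0` and at all but finitely many others, so neither `u 0` nor the infinite tail
of `u` enters the formula. -/
theorem norm_ratComb_replaceGen {u : Ellp 𝕜 p} (hu : ‖u‖ = 1) (α : List PointCode) :
    ‖ratComb 𝕜 (replaceGen u) α‖ ^ p = ‖(coeff α 0).toPoint 𝕜‖ ^ p +
      ∑ j ∈ range α.length, (‖(coeff α (j + 1)).toPoint 𝕜 + (coeff α 0).toPoint 𝕜 * u (j + 1)‖ ^ p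
        - ‖(coeff α 0).toPoint 𝕜 * u (j + 1)‖ ^ p) := by
  set x := ratComb 𝕜 (replaceGen u) α with hx
  set c := (coeff α 0).toPoint 𝕜 with hc
  have h1 := (hasSum_norm_rpow x).sub (hasSum_norm_rpow (c • u))
  have h2 : HasSum (fun i => ‖x i‖ ^ p - ‖(c • u) i‖ ^ p)
      (∑ i ∈ range (α.length + 1), (‖x i‖ ^ p - ‖(c • u) i‖ ^ p)) := by
    refine hasSum_sum_of_ne_finset_zero fun i hi => ?_
    obtain ⟨j, rfl⟩ : ∃ j, i = j + 1 := ⟨i - 1, by simp at hi; omega⟩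
    rw [Finset.mem_range, not_lt] at hi
    rw [hx, ratComb_replaceGen_apply_succ, coeff_of_length_le (by omega : α.length ≤ j + 1),
      toPoint_zero, ellp_smul_apply, add_zero, sub_self]
  have h3 := h1.unique h2
  rw [Finset.sum_range_succ', hx, ratComb_replaceGen_apply_zero, norm_smul, hu, mul_one] at h3
  simp only [ratComb_replaceGen_apply_succ, ellp_smul_apply, ← hc, sub_self, add_zero] at h3
  rw [← hx] at h3
  rw [sub_eq_iff_eq_add'.1 h3]
  simp only [add_comm]

theorem isEffectiveGenerating_replaceGen (hpc : IsComputableReal p) {u : Ellp 𝕜 p} (hu : ‖u‖ = 1)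
    (hu0 : u 0 ≠ 0) {w : ℕ → RatCode} (hw : Computable w)
    (hwu : ∀ j, u (j + 1) = ((w j).toRat : 𝕜)) : IsEffectiveGenerating 𝕜 (replaceGen u) := by
  refine isEffectiveGenerating_of_norm_rpow (isGenerating_replaceGen hu0) (pos_of_fact p) hpc hw
    fun α => ?_
  simp only [← hwu]
  exact norm_ratComb_replaceGen hu α

theorem isEffectiveGenerating_stdGen (hpc : IsComputableReal p) :
    IsEffectiveGenerating 𝕜 (stdGen 𝕜 p) := by
  have h : replaceGen (stdGen 𝕜 p 0) = stdGen 𝕜 p := by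
    funext i
    cases i <;> rfl
  have := isEffectiveGenerating_replaceGen (𝕜 := 𝕜) hpc (norm_stdGen 0) (by simp [stdGen_apply])
    (Computable.const (RatCode.ofNat 0)) (by simp [stdGen_apply])
  rwa [h] at this

/-- Coordinate `0` supplies the missing mass `1 - ∑' j, |w j| ^ p`; it is nonzero, and its
computability is not needed. -/
theorem exists_norm_one_of_tsum_lt {w : ℕ → ℝ} (hw : Summable fun j => |w j| ^ p)
    (hw1 : ∑' j, |w j| ^ p < 1) :
    ∃ u : Ellp 𝕜 p, ‖u‖ = 1 ∧ u 0 ≠ 0 ∧ ∀ j, u (j + 1) = ((w j : ℝ) : 𝕜) := by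
  have hp0 := pos_of_fact p
  have hpr := toReal_ofReal_of_fact p
  have ha : 0 < 1 - ∑' j, |w j| ^ p := by linarith
  set a : ℝ := (1 - ∑' j, |w j| ^ p) ^ p⁻¹ with ha'
  have hap : 0 < a := Real.rpow_pos_of_pos ha _
  let s : ℕ → 𝕜 := fun i => i.casesOn (a : 𝕜) fun j => ((w j : ℝ) : 𝕜)
  have hs : HasSum (fun i => ‖s i‖ ^ p) 1 := by
    rw [← hasSum_nat_add_iff' 1]
    have h1 : ‖s 0‖ ^ p = 1 - ∑' j, |w j| ^ p := by
      change ‖(a : 𝕜)‖ ^ p = _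
      rw [RCLike.norm_ofReal, abs_of_pos hap, ha', ← Real.rpow_mul ha.le,
        inv_mul_cancel₀ hp0.ne', Real.rpow_one]
    have h2 : ∀ j, ‖s (j + 1)‖ ^ p = |w j| ^ p := fun j => by
      change ‖((w j : ℝ) : 𝕜)‖ ^ p = _
      rw [RCLike.norm_ofReal]
    simp only [h2, Finset.sum_range_one, h1, sub_sub_cancel]
    exact hw.hasSum
  let u : Ellp 𝕜 p := ⟨s, memℓp_gen (by rw [hpr]; exact hs.summable)⟩
  refine ⟨u, ?_, ?_, fun j => rfl⟩
  · have h3 := (hasSum_norm_rpow u).unique hs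
    have h4 := congrArg (fun t : ℝ => t ^ p⁻¹) h3
    simpa [← Real.rpow_mul (norm_nonneg u), hp0.ne'] using h4
  · change (a : 𝕜) ≠ 0
    exact_mod_cast hap.ne'

end Ellp

end LpCat

/-! ### Rigidity of isometries for `p ≠ 2`. -/

namespace LpCat

open Finset

section Lamperti

variable {𝕜 : Type*} [RCLike 𝕜]

theorem rpow_eq_mul_rpow_sub_one {x t : ℝ} (hx : 0 < x) : x ^ t = x * x ^ (t - 1) := by
  rw [Real.rpow_sub_one hx.ne']
  field_simp

/-- Split `(a + b) ^ t` as `a * (a + b) ^ (t - 1) + b * (a + b) ^ (t - 1)` and use monotonicity of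
the power `t - 1`. -/
theorem add_rpow_lt_rpow_add {a b t : ℝ} (ha : 0 < a) (hb : 0 < b) (ht : 1 < t) :
    a ^ t + b ^ t < (a + b) ^ t := by
  rw [rpow_eq_mul_rpow_sub_one ha, rpow_eq_mul_rpow_sub_one hb,
    rpow_eq_mul_rpow_sub_one (add_pos ha hb), add_mul]
  have h1 : a ^ (t - 1) < (a + b) ^ (t - 1) :=
    Real.rpow_lt_rpow ha.le (by linarith) (by linarith)
  have h2 : b ^ (t - 1) < (a + b) ^ (t - 1) :=
    Real.rpow_lt_rpow hb.le (by linarith) (by linarith)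
  exact add_lt_add (mul_lt_mul_of_pos_left h1 ha) (mul_lt_mul_of_pos_left h2 hb)

theorem rpow_add_lt_add_rpow {a b t : ℝ} (ha : 0 < a) (hb : 0 < b) (ht : t < 1) :
    (a + b) ^ t < a ^ t + b ^ t := by
  rw [rpow_eq_mul_rpow_sub_one ha, rpow_eq_mul_rpow_sub_one hb,
    rpow_eq_mul_rpow_sub_one (add_pos ha hb), add_mul]
  have h1 : (a + b) ^ (t - 1) < a ^ (t - 1) :=
    Real.rpow_lt_rpow_of_neg ha (by linarith) (by linarith)
  have h2 : (a + b) ^ (t - 1) < b ^ (t - 1) :=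
    Real.rpow_lt_rpow_of_neg hb (by linarith) (by linarith)
  exact add_lt_add (mul_lt_mul_of_pos_left h1 ha) (mul_lt_mul_of_pos_left h2 hb)

theorem norm_rpow_eq_sq_rpow (a : 𝕜) (p : ℝ) : ‖a‖ ^ p = (‖a‖ ^ 2) ^ (p / 2) := by
  rw [← Real.rpow_natCast, ← Real.rpow_mul (norm_nonneg _)]
  congr 1
  push_cast
  ring

theorem half_add_sq (a b : 𝕜) :
    (1 / 2 : ℝ) * ‖a + b‖ ^ 2 + (1 / 2) * ‖a - b‖ ^ 2 = ‖a‖ ^ 2 + ‖b‖ ^ 2 := by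
  have := parallelogram_law_with_norm 𝕜 a b
  nlinarith

/-- The defect of the parallelogram identity for `p`th powers. -/
noncomputable def defect (p : ℝ) (a b : 𝕜) : ℝ :=
  ‖a + b‖ ^ p + ‖a - b‖ ^ p - 2 * (‖a‖ ^ p + ‖b‖ ^ p)

theorem defect_eq_zero {p : ℝ} (hp : 0 < p) {a b : 𝕜} (h : a = 0 ∨ b = 0) : defect p a b = 0 := by
  unfold defect
  rcases h with rfl | rfl <;> simp [Real.zero_rpow hp.ne'] <;> ring

/-- By the parallelogram law the mean of `‖a + b‖ ^ 2` and `‖a - b‖ ^ 2` is `‖a‖ ^ 2 + ‖b‖ ^ 2`.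
Concavity of the power `p / 2` bounds the first two terms by `2 * (‖a‖ ^ 2 + ‖b‖ ^ 2) ^ (p / 2)`,
and strict subadditivity of that power finishes. For `2 < p` both inequalities reverse. -/
theorem defect_neg {p : ℝ} (hp : 0 < p) (hp2 : p < 2) {a b : 𝕜} (ha : a ≠ 0) (hb : b ≠ 0) :
    defect p a b < 0 := by
  have hA : 0 < ‖a‖ ^ 2 := by positivity
  have hB : 0 < ‖b‖ ^ 2 := by positivity
  have h1 := rpow_add_lt_add_rpow hA hB (show p / 2 < 1 by linarith)
  have h2 := (Real.concaveOn_rpow (show 0 ≤ p / 2 by linarith) (show p / 2 ≤ 1 by linarith)).2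
    (Set.mem_Ici.2 (sq_nonneg ‖a + b‖)) (Set.mem_Ici.2 (sq_nonneg ‖a - b‖))
    (show (0 : ℝ) ≤ 1 / 2 by norm_num) (show (0 : ℝ) ≤ 1 / 2 by norm_num) (by norm_num)
  simp only [smul_eq_mul, half_add_sq, ← norm_rpow_eq_sq_rpow] at h1 h2
  unfold defect
  linarith

theorem defect_pos {p : ℝ} (hp2 : 2 < p) {a b : 𝕜} (ha : a ≠ 0) (hb : b ≠ 0) :
    0 < defect p a b := by
  have hA : 0 < ‖a‖ ^ 2 := by positivity
  have hB : 0 < ‖b‖ ^ 2 := by positivity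
  have h1 := add_rpow_lt_rpow_add hA hB (show 1 < p / 2 by linarith)
  have h2 := (convexOn_rpow (show 1 ≤ p / 2 by linarith)).2
    (Set.mem_Ici.2 (sq_nonneg ‖a + b‖)) (Set.mem_Ici.2 (sq_nonneg ‖a - b‖))
    (show (0 : ℝ) ≤ 1 / 2 by norm_num) (show (0 : ℝ) ≤ 1 / 2 by norm_num) (by norm_num)
  simp only [smul_eq_mul, half_add_sq, ← norm_rpow_eq_sq_rpow] at h1 h2
  unfold defect
  linarith

variable {p : ℝ} [hp : Fact (1 ≤ ENNReal.ofReal p)]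

theorem hasSum_defect (x y : Ellp 𝕜 p) : HasSum (fun i => defect p (x i) (y i))
    (‖x + y‖ ^ p + ‖x - y‖ ^ p - 2 * (‖x‖ ^ p + ‖y‖ ^ p)) :=
  ((hasSum_norm_rpow (x + y)).add (hasSum_norm_rpow (x - y))).sub
    (((hasSum_norm_rpow x).add (hasSum_norm_rpow y)).mul_left 2)

/-- For `p ≠ 2` disjointness of supports in `ℓ^p` is a metric property. -/
theorem disjoint_iff_norm (hp2 : p ≠ 2) (x y : Ellp 𝕜 p) : (∀ i, x i = 0 ∨ y i = 0) ↔
    ‖x + y‖ ^ p + ‖x - y‖ ^ p - 2 * (‖x‖ ^ p + ‖y‖ ^ p) = 0 := by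
  have hp0 := pos_of_fact p
  have hs := hasSum_defect x y
  constructor
  · intro h
    have : (fun i => defect p (x i) (y i)) = fun _ => 0 := funext fun i => defect_eq_zero hp0 (h i)
    rw [this] at hs
    exact hs.unique hasSum_zero
  · intro h
    rw [h] at hs
    -- All the defects have the same weak sign, so a vanishing sum forces each of them to vanish.
    rcases lt_or_gt_of_ne hp2 with h2 | h2
    · have h3 : ∀ i, 0 ≤ -defect p (x i) (y i) := fun i => by
        by_cases hi : x i = 0 ∨ y i = 0
        · simp [defect_eq_zero hp0 hi]
        · rw [not_or] at hi
          linarith [defect_neg hp0 h2 hi.1 hi.2]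
      have h4 := (hasSum_zero_iff_of_nonneg h3).1 (by simpa using hs.neg)
      intro i
      by_contra hi
      rw [not_or] at hi
      have := congrFun h4 i
      simp only [Pi.zero_apply] at this
      linarith [defect_neg hp0 h2 hi.1 hi.2]
    · have h3 : ∀ i, 0 ≤ defect p (x i) (y i) := fun i => by
        by_cases hi : x i = 0 ∨ y i = 0
        · simp [defect_eq_zero hp0 hi]
        · rw [not_or] at hi
          exact (defect_pos h2 hi.1 hi.2).le
      have h4 := (hasSum_zero_iff_of_nonneg h3).1 hs
      intro i
      by_contra hi
      rw [not_or] at hi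
      have := congrFun h4 i
      simp only [Pi.zero_apply] at this
      linarith [defect_pos h2 hi.1 hi.2]

/-- For `p ≠ 2` a surjective linear isometry of `ℓ^p` hits the first standard vector, up to a
unimodular factor, at a standard vector. -/
theorem exists_map_stdGen (hp2 : p ≠ 2) (T : Ellp 𝕜 p ≃ₗᵢ[𝕜] Ellp 𝕜 p) :
    ∃ m, ∃ c : 𝕜, ‖c‖ = 1 ∧ T (stdGen 𝕜 p m) = c • stdGen 𝕜 p 0 := by
  have hT : ∀ x y : Ellp 𝕜 p, (∀ i, x i = 0 ∨ y i = 0) → ∀ i, T x i = 0 ∨ T y i = 0 := by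
    intro x y h
    rw [disjoint_iff_norm hp2] at h ⊢
    rwa [← map_add, ← map_sub, T.norm_map, T.norm_map, T.norm_map, T.norm_map]
  set x := T.symm (stdGen 𝕜 p 0) with hx
  have hTx : T x = stdGen 𝕜 p 0 := T.apply_symm_apply _
  have hx0 : ∃ m, x m ≠ 0 := by
    by_contra! h
    have h0 : x = 0 := lp.ext (funext h)
    rw [h0, map_zero] at hTx
    have := norm_stdGen (𝕜 := 𝕜) (p := p) 0
    rw [← hTx, norm_zero] at this
    exact zero_ne_one this
  obtain ⟨m, hm⟩ := hx0
  -- Split `x` into its `m`th coordinate and the rest. The images have disjoint supports and sum to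
  -- `e_0`, so both vanish off coordinate `0`.
  have hd := hT (x m • stdGen 𝕜 p m) (x - x m • stdGen 𝕜 p m) fun i => by
    by_cases hi : i = m
    · right; subst hi; simp [ellp_smul_apply, ellp_sub_apply, stdGen_apply]
    · left; simp [stdGen_apply, hi]
  have hsum : T (x m • stdGen 𝕜 p m) + T (x - x m • stdGen 𝕜 p m) = stdGen 𝕜 p 0 := by
    rw [← map_add, add_sub_cancel, hTx]
  have hz : ∀ i, i ≠ 0 → T (stdGen 𝕜 p m) i = 0 := fun i hi => by
    have h1 : T (x m • stdGen 𝕜 p m) i + T (x - x m • stdGen 𝕜 p m) i = 0 := by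
      rw [← ellp_add_apply, hsum, stdGen_apply, if_neg hi]
    have h2 : T (x m • stdGen 𝕜 p m) i = 0 := by
      rcases hd i with h | h
      · exact h
      · rwa [h, add_zero] at h1
    rw [map_smul] at h2
    simpa [hm] using h2
  have hc : T (stdGen 𝕜 p m) = T (stdGen 𝕜 p m) 0 • stdGen 𝕜 p 0 := by
    refine lp.ext (funext fun i => ?_)
    by_cases hi : i = 0
    · subst hi; simp [stdGen_apply]
    · rw [hz i hi]; simp [stdGen_apply, hi]
  refine ⟨m, _, ?_, hc⟩
  have h5 := T.norm_map (stdGen 𝕜 p m)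
  rw [hc, norm_smul, norm_stdGen, norm_stdGen, mul_one] at h5
  exact h5

end Lamperti

end LpCat

/-! ### Summable weights encoding the halting problem. -/

namespace LpCat

open Finset Comb

open Nat.Partrec (Code)

section HaltingWeights

/-- The program with index `n` halts on input `0` within `t` steps. -/
def haltsBy (n t : ℕ) : Bool := (Code.evaln t (Denumerable.ofNat Code n) 0).isSome

theorem primrec_haltsBy : Primrec₂ haltsBy :=
  Primrec.option_isSome.comp (Code.primrec_evaln.comp (Primrec.pair
    (Primrec.pair Primrec.snd ((Primrec.ofNat Code).comp Primrec.fst)) (Primrec.const 0)))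

theorem haltsBy_mono {n s t : ℕ} (h : s ≤ t) (hs : haltsBy n s = true) : haltsBy n t = true := by
  obtain ⟨x, hx⟩ := Option.isSome_iff_exists.1 hs
  exact Option.isSome_iff_exists.2 ⟨x, Code.evaln_mono h hx⟩

theorem haltsBy_zero (n : ℕ) : haltsBy n 0 = false := by
  simp [haltsBy, Code.evaln]

theorem dom_iff_haltsBy (n : ℕ) :
    (Code.eval (Denumerable.ofNat Code n) 0).Dom ↔ ∃ t, haltsBy n t = true := by
  rw [Part.dom_iff_mem]
  constructor
  · rintro ⟨x, hx⟩
    obtain ⟨t, ht⟩ := Code.evaln_complete.1 hx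
    exact ⟨t, Option.isSome_iff_exists.2 ⟨x, ht⟩⟩
  · rintro ⟨t, ht⟩
    obtain ⟨x, hx⟩ := Option.isSome_iff_exists.1 ht
    exact ⟨x, Code.evaln_complete.2 ⟨t, hx⟩⟩

/-- Codes of the weights `2⁻¹ ^ (n + 2)`, at `Nat.pair n t`, for the programs `n` that halt at
the stage `t + 1` exactly. -/
def haltWeight (j : ℕ) : RatCode :=
  bif haltsBy j.unpair.1 (j.unpair.2 + 1) && !haltsBy j.unpair.1 j.unpair.2 then
    RatCode.twoInv (j.unpair.1 + 2) else RatCode.ofNat 0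

theorem primrec_haltWeight : Primrec haltWeight := by
  have h1 : Primrec fun j : ℕ => j.unpair.1 := Primrec.fst.comp Primrec.unpair
  have h2 : Primrec fun j : ℕ => j.unpair.2 := Primrec.snd.comp Primrec.unpair
  exact Primrec.cond (Primrec.and.comp (primrec_haltsBy.comp h1 (Primrec.succ.comp h2))
    (Primrec.not.comp (primrec_haltsBy.comp h1 h2)))
    (RatCode.primrec_twoInv.comp (h1.nat_add' (Primrec.const 2))) (Primrec.const _)

/-- A program has at most one first halting stage, so each `n` contributes at most once, and `∑ 2⁻¹
^ (n + 2) = 1 / 2`. -/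
theorem sum_haltWeight_le (s : Finset ℕ) :
    ∑ j ∈ s, ((haltWeight j).toRat : ℝ) ≤ 1 / 2 := by
  let A : ℕ → Prop := fun j =>
    (haltsBy j.unpair.1 (j.unpair.2 + 1) && !haltsBy j.unpair.1 j.unpair.2) = true
  have h1 : ∑ j ∈ s, ((haltWeight j).toRat : ℝ) =
      ∑ j ∈ s.filter A, (2 : ℝ)⁻¹ ^ (j.unpair.1 + 2) := by
    rw [Finset.sum_filter]
    refine Finset.sum_congr rfl fun j _ => ?_
    by_cases hj : A j
    · have hj' : (haltsBy j.unpair.1 (j.unpair.2 + 1) && !haltsBy j.unpair.1 j.unpair.2) = true := hj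
      rw [if_pos hj, haltWeight, hj']
      simp
    · have hj' : (haltsBy j.unpair.1 (j.unpair.2 + 1) && !haltsBy j.unpair.1 j.unpair.2) = false := by
        simpa only [A, Bool.not_eq_true] using hj
      rw [if_neg hj, haltWeight, hj']
      simp
  have h2 : Set.InjOn (fun j : ℕ => j.unpair.1) (s.filter A : Finset ℕ) := by
    intro i hi j hj hij
    have hi' : A i := (Finset.mem_filter.1 hi).2
    have hj' : A j := (Finset.mem_filter.1 hj).2
    simp only [A, Bool.and_eq_true, Bool.not_eq_true', ← Bool.not_eq_true] at hi' hj'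
    simp only at hij
    have h3 : i.unpair.2 = j.unpair.2 := by
      rcases lt_trichotomy i.unpair.2 j.unpair.2 with h | h | h
      · exact absurd (haltsBy_mono h (hij ▸ hi'.1)) hj'.2
      · exact h
      · exact absurd (haltsBy_mono h (hij ▸ hj'.1)) hi'.2
    rw [← Nat.pair_unpair i, ← Nat.pair_unpair j, hij, h3]
  rw [h1, ← Finset.sum_image (f := fun n => (2 : ℝ)⁻¹ ^ (n + 2)) h2]
  have h4 : HasSum (fun n : ℕ => (2 : ℝ)⁻¹ ^ (n + 2)) (1 / 2) := by
    have := (hasSum_geometric_of_lt_one (r := (2 : ℝ)⁻¹) (by norm_num) (by norm_num)).mul_left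
      (1 / 4)
    have h5 : (fun n : ℕ => (2 : ℝ)⁻¹ ^ (n + 2)) = fun n => 1 / 4 * 2⁻¹ ^ n := by
      funext n
      rw [pow_add]
      ring
    have h6 : (1 / 4 : ℝ) * (1 - 2⁻¹)⁻¹ = 1 / 2 := by norm_num
    rwa [h5, ← h6]
  exact sum_le_hasSum _ (fun _ _ => by positivity) h4

theorem haltWeight_nonneg (j : ℕ) : (0 : ℝ) ≤ (haltWeight j).toRat := by
  unfold haltWeight
  cases (haltsBy j.unpair.1 (j.unpair.2 + 1) && !haltsBy j.unpair.1 j.unpair.2) <;> simp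

/-- The weights lie in `[0, 1]`, so one weight sequence serves every exponent `p ≥ 1`. -/
theorem haltWeight_rpow_le {p : ℝ} (hp : 1 ≤ p) (j : ℕ) :
    |((haltWeight j).toRat : ℝ)| ^ p ≤ (haltWeight j).toRat := by
  have h0 := haltWeight_nonneg j
  have h1 : ((haltWeight j).toRat : ℝ) ≤ 1 := by
    have := sum_haltWeight_le {j}
    simp only [Finset.sum_singleton] at this
    linarith
  rw [abs_of_nonneg h0]
  rcases h0.eq_or_lt with h | h
  · rw [← h, Real.zero_rpow (by linarith)]
  · simpa using Real.rpow_le_rpow_of_exponent_ge h h1 hp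

theorem summable_haltWeight {p : ℝ} (hp : 1 ≤ p) :
    Summable fun j => |((haltWeight j).toRat : ℝ)| ^ p :=
  summable_of_sum_le (c := 1 / 2) (fun j => by positivity) fun s =>
    (Finset.sum_le_sum fun j _ => haltWeight_rpow_le hp j).trans (sum_haltWeight_le s)

theorem tsum_haltWeight_lt {p : ℝ} (hp : 1 ≤ p) :
    ∑' j, |((haltWeight j).toRat : ℝ)| ^ p < 1 := by
  have : ∑' j, |((haltWeight j).toRat : ℝ)| ^ p ≤ 1 / 2 :=
    (summable_haltWeight hp).tsum_le_of_sum_le fun s =>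
      (Finset.sum_le_sum fun j _ => haltWeight_rpow_le hp j).trans (sum_haltWeight_le s)
  linarith

end HaltingWeights

/-! ### Radii, coefficient bounds and membership in rational balls. -/

section Radius

/-- The radius of a coded rational ball, as a coded rational number. -/
def radius (B : BallCode) : RatCode := (B.2.1 + 1, 0, B.2.2)

theorem toRat_radius (B : BallCode) : ((radius B).toRat : ℝ) = PosRatCode.toReal B.2 := by
  simp [radius, RatCode.toRat, PosRatCode.toReal]

theorem primrec_radius : Primrec radius :=
  Primrec.pair (Primrec.succ.comp (Primrec.fst.comp Primrec.snd))
    (Primrec.pair (Primrec.const 0) (Primrec.snd.comp Primrec.snd))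

theorem posRatCode_pos (c : PosRatCode) : 0 < c.toReal := by
  unfold PosRatCode.toReal
  positivity

/-- A bound of the absolute value of a coded rational point. -/
def PointCode.bound (z : PointCode) : ℕ := z.1.1 + z.1.2.1 + (z.2.1 + z.2.2.1)

theorem PointCode.primrec_bound : Primrec PointCode.bound := by
  have h : Primrec fun c : RatCode => c.1 + c.2.1 :=
    Primrec.fst.nat_add' (Primrec.fst.comp Primrec.snd)
  exact (h.comp Primrec.fst).nat_add' (h.comp Primrec.snd)

theorem RatCode.abs_toRat_le (c : RatCode) : |(c.toRat : ℝ)| ≤ ((c.1 + c.2.1 : ℕ) : ℝ) := by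
  simp only [RatCode.toRat]
  push_cast
  have h : (0 : ℝ) < (c.2.2 : ℝ) + 1 := by positivity
  rw [abs_div, abs_of_pos h]
  refine (div_le_self (abs_nonneg _) (by linarith [Nat.cast_nonneg (α := ℝ) c.2.2])).trans ?_
  rw [abs_le]
  have h1 := Nat.cast_nonneg (α := ℝ) c.1
  have h2 := Nat.cast_nonneg (α := ℝ) c.2.1
  constructor <;> linarith

theorem PointCode.norm_toPoint_le (𝕜 : Type*) [RCLike 𝕜] (z : PointCode) :
    ‖z.toPoint 𝕜‖ ≤ z.bound := by
  have h : ∀ q : RatCode, ‖((q.toRat : ℚ) : 𝕜)‖ = |(q.toRat : ℝ)| := fun q => by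
    rw [← RCLike.ofReal_ratCast, RCLike.norm_ofReal]
  have hI : ‖(RCLike.I : 𝕜)‖ ≤ 1 := by
    rw [RCLike.norm_I]
    split_ifs <;> norm_num
  unfold PointCode.toPoint PointCode.bound
  refine (norm_add_le _ _).trans ?_
  rw [norm_mul, h, h, Nat.cast_add]
  refine add_le_add (RatCode.abs_toRat_le _) ?_
  exact (mul_le_of_le_one_right (abs_nonneg _) hI).trans (RatCode.abs_toRat_le _)

variable {𝕜 : Type*} [RCLike 𝕜] {V : Type*} [NormedAddCommGroup V] [NormedSpace 𝕜 V] {f : ℕ → V}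

/-- The code of `-1`. -/
def PointCode.negOne : PointCode := PointCode.ofRat (RatCode.ofNat 1).neg

theorem PointCode.toPoint_negOne : PointCode.negOne.toPoint 𝕜 = -1 := by
  simp [PointCode.negOne]

theorem semiDec_ratComb_mem_ratBall (hf : IsEffectiveGenerating 𝕜 f) :
    SemiDec fun x : List PointCode × BallCode => ratComb 𝕜 f x.1 ∈ ratBall 𝕜 f x.2 := by
  have h := (semiDec_norm_lt hf).comp (f := fun x : List PointCode × BallCode =>
    (add x.1 (smul (iIndex 𝕜) PointCode.negOne x.2.1), radius x.2)) (Primrec.pair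
      (primrec_add.comp Primrec.fst ((primrec_smul _).comp (Primrec.const _)
        (Primrec.fst.comp Primrec.snd))) (primrec_radius.comp Primrec.snd))
  refine h.of_eq fun x => ?_
  rw [ratBall, Metric.mem_ball, dist_eq_norm, ratComb_add, ratComb_smul, PointCode.toPoint_negOne,
    toRat_radius, neg_one_smul, sub_eq_add_neg]

theorem semiDec_norm_add_lt (hf : IsEffectiveGenerating 𝕜 f) {α : Type*} [Primcodable α]
    {L : α → List PointCode} {a b : α → RatCode} (hL : Primrec L) (ha : Primrec a)
    (hb : Primrec b) :
    SemiDec fun x => ‖ratComb 𝕜 f (L x)‖ + ((a x).toRat : ℝ) < ((b x).toRat : ℝ) := by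
  have h := (semiDec_norm_lt hf).comp (f := fun x => (L x, (b x).add (a x).neg)) (Primrec.pair hL
    (RatCode.primrec_add.comp hb (RatCode.primrec_neg.comp ha)))
  refine h.of_eq fun x => ?_
  simp only [RatCode.toRat_add, RatCode.toRat_neg]
  push_cast
  rw [← sub_eq_add_neg, lt_sub_iff_add_lt]

end Radius

/-! ### A computable isometry would make non-halting enumerable. -/

section NotCategorical

variable {𝕜 : Type*} [RCLike 𝕜] {p : ℝ} [hp : Fact (1 ≤ ENNReal.ofReal p)]

/-- Coefficients of the tail of the initial vector of a generating set `replaceGen u`. -/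
def tailCoeffs (w : ℕ → RatCode) (s : ℕ) : List PointCode :=
  (List.range (s + 1)).map fun j =>
    j.casesOn (PointCode.ofRat (RatCode.ofNat 1)) fun i => PointCode.ofRat (w i).neg

theorem primrec_tailCoeffs {w : ℕ → RatCode} (hw : Primrec w) : Primrec (tailCoeffs w) := by
  refine Primrec.list_map (Primrec.list_range.comp Primrec.succ) ?_
  exact Primrec.nat_casesOn Primrec.snd (Primrec.const _)
    (PointCode.primrec_ofRat.comp (RatCode.primrec_neg.comp (hw.comp Primrec.snd)))

theorem coeff_tailCoeffs_zero (w : ℕ → RatCode) (s : ℕ) :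
    (coeff (tailCoeffs w s) 0).toPoint 𝕜 = 1 := by
  rw [tailCoeffs, coeff_map_range, if_pos (Nat.succ_pos s)]
  simp

theorem coeff_tailCoeffs_succ (w : ℕ → RatCode) (s i : ℕ) :
    (coeff (tailCoeffs w s) (i + 1)).toPoint 𝕜 = if i < s then -((w i).toRat : 𝕜) else 0 := by
  rw [tailCoeffs, coeff_map_range]
  by_cases h : i < s
  · simp [h]
  · simp [h]

theorem tail_apply_succ {w : ℕ → RatCode} {u : Ellp 𝕜 p}
    (hwu : ∀ j, u (j + 1) = ((w j).toRat : 𝕜)) (s i : ℕ) :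
    ratComb 𝕜 (replaceGen u) (tailCoeffs w s) (i + 1) = if i < s then 0 else u (i + 1) := by
  rw [ratComb_replaceGen_apply_succ, coeff_tailCoeffs_zero, coeff_tailCoeffs_succ, ← hwu]
  split_ifs <;> simp

/-- The combination is `u` with coordinates `1, …, s` removed, which leaves `u 0 • e_0` plus a tail
of a convergent series. -/
theorem tendsto_tail {w : ℕ → RatCode} {u : Ellp 𝕜 p}
    (hwu : ∀ j, u (j + 1) = ((w j).toRat : 𝕜)) :
    Filter.Tendsto (fun s => ratComb 𝕜 (replaceGen u) (tailCoeffs w s)) Filter.atTop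
      (nhds (u 0 • stdGen 𝕜 p 0)) := by
  have h1 := (hasSum_stdGen u).tendsto_sum_nat.comp (Filter.tendsto_add_atTop_nat 1)
  have h2 := (tendsto_const_nhds (x := u + u 0 • stdGen 𝕜 p 0)).sub h1
  rw [add_sub_cancel_left] at h2
  refine h2.congr fun s => lp.ext (funext fun i => ?_)
  rw [ellp_sub_apply, ellp_add_apply, Function.comp_apply, ellp_sum_apply]
  cases i with
  | zero =>
    rw [ratComb_replaceGen_apply_zero, coeff_tailCoeffs_zero, Finset.sum_range_succ']
    simp [ellp_smul_apply, stdGen_apply]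
  | succ i =>
    rw [tail_apply_succ hwu]
    simp only [ellp_smul_apply, stdGen_apply]
    by_cases h : i < s <;> simp [h]

/-- The centre and the centre shifted by `r / 2` along `e_0` both lie within `η` of `x`, so `r / 2 <
2 * η`. -/
theorem radius_lt_of_ball_subset {f : ℕ → Ellp 𝕜 p} {B : BallCode} {x : Ellp 𝕜 p} {η : ℝ}
    (h : ratBall 𝕜 f B ⊆ Metric.ball x η) :
    ‖ratComb 𝕜 f B.1 - x‖ < η ∧ PosRatCode.toReal B.2 < 4 * η := by
  have hr := posRatCode_pos B.2
  set b := ratComb 𝕜 f B.1 with hb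
  set r := PosRatCode.toReal B.2 with hr'
  have h1 : b ∈ Metric.ball x η := h (Metric.mem_ball_self hr)
  have hn : ‖((r / 2 : ℝ) : 𝕜) • stdGen 𝕜 p 0‖ = r / 2 := by
    rw [norm_smul, norm_stdGen, RCLike.norm_ofReal, abs_of_pos (by linarith), mul_one]
  have h2 : b + ((r / 2 : ℝ) : 𝕜) • stdGen 𝕜 p 0 ∈ Metric.ball x η := h (by
    rw [ratBall, Metric.mem_ball, dist_eq_norm, ← hb, add_sub_cancel_left, hn]
    linarith)
  rw [Metric.mem_ball, dist_eq_norm] at h1 h2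
  refine ⟨h1, ?_⟩
  have h3 : ((r / 2 : ℝ) : 𝕜) • stdGen 𝕜 p 0 =
      (b + ((r / 2 : ℝ) : 𝕜) • stdGen 𝕜 p 0 - x) - (b - x) := by abel
  have h4 := norm_sub_le (b + ((r / 2 : ℝ) : 𝕜) • stdGen 𝕜 p 0 - x) (b - x)
  rw [← h3, hn] at h4
  linarith

/-- A certificate for the divergence of the program with index `n`, for an algorithm `P` that
computes a multiple of the first standard vector as the image of the `m`th one. -/
def IsDivergenceCertificate (u : Ellp 𝕜 p) (P : BallCode →. BallCode) (m n s : ℕ) (z : PointCode)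
    (B B' : BallCode) : Prop :=
  haltsBy n s = false ∧ ratComb 𝕜 (stdGen 𝕜 p) (basis m) ∈ ratBall 𝕜 (stdGen 𝕜 p) B ∧
    B' ∈ P B ∧
    ‖ratComb 𝕜 (replaceGen u) (add (tailCoeffs haltWeight s) (smul (iIndex 𝕜) z B'.1))‖ +
      (((RatCode.ofNat z.bound).mul (radius B')).toRat : ℝ) < ((RatCode.twoInv (n + 2)).toRat : ℝ)

abbrev CertificateData : Type := ℕ × ((ℕ × PointCode) × (BallCode × BallCode))

theorem semiDec_isDivergenceCertificate (hpc : IsComputableReal p) {u : Ellp 𝕜 p}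
    (hF : IsEffectiveGenerating 𝕜 (replaceGen u)) {P : BallCode →. BallCode} (hP : Partrec P)
    (m : ℕ) : SemiDec fun x : CertificateData =>
      IsDivergenceCertificate u P m x.1 x.2.1.1 x.2.1.2 x.2.2.1 x.2.2.2 := by
  have hs : Primrec fun x : CertificateData => x.2.1.1 := Primrec.fst.comp (Primrec.fst.comp Primrec.snd)
  have hz : Primrec fun x : CertificateData => x.2.1.2 := Primrec.snd.comp (Primrec.fst.comp Primrec.snd)
  have hB : Primrec fun x : CertificateData => x.2.2.1 := Primrec.fst.comp (Primrec.snd.comp Primrec.snd)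
  have hB' : Primrec fun x : CertificateData => x.2.2.2 := Primrec.snd.comp (Primrec.snd.comp Primrec.snd)
  have h1 : SemiDec fun x : CertificateData => haltsBy x.1 x.2.1.1 = false :=
    SemiDec.of_primrecPred (Primrec.eq.comp (primrec_haltsBy.comp Primrec.fst hs)
      (Primrec.const false))
  have hmB : Primrec fun x : CertificateData => (basis m, x.2.2.1) :=
    Primrec.pair (Primrec.const (basis m)) hB
  have hE : IsEffectiveGenerating 𝕜 (stdGen 𝕜 p) := isEffectiveGenerating_stdGen hpc
  have h2' := semiDec_ratComb_mem_ratBall hE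
  have h2 : SemiDec fun x : CertificateData =>
      ratComb 𝕜 (stdGen 𝕜 p) (basis m) ∈ ratBall 𝕜 (stdGen 𝕜 p) x.2.2.1 := by
    have h := h2'.comp hmB
    beta_reduce at h
    exact h
  have h3 : SemiDec fun x : CertificateData => x.2.2.2 ∈ P x.2.2.1 :=
    (SemiDec.of_partrec hP).comp (Primrec.pair hB hB')
  have h4 : Primrec fun x : CertificateData =>
      add (tailCoeffs haltWeight x.2.1.1) (smul (iIndex 𝕜) x.2.1.2 x.2.2.2.1) :=
    primrec_add.comp ((primrec_tailCoeffs primrec_haltWeight).comp hs)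
      ((primrec_smul _).comp hz (Primrec.fst.comp hB'))
  have h5 : Primrec fun x : CertificateData => (RatCode.ofNat x.2.1.2.bound).mul (radius x.2.2.2) :=
    RatCode.primrec_mul.comp (RatCode.primrec_ofNat.comp (PointCode.primrec_bound.comp hz))
      (primrec_radius.comp hB')
  have h6 : Primrec fun x : CertificateData => RatCode.twoInv (x.1 + 2) :=
    RatCode.primrec_twoInv.comp (Primrec.fst.nat_add' (Primrec.const 2))
  have h7 := semiDec_norm_add_lt hF h4 h5 h6
  exact (h1.and (h2.and (h3.and h7))).of_eq fun x => Iff.rfl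

/-- Soundness. If `n` first halts at stage `t + 1`, then `s ≤ t ≤ Nat.pair n t`, so the weight at
`Nat.pair n t` survives the removal of the first `s` weights. Adding a multiple of `e_0` leaves that
coordinate alone, yet the certificate bounds the norm of the sum strictly below this weight. -/
theorem IsDivergenceCertificate.not_dom {u : Ellp 𝕜 p}
    (hwu : ∀ j, u (j + 1) = ((haltWeight j).toRat : 𝕜)) {T : Ellp 𝕜 p → Ellp 𝕜 p}
    {P : BallCode →. BallCode} (hcorr : ∀ B, ∀ B' ∈ P B, ∀ v ∈ ratBall 𝕜 (stdGen 𝕜 p) B,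
      T v ∈ ratBall 𝕜 (replaceGen u) B') {m : ℕ} {c : 𝕜}
    (hTm : T (stdGen 𝕜 p m) = c • stdGen 𝕜 p 0) {n s : ℕ} {z : PointCode} {B B' : BallCode}
    (h : IsDivergenceCertificate u P m n s z B B') :
    ¬(Code.eval (Denumerable.ofNat Code n) 0).Dom := by
  obtain ⟨hs, hmem, hPB, hlt⟩ := h
  rw [dom_iff_haltsBy]
  intro hhalt
  classical
  obtain ⟨t, ht⟩ : ∃ t, Nat.find hhalt = t + 1 := Nat.exists_eq_succ_of_ne_zero fun h => by
    have := Nat.find_spec hhalt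
    rw [h, haltsBy_zero] at this
    exact Bool.false_ne_true this
  have h1 : haltsBy n (t + 1) = true := ht ▸ Nat.find_spec hhalt
  have h2 : haltsBy n t = false := by
    have := Nat.find_min hhalt (m := t) (by omega)
    simpa using this
  have hst : s ≤ t := by
    by_contra h
    rw [haltsBy_mono (by omega : t + 1 ≤ s) h1] at hs
    exact Bool.false_ne_true hs.symm
  have hw : (haltWeight (Nat.pair n t)).toRat = 2⁻¹ ^ (n + 2) := by
    simp [haltWeight, h1, h2]
  have hT := hcorr B B' hPB _ hmem
  rw [ratComb_basis, hTm, ratBall, Metric.mem_ball, dist_eq_norm] at hT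
  set b := ratComb 𝕜 (replaceGen u) B'.1 with hb
  set τ := ratComb 𝕜 (replaceGen u) (tailCoeffs haltWeight s) with hτ
  have h3 : ratComb 𝕜 (replaceGen u) (add (tailCoeffs haltWeight s) (smul (iIndex 𝕜) z B'.1)) = τ + z.toPoint 𝕜 • b := by
    rw [ratComb_add, ratComb_smul]
  rw [h3, RatCode.toRat_mul, Rat.cast_mul, toRat_radius] at hlt
  simp only [RatCode.toRat_ofNat, RatCode.toRat_twoInv] at hlt
  push_cast at hlt
  -- The cost of replacing the known centre `b` by the unknown image `c • e_0`; the radius term in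
  -- the certificate pays for it.
  have h4 : ‖z.toPoint 𝕜 • (c • stdGen 𝕜 p 0 - b)‖ ≤ z.bound * PosRatCode.toReal B'.2 := by
    rw [norm_smul]
    exact mul_le_mul (z.norm_toPoint_le 𝕜) hT.le (norm_nonneg _) (Nat.cast_nonneg _)
  have h5 : ‖τ + (z.toPoint 𝕜 * c) • stdGen 𝕜 p 0‖ < 2⁻¹ ^ (n + 2) := by
    have : τ + (z.toPoint 𝕜 * c) • stdGen 𝕜 p 0 =
        (τ + z.toPoint 𝕜 • b) + z.toPoint 𝕜 • (c • stdGen 𝕜 p 0 - b) := by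
      rw [mul_smul, smul_sub]; abel
    rw [this]
    exact (norm_add_le _ _).trans_lt (by linarith)
  have h6 := lp.norm_apply_le_norm (zero_lt_one.trans_le hp.out).ne'
    (τ + (z.toPoint 𝕜 * c) • stdGen 𝕜 p 0) (Nat.pair n t + 1)
  rw [ellp_add_apply, ellp_smul_apply, stdGen_apply, if_neg (Nat.succ_ne_zero _), mul_zero,
    add_zero, hτ, tail_apply_succ hwu,
    if_neg (not_lt.2 (hst.trans (Nat.right_le_pair n t))), hwu, hw] at h6
  have h7 : ‖(((2⁻¹ : ℚ) ^ (n + 2) : ℚ) : 𝕜)‖ = (2 : ℝ)⁻¹ ^ (n + 2) := by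
    rw [← RCLike.ofReal_ratCast, RCLike.norm_ofReal]
    push_cast
    exact abs_of_pos (by positivity)
  rw [h7] at h6
  linarith

/-- Completeness. If `n` diverges every `s` passes the halting test, so `s` can be taken large
enough for the tail to be near `u 0 • e_0`, and `z` near `-u 0 * c⁻¹` makes `z • (c • e_0)` cancel
it. -/
theorem exists_isDivergenceCertificate {u : Ellp 𝕜 p}
    (hwu : ∀ j, u (j + 1) = ((haltWeight j).toRat : 𝕜)) {T : Ellp 𝕜 p → Ellp 𝕜 p}
    {P : BallCode →. BallCode} (hconv : ∀ v, ∀ U ∈ nhds (T v), ∃ B, v ∈ ratBall 𝕜 (stdGen 𝕜 p) B ∧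
      ∃ B' ∈ P B, ratBall 𝕜 (replaceGen u) B' ⊆ U) {m : ℕ} {c : 𝕜} (hc : ‖c‖ = 1)
    (hTm : T (stdGen 𝕜 p m) = c • stdGen 𝕜 p 0) {n : ℕ}
    (hn : ¬(Code.eval (Denumerable.ofNat Code n) 0).Dom) :
    ∃ s z B B', IsDivergenceCertificate u P m n s z B B' := by
  rw [dom_iff_haltsBy] at hn
  push Not at hn
  set ε : ℝ := 2⁻¹ ^ (n + 2) with hε
  have hεpos : 0 < ε := by positivity
  obtain ⟨s, hs⟩ := ((Metric.tendsto_nhds.1 (tendsto_tail hwu)) (ε / 4)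
    (by linarith)).exists
  rw [dist_eq_norm] at hs
  obtain ⟨z, hz⟩ := (Metric.denseRange_iff.1 (PointCode.denseRange_toPoint 𝕜)) (-u 0 * c⁻¹)
    (ε / 4) (by linarith)
  have hc0 : c ≠ 0 := by
    rintro rfl
    simp at hc
  have hzc : ‖u 0 + z.toPoint 𝕜 * c‖ < ε / 4 := by
    have : u 0 + z.toPoint 𝕜 * c = -((-u 0 * c⁻¹ - z.toPoint 𝕜) * c) := by
      field_simp
      ring
    rw [this, norm_neg, norm_mul, hc, mul_one, ← dist_eq_norm]
    exact hz
  set M : ℝ := ((z.bound : ℕ) : ℝ) with hM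
  have hM0 : 0 ≤ M := Nat.cast_nonneg _
  -- The ball is chosen after `z`, so its precision can absorb the bound `M` of `z`. Centre and
  -- radius cost at most `ε / 32` and `ε / 8`, besides twice `ε / 4` for the tail and for `z`.
  set η : ℝ := ε / (32 * (M + 1)) with hη
  have hηpos : 0 < η := by positivity
  have hMη : M * η ≤ ε / 32 := by
    rw [hη, mul_div_assoc', div_le_div_iff₀ (by positivity) (by norm_num)]
    nlinarith
  obtain ⟨B, hmem, B', hB', hsub⟩ := hconv (stdGen 𝕜 p m) (Metric.ball (c • stdGen 𝕜 p 0) η)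
    (by rw [hTm]; exact Metric.ball_mem_nhds _ hηpos)
  obtain ⟨h1, h2⟩ := radius_lt_of_ball_subset hsub
  refine ⟨s, z, B, B', by simpa using hn s, by rwa [ratComb_basis], hB', ?_⟩
  set b := ratComb 𝕜 (replaceGen u) B'.1 with hb
  set τ := ratComb 𝕜 (replaceGen u) (tailCoeffs haltWeight s) with hτ
  have h3 : ratComb 𝕜 (replaceGen u) (add (tailCoeffs haltWeight s) (smul (iIndex 𝕜) z B'.1)) = τ + z.toPoint 𝕜 • b := by
    rw [ratComb_add, ratComb_smul]
  simp only [h3, RatCode.toRat_mul, Rat.cast_mul, toRat_radius, RatCode.toRat_ofNat,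
    RatCode.toRat_twoInv]
  push_cast
  have h4 : τ + z.toPoint 𝕜 • b = (τ - u 0 • stdGen 𝕜 p 0) +
      (u 0 + z.toPoint 𝕜 * c) • stdGen 𝕜 p 0 + z.toPoint 𝕜 • (b - c • stdGen 𝕜 p 0) := by
    rw [add_smul, mul_smul, smul_sub]; abel
  have h5 : ‖z.toPoint 𝕜 • (b - c • stdGen 𝕜 p 0)‖ ≤ M * η := by
    rw [norm_smul]
    exact mul_le_mul (z.norm_toPoint_le 𝕜) h1.le (norm_nonneg _) hM0
  have h6 : ‖(u 0 + z.toPoint 𝕜 * c) • stdGen 𝕜 p 0‖ < ε / 4 := by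
    rwa [norm_smul, norm_stdGen, mul_one]
  have h7 : M * PosRatCode.toReal B'.2 ≤ M * (4 * η) := mul_le_mul_of_nonneg_left h2.le hM0
  have h8 := norm_add₃_le (a := τ - u 0 • stdGen 𝕜 p 0)
    (b := (u 0 + z.toPoint 𝕜 * c) • stdGen 𝕜 p 0) (c := z.toPoint 𝕜 • (b - c • stdGen 𝕜 p 0))
  rw [← h4] at h8
  rw [← hM, ← hε]
  linarith

theorem not_isComputableMap_of_haltWeight (hp2 : p ≠ 2) (hpc : IsComputableReal p) {u : Ellp 𝕜 p}
    (hu : ‖u‖ = 1) (hu0 : u 0 ≠ 0) (hwu : ∀ j, u (j + 1) = ((haltWeight j).toRat : 𝕜))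
    (T : Ellp 𝕜 p ≃ₗᵢ[𝕜] Ellp 𝕜 p) : ¬IsComputableMap 𝕜 (stdGen 𝕜 p) (replaceGen u) T := by
  rintro ⟨P, hP, hcorr, hconv⟩
  have hF : IsEffectiveGenerating 𝕜 (replaceGen u) :=
    isEffectiveGenerating_replaceGen hpc hu hu0 primrec_haltWeight.to_comp hwu
  obtain ⟨m, c, hc, hTm⟩ := exists_map_stdGen hp2 T
  have hQ := SemiDec.exists (P := fun n (y : (ℕ × PointCode) × (BallCode × BallCode)) =>
    IsDivergenceCertificate u P m n y.1.1 y.1.2 y.2.1 y.2.2)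
    (semiDec_isDivergenceCertificate hpc hF hP m)
  have hK : SemiDec fun n : ℕ => ¬(Code.eval (Denumerable.ofNat Code n) 0).Dom := by
    refine hQ.of_eq fun n => ⟨?_, fun hn => ?_⟩
    · rintro ⟨y, hy⟩
      exact hy.not_dom hwu hcorr hTm
    · obtain ⟨s, z, B, B', h⟩ := exists_isDivergenceCertificate hwu hconv hc hTm hn
      exact ⟨((s, z), (B, B')), h⟩
  refine ComputablePred.halting_problem_not_re 0 (((hK.comp (Primrec.encode (α := Code))).of_eq
    fun d => ?_).rePred)
  rw [Denumerable.ofNat_encode]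

theorem not_isComputablyCategorical (hp1 : 1 ≤ p) (hp2 : p ≠ 2) (hpc : IsComputableReal p) :
    ¬IsComputablyCategorical 𝕜 p hp1 := by
  intro h
  obtain ⟨u, hu, hu0, hwu⟩ := exists_norm_one_of_tsum_lt (𝕜 := 𝕜) (summable_haltWeight hp1)
    (tsum_haltWeight_lt hp1)
  simp only [RCLike.ofReal_ratCast] at hwu
  obtain ⟨T, hT⟩ := h (replaceGen u)
    (isEffectiveGenerating_replaceGen hpc hu hu0 primrec_haltWeight.to_comp hwu)
  exact not_isComputableMap_of_haltWeight hp2 hpc hu hu0 hwu T hT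

end NotCategorical

end LpCat

/-! ### Stability of Gram-Schmidt for nearly orthonormal families. -/

namespace LpCat

open Finset Comb

section GramSchmidt

open InnerProductSpace

variable {𝕜 : Type*} [RCLike 𝕜] {H : Type*} [NormedAddCommGroup H] [InnerProductSpace 𝕜 H]

theorem gramSchmidt_eq_sub_sum_normed (u : ℕ → H) (n : ℕ) :
    gramSchmidt 𝕜 u n = u n - ∑ i ∈ range n,
      inner 𝕜 (gramSchmidtNormed 𝕜 u i) (u n) • gramSchmidtNormed 𝕜 u i := by
  have h := gramSchmidt_def'' 𝕜 u n
  rw [eq_sub_iff_add_eq]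
  conv_rhs => rw [h]
  congr 1
  have : Iio n = range n := by ext; simp
  rw [this]
  refine Finset.sum_congr rfl fun i _ => ?_
  simp only [gramSchmidtNormed, inner_smul_left, smul_smul, map_inv₀, RCLike.conj_ofReal]
  congr 1
  rw [div_eq_mul_inv, sq, mul_inv]
  ring

theorem abs_sub_one_le_abs_sq_sub_one {x : ℝ} (hx : 0 ≤ x) : |x - 1| ≤ |x ^ 2 - 1| := by
  have h : x ^ 2 - 1 = (x - 1) * (x + 1) := by ring
  rw [h, abs_mul]
  exact le_mul_of_one_le_right (abs_nonneg _) (by rw [abs_of_nonneg] <;> linarith)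

/-- A nearly orthonormal family is close to its Gram-Schmidt orthonormalization. -/
theorem gramSchmidtNormed_near {u : ℕ → H} {N : ℕ} {δ : ℝ} (hδ : 0 ≤ δ)
    (hu : ∀ i < N, ∀ j < N, ‖inner 𝕜 (u i) (u j) - if i = j then 1 else 0‖ ≤ δ)
    (hsmall : (8 * (N + 1) : ℝ) ^ N * δ ≤ 1) :
    ∀ i < N, ‖gramSchmidtNormed 𝕜 u i‖ = 1 ∧
      ‖gramSchmidtNormed 𝕜 u i - u i‖ ≤ (8 * (N + 1) : ℝ) ^ (i + 1) * δ := by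
  -- Each Gram-Schmidt step multiplies the error bound by `K`; below, `η` bounds the error of all
  -- earlier vectors.
  set K : ℝ := 8 * (N + 1) with hK
  have hN0 : (0 : ℝ) ≤ N := Nat.cast_nonneg _
  have hK1 : 1 ≤ K := by linarith
  intro i
  induction i using Nat.strong_induction_on with
  | _ i ih =>
  intro hi
  set g := gramSchmidtNormed 𝕜 u with hg
  set r := gramSchmidt 𝕜 u i with hr
  set η := K ^ i * δ with hη
  have hiN : (i : ℝ) ≤ N := by exact_mod_cast hi.le
  have hδη : δ ≤ η := le_mul_of_one_le_left hδ (one_le_pow₀ hK1)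
  have hη0 : 0 ≤ η := hδ.trans hδη
  have hKη : K * η ≤ 1 := by
    rw [hη, ← mul_assoc, ← pow_succ']
    exact (mul_le_mul_of_nonneg_right (pow_le_pow_right₀ hK1 hi) hδ).trans hsmall
  have hsq : |‖u i‖ ^ 2 - 1| ≤ δ := by
    have := hu i hi i hi
    rw [if_pos rfl, inner_self_eq_norm_sq_to_K] at this
    rw [← RCLike.norm_ofReal (K := 𝕜)]
    push_cast
    exact this
  have hnu : |‖u i‖ - 1| ≤ η :=
    (abs_sub_one_le_abs_sq_sub_one (norm_nonneg _)).trans (hsq.trans hδη)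
  have hη1 : η ≤ 1 := (le_mul_of_one_le_left hη0 hK1).trans hKη
  have hu2 : ‖u i‖ ≤ 2 := by linarith [(abs_le.1 hnu).2]
  -- Replacing `g j` by `u j` costs at most `η * ‖u i‖ ≤ 2 * η`, and the inner product of `u j` and
  -- `u i` costs at most `δ ≤ η`.
  have hcoef : ∀ j ∈ range i, ‖inner 𝕜 (g j) (u i) • g j‖ ≤ 3 * η := by
    intro j hj
    have hji : j < i := Finset.mem_range.1 hj
    obtain ⟨h1, h2⟩ := ih j hji (hji.trans hi)
    have h3 : ‖g j - u j‖ ≤ η := h2.trans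
      (mul_le_mul_of_nonneg_right (pow_le_pow_right₀ hK1 hji) hδ)
    have h4 : inner 𝕜 (g j) (u i) = inner 𝕜 (u j) (u i) + inner 𝕜 (g j - u j) (u i) := by
      rw [← inner_add_left, add_sub_cancel]
    have h5 := hu j (hji.trans hi) i hi
    rw [if_neg hji.ne, sub_zero] at h5
    have h6 : ‖inner 𝕜 (g j - u j) (u i)‖ ≤ η * 2 :=
      (norm_inner_le_norm _ _).trans (mul_le_mul h3 hu2 (norm_nonneg _) hη0)
    rw [norm_smul, h1, mul_one, h4]
    exact (norm_add_le _ _).trans (by linarith)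
  have hru : ‖r - u i‖ ≤ N * (3 * η) := by
    rw [hr, gramSchmidt_eq_sub_sum_normed, sub_sub_cancel_left, norm_neg]
    refine (norm_sum_le_of_le _ hcoef).trans ?_
    rw [Finset.sum_const, Finset.card_range, nsmul_eq_mul]
    exact mul_le_mul_of_nonneg_right hiN (by linarith)
  have hr1 : |‖r‖ - 1| ≤ (3 * N + 1) * η := by
    have h1 := abs_norm_sub_norm_le r (u i)
    have h2 := abs_sub_le ‖r‖ ‖u i‖ 1
    linarith
  -- `hsmall` gives `K * η ≤ 1`, which keeps the norm of the residual at least `1 / 2`, so it can be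
  -- normalized.
  have hr0 : 0 < ‖r‖ := by
    have h1 : (3 * N + 1) * η ≤ K * η / 2 := by
      rw [hK]; nlinarith
    have h2 := (abs_le.1 hr1).1
    linarith
  have hg1 : g i = ((‖r‖⁻¹ : ℝ) : 𝕜) • r := by
    rw [hg, gramSchmidtNormed]
    push_cast
    rfl
  constructor
  · rw [hg1, norm_smul, RCLike.norm_ofReal, abs_of_pos (inv_pos.2 hr0), inv_mul_cancel₀ hr0.ne']
  · have h1 : g i - r = ((‖r‖⁻¹ - 1 : ℝ) : 𝕜) • r := by
      rw [hg1]
      push_cast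
      rw [sub_smul, one_smul]
    have h2 : ‖g i - r‖ = |‖r‖ - 1| := by
      rw [h1, norm_smul, RCLike.norm_ofReal]
      conv_lhs => rw [← abs_of_pos hr0, ← abs_mul, abs_of_pos hr0, sub_mul,
        inv_mul_cancel₀ hr0.ne', one_mul]
      rw [abs_sub_comm]
    have h3 : ‖g i - u i‖ ≤ ‖g i - r‖ + ‖r - u i‖ := norm_sub_le_norm_sub_add_norm_sub _ _ _
    have h4 : K ^ (i + 1) * δ = K * η := by rw [hη, pow_succ']; ring
    rw [h4, hK]
    rw [h2] at h3
    nlinarith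

/-- The Gram-Schmidt orthonormalization is orthonormal where it does not vanish. -/
theorem inner_gramSchmidtNormed (u : ℕ → H) {i j : ℕ} (hi : ‖gramSchmidtNormed 𝕜 u i‖ = 1) :
    inner 𝕜 (gramSchmidtNormed 𝕜 u i) (gramSchmidtNormed 𝕜 u j) = if i = j then 1 else 0 := by
  split_ifs with h
  · subst h
    rw [inner_self_eq_norm_sq_to_K, hi]
    simp
  · simp [gramSchmidtNormed, inner_smul_left, inner_smul_right, gramSchmidt_orthogonal 𝕜 u h]

/-- A nearly orthonormal family in an infinite-dimensional space is close to the initial part of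
an orthonormal family with one more member, whose span contains a given vector. -/
theorem exists_orthonormal_near (hinf : ¬FiniteDimensional 𝕜 H) {u : ℕ → H} {N : ℕ} {δ : ℝ}
    (hδ : 0 ≤ δ) (hu : ∀ i < N, ∀ j < N, ‖inner 𝕜 (u i) (u j) - if i = j then 1 else 0‖ ≤ δ)
    (hsmall : (8 * (N + 1) : ℝ) ^ N * δ ≤ 1) (f : H) :
    ∃ g : ℕ → H, (∀ i < N + 1, ∀ j < N + 1, inner 𝕜 (g i) (g j) = if i = j then 1 else 0) ∧
      (∀ i < N, ‖g i - u i‖ ≤ (8 * (N + 1) : ℝ) ^ N * δ) ∧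
      ∃ b : ℕ → 𝕜, f = ∑ i ∈ range (N + 1), b i • g i := by
  set S := Submodule.span 𝕜 (u '' Set.Iio N) with hS
  have hfin : FiniteDimensional 𝕜 S :=
    FiniteDimensional.span_of_finite 𝕜 ((Set.finite_Iio N).image u)
  obtain ⟨y, hy⟩ : ∃ y, y ∉ S := by
    by_contra! h
    have : S = ⊤ := eq_top_iff.2 fun x _ => h x
    rw [this] at hfin
    exact hinf (Module.finite_def.2 (Module.Finite.iff_fg.1 hfin))
  -- The additional vector is `f` itself when `f` is new, and otherwise any vector outside `S`,
  -- which infinite dimension provides.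
  obtain ⟨x, hxS, hfx⟩ : ∃ x, x ∉ S ∧ (f ∈ S ∨ f = x) := by
    by_cases hf : f ∈ S
    · exact ⟨y, hy, Or.inl hf⟩
    · exact ⟨f, hf, Or.inr rfl⟩
  let v : ℕ → H := fun i => if i < N then u i else x
  have hvu : ∀ i < N, v i = u i := fun i hi => if_pos hi
  have hvN : v N = x := if_neg (lt_irrefl _)
  have himg : v '' Set.Iio N = u '' Set.Iio N := Set.image_congr fun i hi => hvu i hi
  have hnear := gramSchmidtNormed_near (u := v) hδ (fun i hi j hj => by
    rw [hvu i hi, hvu j hj]; exact hu i hi j hj) hsmall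
  have hnorm : ∀ i < N + 1, ‖gramSchmidtNormed 𝕜 v i‖ = 1 := by
    intro i hi
    rcases Nat.lt_succ_iff_lt_or_eq.1 hi with hi | rfl
    · exact (hnear i hi).1
    · apply gramSchmidtNormed_unit_length'
      intro h0
      apply hxS
      have h1 : gramSchmidt 𝕜 v i = 0 := by
        simpa [gramSchmidtNormed] using h0
      have h2 := gramSchmidt_eq_sub_sum_normed (𝕜 := 𝕜) v i
      rw [h1, eq_comm, sub_eq_zero, hvN] at h2
      rw [h2, hS, ← himg, ← span_gramSchmidt_Iio 𝕜 v, ← span_gramSchmidtNormed]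
      exact Submodule.sum_mem _ fun j hj => Submodule.smul_mem _ _
        (Submodule.subset_span ⟨j, Finset.mem_range.1 hj, rfl⟩)
  refine ⟨gramSchmidtNormed 𝕜 v, fun i hi j _ => inner_gramSchmidtNormed v (hnorm i hi),
    fun i hi => ?_, ?_⟩
  · have h := (hnear i hi).2
    rw [hvu i hi] at h
    refine h.trans (mul_le_mul_of_nonneg_right (pow_le_pow_right₀ ?_ hi) hδ)
    linarith [Nat.cast_nonneg (α := ℝ) N]
  · have h1 : f ∈ Submodule.span 𝕜 (gramSchmidtNormed 𝕜 v '' Set.Iic N) := by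
      rw [span_gramSchmidtNormed, span_gramSchmidt_Iic]
      rcases hfx with h | rfl
      · rw [hS, ← himg] at h
        exact Submodule.span_mono (Set.image_mono (Set.Iio_subset_Iic_self)) h
      · exact Submodule.subset_span ⟨N, Set.mem_Iic.2 le_rfl, hvN⟩
    have h2 : Set.Iic N = ((range (N + 1) : Finset ℕ) : Set ℕ) := by
      ext; simp
    rw [h2, Submodule.mem_span_image_finset_iff_exists_fun] at h1
    obtain ⟨c, hc⟩ := h1
    refine ⟨fun i => if h : i ∈ range (N + 1) then c ⟨i, h⟩ else 0, ?_⟩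
    rw [← hc, ← Finset.sum_coe_sort (range (N + 1))]
    refine Finset.sum_congr rfl fun i _ => ?_
    beta_reduce
    rw [dif_pos i.2]

/-- Near orthonormality from estimates of norms of combinations with coefficients `±1`, `±I`. -/
theorem norm_inner_sub_le {v : ℕ → H} {N : ℕ} {δ : ℝ} (hδ1 : δ ≤ 1)
    (h1 : ∀ i < N, 1 - δ < ‖v i‖ ∧ ‖v i‖ < 1 + δ)
    (h2 : ∀ i < N, ∀ j < N, i ≠ j → ∀ z : 𝕜, z = 1 ∨ z = -1 ∨ z = RCLike.I ∨ z = -RCLike.I →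
      ‖v i + z • v j‖ ^ 2 < 2 + δ) :
    ∀ i < N, ∀ j < N, ‖inner 𝕜 (v i) (v j) - if i = j then 1 else 0‖ ≤ 5 * δ := by
  have hδ0 : ∀ i < N, 0 < δ := fun i hi => by linarith [(h1 i hi).1, (h1 i hi).2]
  have hlow : ∀ i < N, 1 - 2 * δ ≤ ‖v i‖ ^ 2 := fun i hi => by
    nlinarith [(h1 i hi).1, sq_nonneg (‖v i‖ - 1)]
  intro i hi j hj
  have hδ := hδ0 i hi
  split_ifs with hij
  · subst hij
    rw [inner_self_eq_norm_sq_to_K]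
    have h3 : ((‖v i‖ : 𝕜)) ^ 2 - 1 = ((‖v i‖ ^ 2 - 1 : ℝ) : 𝕜) := by push_cast; rfl
    rw [h3, RCLike.norm_ofReal, abs_le]
    constructor
    · linarith [hlow i hi]
    · nlinarith [(h1 i hi).2, norm_nonneg (v i)]
  · rw [sub_zero]
    -- Expanding the square, twice the real part is below `2 + δ - 2 * (1 - 2 * δ) = 5 * δ`. The
    -- four units then bound the real and imaginary parts from both sides.
    have key : ∀ z : 𝕜, z = 1 ∨ z = -1 ∨ z = RCLike.I ∨ z = -RCLike.I → ‖z‖ = 1 →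
        RCLike.re (inner 𝕜 (v i) (z • v j)) ≤ 5 / 2 * δ := fun z hz hz1 => by
      have h3 := h2 i hi j hj hij z hz
      rw [norm_add_sq (𝕜 := 𝕜), norm_smul, hz1, one_mul] at h3
      linarith [hlow i hi, hlow j hj]
    have hre : |RCLike.re (inner 𝕜 (v i) (v j))| ≤ 5 / 2 * δ := by
      have h3 := key 1 (Or.inl rfl) norm_one
      have h4 := key (-1) (Or.inr (Or.inl rfl)) (by simp)
      rw [one_smul] at h3
      rw [neg_one_smul, inner_neg_right, map_neg] at h4
      exact abs_le.2 ⟨by linarith, h3⟩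
    have him : |RCLike.im (inner 𝕜 (v i) (v j))| ≤ 5 / 2 * δ := by
      by_cases hI : (RCLike.I : 𝕜) = 0
      · have : RCLike.im (inner 𝕜 (v i) (v j)) = 0 := by
          simpa [hI] using (RCLike.I_mul_re (inner 𝕜 (v i) (v j)))
        rw [this, abs_zero]
        linarith
      · have hn : ‖(RCLike.I : 𝕜)‖ = 1 := RCLike.norm_I_of_ne_zero hI
        have h3 := key RCLike.I (Or.inr (Or.inr (Or.inl rfl))) hn
        have h4 := key (-RCLike.I) (Or.inr (Or.inr (Or.inr rfl))) (by rwa [norm_neg])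
        rw [inner_smul_right, RCLike.I_mul_re] at h3
        rw [neg_smul, inner_neg_right, inner_smul_right, map_neg, RCLike.I_mul_re, neg_neg] at h4
        exact abs_le.2 ⟨by linarith, h4⟩
    have h3 : ‖inner 𝕜 (v i) (v j)‖ ^ 2 ≤ (5 * δ) ^ 2 := by
      rw [RCLike.norm_sq_eq_def, ← sq, ← sq, ← sq_abs, ← sq_abs (RCLike.im _)]
      nlinarith [abs_nonneg (RCLike.re (inner 𝕜 (v i) (v j))),
        abs_nonneg (RCLike.im (inner 𝕜 (v i) (v j)))]
    exact (sq_le_sq₀ (norm_nonneg _) (by linarith)).1 h3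

end GramSchmidt

end LpCat

/-! ### The enumerable search for nearly orthonormal families. -/

namespace LpCat

open Finset Comb Filter Topology

section Codes

theorem getD_map_range {α : Type*} (g : ℕ → α) (d : α) {n i : ℕ} (h : i < n) :
    ((List.range n).map g).getD i d = g i := by
  simp [List.getD, h]

/-- Codes of the numbers `1`, `-1`, `I`, `-I`. -/
def unitCodes : List PointCode :=
  [PointCode.ofRat (RatCode.ofNat 1), PointCode.negOne, (RatCode.ofNat 0, RatCode.ofNat 1),
    (RatCode.ofNat 0, (RatCode.ofNat 1).neg)]

theorem exists_unitCode {𝕜 : Type*} [RCLike 𝕜] {z : 𝕜}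
    (h : z = 1 ∨ z = -1 ∨ z = RCLike.I ∨ z = -RCLike.I) :
    ∃ k < 4, (coeff unitCodes k).toPoint 𝕜 = z := by
  rcases h with rfl | rfl | rfl | rfl
  · exact ⟨0, by norm_num, by simp [coeff, unitCodes]⟩
  · exact ⟨1, by norm_num, by simp [coeff, unitCodes, PointCode.toPoint_negOne]⟩
  · exact ⟨2, by norm_num, by simp [coeff, unitCodes, PointCode.toPoint]⟩
  · exact ⟨3, by norm_num, by simp [coeff, unitCodes, PointCode.toPoint]⟩

theorem norm_unitCode_le (𝕜 : Type*) [RCLike 𝕜] (k : ℕ) :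
    ‖(coeff unitCodes k).toPoint 𝕜‖ ≤ 1 := by
  have hI : ‖(RCLike.I : 𝕜)‖ ≤ 1 := by
    rw [RCLike.norm_I]
    split_ifs <;> norm_num
  match k with
  | 0 => simp [coeff, unitCodes]
  | 1 => simp [coeff, unitCodes, PointCode.toPoint_negOne]
  | 2 => simpa [coeff, unitCodes, PointCode.toPoint] using hI
  | 3 => simpa [coeff, unitCodes, PointCode.toPoint] using hI
  | k + 4 => simp [coeff_of_length_le (show unitCodes.length ≤ k + 4 by simp [unitCodes])]

/-- The binary precision to which a family of `n` vectors is orthonormal. -/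
def precision (n : ℕ) : ℕ := 5 * (8 * (n + 1)) ^ n * 4 ^ (n + 2)

theorem primrec_precision : Primrec precision :=
  ((Primrec.const 5).nat_mul' (primrec_nat_pow.comp
    ((Primrec.const 8).nat_mul' Primrec.succ) Primrec.id)).nat_mul'
    (primrec_nat_pow.comp (Primrec.const 4) (Primrec.id.nat_add' (Primrec.const 2)))

/-- The required denominator itself serves as the exponent, since `m ≤ 2 ^ m`; this avoids
logarithms. -/
theorem mul_two_inv_precision_le (n : ℕ) :
    (8 * (n + 1) : ℝ) ^ n * (5 * 2⁻¹ ^ precision n) ≤ (1 / 4) ^ (n + 2) := by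
  have h1 : (precision n : ℝ) ≤ 2 ^ precision n := by exact_mod_cast Nat.lt_two_pow_self.le
  have h2 : (precision n : ℝ) = (8 * (n + 1) : ℝ) ^ n * 5 * 4 ^ (n + 2) := by
    simp only [precision]
    push_cast
    ring
  rw [inv_pow, div_pow, one_pow, ← mul_assoc, ← div_eq_mul_inv,
    div_le_div_iff₀ (by positivity) (by positivity), one_mul, ← h2]
  exact h1

theorem two_inv_precision_le_one (n : ℕ) : (2 : ℝ)⁻¹ ^ precision n ≤ 1 :=
  pow_le_one₀ (by norm_num) (by norm_num)

end Codes

section SemiDecNorm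

variable {𝕜 : Type*} [RCLike 𝕜] {V : Type*} [NormedAddCommGroup V] [NormedSpace 𝕜 V] {f : ℕ → V}
variable {α : Type*} [Primcodable α] {L : α → List PointCode} {q : α → RatCode}

theorem semiDec_norm_comp_lt (hf : IsEffectiveGenerating 𝕜 f) (hL : Primrec L) (hq : Primrec q) :
    SemiDec fun x => ‖ratComb 𝕜 f (L x)‖ < ((q x).toRat : ℝ) := by
  have h := (semiDec_norm_lt hf).comp (Primrec.pair hL hq)
  beta_reduce at h
  exact h

theorem semiDec_lt_norm_comp (hf : IsEffectiveGenerating 𝕜 f) (hL : Primrec L) (hq : Primrec q) :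
    SemiDec fun x => ((q x).toRat : ℝ) < ‖ratComb 𝕜 f (L x)‖ := by
  have h := (semiDec_lt_norm hf).comp (Primrec.pair hL hq)
  beta_reduce at h
  exact h

/-- A rational `r` between the norm and the square root of the bound witnesses the inequality. -/
theorem semiDec_norm_sq_comp_lt (hf : IsEffectiveGenerating 𝕜 f) (hL : Primrec L)
    (hq : Primrec q) : SemiDec fun x => ‖ratComb 𝕜 f (L x)‖ ^ 2 < ((q x).toRat : ℝ) := by
  have h1 : SemiDec fun x : α × RatCode => ‖ratComb 𝕜 f (L x.1)‖ < (x.2.toRat : ℝ) :=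
    semiDec_norm_comp_lt hf (hL.comp Primrec.fst) Primrec.snd
  have h2 : SemiDec fun x : α × RatCode => ((x.2.mul x.2).toRat : ℝ) < ((q x.1).toRat : ℝ) :=
    SemiDec.rat_lt (RatCode.primrec_mul.comp Primrec.snd Primrec.snd).to_comp
      (hq.comp Primrec.fst).to_comp
  refine (SemiDec.exists (P := fun x (r : RatCode) => ‖ratComb 𝕜 f (L x)‖ < (r.toRat : ℝ) ∧
    ((r.mul r).toRat : ℝ) < ((q x).toRat : ℝ)) (h1.and h2)).of_eq fun x => ?_
  simp only [RatCode.toRat_mul]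
  push_cast
  constructor
  · rintro ⟨r, hr1, hr2⟩
    nlinarith [norm_nonneg (ratComb 𝕜 f (L x))]
  · intro h
    have h3 : ‖ratComb 𝕜 f (L x)‖ < √((q x).toRat : ℝ) := Real.lt_sqrt_of_sq_lt h
    obtain ⟨r, hr1, hr2⟩ := RatCode.exists_between h3
    refine ⟨r, hr1, ?_⟩
    have hr0 : (0 : ℝ) ≤ r.toRat := (norm_nonneg _).trans hr1.le
    have := (Real.lt_sqrt hr0).1 hr2
    linarith

end SemiDecNorm

section Stage

variable (𝕜 : Type*) [RCLike 𝕜] {H : Type*} [NormedAddCommGroup H] [NormedSpace 𝕜 H]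

/-- The `i`th vector of a coded finite family of rational combinations. -/
noncomputable def vec (f : ℕ → H) (W : List (List PointCode)) (i : ℕ) : H :=
  ratComb 𝕜 f (W.getD i [])

/-- Near orthonormality of a coded finite family, in terms of norms of rational combinations. -/
def NearOrthonormal (f : ℕ → H) (W : List (List PointCode)) : Prop :=
  (∀ i < W.length, 1 - (2 : ℝ)⁻¹ ^ precision W.length < ‖vec 𝕜 f W i‖ ∧
    ‖vec 𝕜 f W i‖ < 1 + (2 : ℝ)⁻¹ ^ precision W.length) ∧
  ∀ i < W.length, ∀ j < W.length, i = j ∨ ∀ k < 4,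
    ‖vec 𝕜 f W i + (coeff unitCodes k).toPoint 𝕜 • vec 𝕜 f W j‖ ^ 2 <
      2 + (2 : ℝ)⁻¹ ^ precision W.length

/-- `W'` refines the nearly orthonormal family `W`, has one more member, and its span comes close
to a given member of `f`. -/
def StageStep (f : ℕ → H) (W W' : List (List PointCode)) : Prop :=
  W'.length = W.length + 1 ∧ NearOrthonormal 𝕜 f W' ∧
  (∀ i < W.length, ‖vec 𝕜 f W' i - vec 𝕜 f W i‖ < (1 / 4) ^ W.length) ∧
  ∃ β : List PointCode, ‖f W.length.unpair.1 - ∑ i ∈ range (W.length + 1),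
    (coeff β i).toPoint 𝕜 • vec 𝕜 f W' i‖ < (2 : ℝ)⁻¹ ^ W.length.unpair.2

variable {𝕜} {f : ℕ → H}

theorem semiDec_nearOrthonormal (hf : IsEffectiveGenerating 𝕜 f) :
    SemiDec (NearOrthonormal 𝕜 f) := by
  have hδ : Primrec fun W : List (List PointCode) => RatCode.twoInv (precision W.length) :=
    RatCode.primrec_twoInv.comp (primrec_precision.comp Primrec.list_length)
  have h1 : SemiDec fun W => ∀ i < W.length, 1 - (2 : ℝ)⁻¹ ^ precision W.length < ‖vec 𝕜 f W i‖ ∧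
      ‖vec 𝕜 f W i‖ < 1 + (2 : ℝ)⁻¹ ^ precision W.length := by
    refine SemiDec.forall_lt ?_ Primrec.list_length
    have hL : Primrec fun x : List (List PointCode) × ℕ => x.1.getD x.2 [] := Primrec.list_getD []
    have hδ' := hδ.comp (Primrec.fst (α := List (List PointCode)) (β := ℕ))
    have h2 := semiDec_lt_norm_comp hf hL
      (RatCode.primrec_add.comp (Primrec.const (RatCode.ofNat 1)) (RatCode.primrec_neg.comp hδ'))
    have h3 := semiDec_norm_comp_lt hf hL
      (RatCode.primrec_add.comp (Primrec.const (RatCode.ofNat 1)) hδ')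
    refine (h2.and h3).of_eq fun x => ?_
    simp only [RatCode.toRat_add, RatCode.toRat_neg, RatCode.toRat_twoInv, RatCode.toRat_ofNat, vec]
    push_cast
    rw [← sub_eq_add_neg]
  have h2 : SemiDec fun x : ((List (List PointCode) × ℕ) × ℕ) × ℕ =>
      ‖vec 𝕜 f x.1.1.1 x.1.1.2 + (coeff unitCodes x.2).toPoint 𝕜 • vec 𝕜 f x.1.1.1 x.1.2‖ ^ 2 <
      2 + (2 : ℝ)⁻¹ ^ precision x.1.1.1.length := by
    have hW : Primrec fun x : ((List (List PointCode) × ℕ) × ℕ) × ℕ => x.1.1.1 :=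
      Primrec.fst.comp (Primrec.fst.comp Primrec.fst)
    have hi : Primrec fun x : ((List (List PointCode) × ℕ) × ℕ) × ℕ => x.1.1.1.getD x.1.1.2 [] :=
      (Primrec.list_getD []).comp hW (Primrec.snd.comp (Primrec.fst.comp Primrec.fst))
    have hj : Primrec fun x : ((List (List PointCode) × ℕ) × ℕ) × ℕ => x.1.1.1.getD x.1.2 [] :=
      (Primrec.list_getD []).comp hW (Primrec.snd.comp Primrec.fst)
    have hk : Primrec fun x : ((List (List PointCode) × ℕ) × ℕ) × ℕ => coeff unitCodes x.2 :=
      primrec_coeff.comp (Primrec.const _) Primrec.snd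
    have h3 := semiDec_norm_sq_comp_lt hf (primrec_add.comp hi
      ((primrec_smul (iIndex 𝕜)).comp hk hj))
      (RatCode.primrec_add.comp (Primrec.const (RatCode.ofNat 2)) (hδ.comp hW))
    refine h3.of_eq fun x => ?_
    simp only [ratComb_add, ratComb_smul, RatCode.toRat_add, RatCode.toRat_twoInv,
      RatCode.toRat_ofNat, vec]
    push_cast
    rfl
  have h3 : SemiDec fun x : (List (List PointCode) × ℕ) × ℕ => x.1.2 = x.2 ∨ ∀ k < 4,
      ‖vec 𝕜 f x.1.1 x.1.2 + (coeff unitCodes k).toPoint 𝕜 • vec 𝕜 f x.1.1 x.2‖ ^ 2 <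
      2 + (2 : ℝ)⁻¹ ^ precision x.1.1.length := by
    refine SemiDec.or ?_ ?_
    · exact SemiDec.of_primrecPred (Primrec.eq.comp (Primrec.snd.comp Primrec.fst) Primrec.snd)
    · exact SemiDec.forall_lt h2 (Primrec.const 4)
  have h4 : SemiDec fun W => ∀ i < W.length, ∀ j < W.length, i = j ∨ ∀ k < 4,
      ‖vec 𝕜 f W i + (coeff unitCodes k).toPoint 𝕜 • vec 𝕜 f W j‖ ^ 2 <
      2 + (2 : ℝ)⁻¹ ^ precision W.length := by
    refine SemiDec.forall_lt ?_ Primrec.list_length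
    exact SemiDec.forall_lt h3 (Primrec.list_length.comp Primrec.fst)
  exact h1.and h4

theorem semiDec_stageStep (hf : IsEffectiveGenerating 𝕜 f) :
    SemiDec fun x : List (List PointCode) × List (List PointCode) => StageStep 𝕜 f x.1 x.2 := by
  have hn : Primrec fun x : List (List PointCode) × List (List PointCode) => x.1.length :=
    Primrec.list_length.comp Primrec.fst
  have h1 : SemiDec fun x : List (List PointCode) × List (List PointCode) =>
      x.2.length = x.1.length + 1 :=
    SemiDec.of_primrecPred (Primrec.eq.comp (Primrec.list_length.comp Primrec.snd)
      (Primrec.succ.comp hn))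
  have h2 : SemiDec fun x : List (List PointCode) × List (List PointCode) =>
      NearOrthonormal 𝕜 f x.2 := (semiDec_nearOrthonormal hf).comp Primrec.snd
  have h3 : SemiDec fun x : List (List PointCode) × List (List PointCode) =>
      ∀ i < x.1.length, ‖vec 𝕜 f x.2 i - vec 𝕜 f x.1 i‖ < (1 / 4) ^ x.1.length := by
    refine SemiDec.forall_lt ?_ hn
    have hi : Primrec fun x : (List (List PointCode) × List (List PointCode)) × ℕ =>
        x.1.1.getD x.2 [] := (Primrec.list_getD []).comp (Primrec.fst.comp Primrec.fst) Primrec.snd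
    have hi' : Primrec fun x : (List (List PointCode) × List (List PointCode)) × ℕ =>
        x.1.2.getD x.2 [] := (Primrec.list_getD []).comp (Primrec.snd.comp Primrec.fst) Primrec.snd
    have h4 := semiDec_norm_comp_lt hf (primrec_add.comp hi' ((primrec_smul (iIndex 𝕜)).comp
      (Primrec.const PointCode.negOne) hi)) (RatCode.primrec_twoInv.comp
      (Primrec.nat_mul.comp (Primrec.const 2) (hn.comp Primrec.fst)))
    refine h4.of_eq fun x => ?_
    simp only [ratComb_add, ratComb_smul, PointCode.toPoint_negOne, RatCode.toRat_twoInv, vec,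
      neg_one_smul, pow_mul]
    push_cast
    rw [← sub_eq_add_neg]
    norm_num
  have h4 : SemiDec fun y : (List (List PointCode) × List (List PointCode)) × List PointCode =>
      ‖f y.1.1.length.unpair.1 - ∑ i ∈ range (y.1.1.length + 1),
        (coeff y.2 i).toPoint 𝕜 • vec 𝕜 f y.1.2 i‖ < (2 : ℝ)⁻¹ ^ y.1.1.length.unpair.2 := by
    have hn' := hn.comp (Primrec.fst (α := List (List PointCode) × List (List PointCode))
      (β := List PointCode))
    have hlin : Primrec fun y : (List (List PointCode) × List (List PointCode)) × List PointCode =>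
        lin (iIndex 𝕜) y.2 y.1.2 (y.1.1.length + 1) :=
      (primrec_lin (iIndex 𝕜)).comp (Primrec.pair (Primrec.pair Primrec.snd
        (Primrec.snd.comp Primrec.fst)) (Primrec.succ.comp hn'))
    have h5 := semiDec_norm_comp_lt hf (primrec_add.comp
      (primrec_basis.comp (Primrec.fst.comp (Primrec.unpair.comp hn')))
      ((primrec_smul (iIndex 𝕜)).comp (Primrec.const PointCode.negOne) hlin))
      (RatCode.primrec_twoInv.comp (Primrec.snd.comp (Primrec.unpair.comp hn')))
    refine h5.of_eq fun y => ?_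
    simp only [ratComb_add, ratComb_smul, PointCode.toPoint_negOne, RatCode.toRat_twoInv, vec,
      neg_one_smul, ratComb_basis, ratComb_lin]
    push_cast
    rw [← sub_eq_add_neg]
  exact h1.and (h2.and (h3.and (SemiDec.exists h4)))

end Stage

section StageExists

variable {𝕜 : Type*} [RCLike 𝕜] {H : Type*} [NormedAddCommGroup H] [InnerProductSpace 𝕜 H]
  {f : ℕ → H}

theorem NearOrthonormal.norm_inner_sub_le {W : List (List PointCode)}
    (hW : NearOrthonormal 𝕜 f W) : ∀ i < W.length, ∀ j < W.length,
      ‖inner 𝕜 (vec 𝕜 f W i) (vec 𝕜 f W j) - if i = j then 1 else 0‖ ≤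
        5 * 2⁻¹ ^ precision W.length := by
  refine LpCat.norm_inner_sub_le (two_inv_precision_le_one _) hW.1 fun i hi j hj hij z hz => ?_
  obtain ⟨k, hk, rfl⟩ := exists_unitCode hz
  exact (hW.2 i hi j hj).resolve_left hij k hk

theorem NearOrthonormal.exists_orthonormal (hinf : ¬FiniteDimensional 𝕜 H)
    {W : List (List PointCode)} (hW : NearOrthonormal 𝕜 f W) (x : H) :
    ∃ g : ℕ → H, (∀ i < W.length + 1, ∀ j < W.length + 1,
        inner 𝕜 (g i) (g j) = if i = j then 1 else 0) ∧
      (∀ i < W.length, ‖g i - vec 𝕜 f W i‖ ≤ (1 / 4) ^ (W.length + 2)) ∧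
      ∃ b : ℕ → 𝕜, x = ∑ i ∈ range (W.length + 1), b i • g i := by
  have h := mul_two_inv_precision_le W.length
  obtain ⟨g, h1, h2, h3⟩ := exists_orthonormal_near hinf (by positivity) hW.norm_inner_sub_le
    (h.trans (pow_le_one₀ (by norm_num) (by norm_num))) x
  exact ⟨g, h1, fun i hi => (h2 i hi).trans h, h3⟩

/-- The exact orthonormal family `g` with the exact coefficients `b` satisfies every requirement.
These are finitely many strict inequalities between continuous functions, so they persist near `(g,
b)`, where density gives rational combinations and rational coefficients. -/
theorem exists_stageStep (hinf : ¬FiniteDimensional 𝕜 H) (hf : IsGenerating 𝕜 f)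
    {W : List (List PointCode)} (hW : NearOrthonormal 𝕜 f W) : ∃ W', StageStep 𝕜 f W W' := by
  obtain ⟨g, hg, hgu, b, hb⟩ := hW.exists_orthonormal hinf (f W.length.unpair.1)
  set N := W.length with hN
  have hnorm : ∀ i < N + 1, ‖g i‖ = 1 := fun i hi => by
    have h := hg i hi i hi
    rw [if_pos rfl, inner_self_eq_norm_sq_to_K] at h
    have h2 : ‖g i‖ ^ 2 = 1 := by exact_mod_cast h
    exact (pow_eq_one_iff_of_nonneg (norm_nonneg _) two_ne_zero).1 h2
  have hδ := two_inv_pos (precision (N + 1))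
  set δ : ℝ := 2⁻¹ ^ precision (N + 1) with hδ'
  have hc : ∀ i, Continuous fun x : (ℕ → H) × (ℕ → 𝕜) => x.1 i := fun i =>
    (continuous_apply i).comp continuous_fst
  have hc' : ∀ i, Continuous fun x : (ℕ → H) × (ℕ → 𝕜) => x.2 i := fun i =>
    (continuous_apply i).comp continuous_snd
  have e1 : ∀ᶠ x : (ℕ → H) × (ℕ → 𝕜) in 𝓝 (g, b), ∀ i ∈ {i | i < N + 1},
      1 - δ < ‖x.1 i‖ ∧ ‖x.1 i‖ < 1 + δ := by
    rw [eventually_all_finite (Set.finite_lt_nat _)]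
    intro i hi
    have ht := ((hc i).norm.tendsto (g, b))
    simp only [hnorm i hi] at ht
    exact (ht.eventually_const_lt (by linarith)).and (ht.eventually_lt_const (by linarith))
  have e2 : ∀ᶠ x : (ℕ → H) × (ℕ → 𝕜) in 𝓝 (g, b), ∀ i ∈ {i | i < N + 1}, ∀ j ∈ {j | j < N + 1},
      i = j ∨ ∀ k ∈ {k | k < 4},
        ‖x.1 i + (coeff unitCodes k).toPoint 𝕜 • x.1 j‖ ^ 2 < 2 + δ := by
    rw [eventually_all_finite (Set.finite_lt_nat _)]
    intro i hi
    rw [eventually_all_finite (Set.finite_lt_nat _)]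
    intro j hj
    by_cases hij : i = j
    · exact Eventually.of_forall fun x => Or.inl hij
    · refine Eventually.mono ?_ fun x hx => Or.inr hx
      rw [eventually_all_finite (Set.finite_lt_nat _)]
      intro k _
      have ht := ((((hc i).add ((hc j).const_smul ((coeff unitCodes k).toPoint 𝕜))).norm.pow
        2).tendsto (g, b))
      refine ht.eventually_lt_const ?_
      have h1 : ‖g i + (coeff unitCodes k).toPoint 𝕜 • g j‖ ^ 2 ≤ 2 := by
        rw [norm_add_sq (𝕜 := 𝕜), inner_smul_right, hg i hi j hj, if_neg hij, norm_smul,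
          hnorm i hi, hnorm j hj]
        have h2 := norm_unitCode_le 𝕜 k
        simp only [mul_zero, map_zero, add_zero, mul_one, one_pow]
        nlinarith [norm_nonneg ((coeff unitCodes k).toPoint 𝕜)]
      exact h1.trans_lt (by linarith)
  have e3 : ∀ᶠ x : (ℕ → H) × (ℕ → 𝕜) in 𝓝 (g, b), ∀ i ∈ {i | i < N},
      ‖x.1 i - vec 𝕜 f W i‖ < (1 / 4) ^ N := by
    rw [eventually_all_finite (Set.finite_lt_nat _)]
    intro i hi
    have ht := ((hc i).sub (continuous_const (y := vec 𝕜 f W i))).norm.tendsto (g, b)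
    refine ht.eventually_lt_const ((hgu i hi).trans_lt ?_)
    exact pow_lt_pow_right_of_lt_one₀ (by norm_num) (by norm_num) (by omega)
  have e4 : ∀ᶠ x : (ℕ → H) × (ℕ → 𝕜) in 𝓝 (g, b),
      ‖f N.unpair.1 - ∑ i ∈ range (N + 1), x.2 i • x.1 i‖ < (2 : ℝ)⁻¹ ^ N.unpair.2 := by
    have ht := ((continuous_const (y := f N.unpair.1)).sub (continuous_finsetSum (range (N + 1))
      fun i _ => (hc' i).smul (hc i))).norm.tendsto (g, b)
    refine ht.eventually_lt_const ?_
    change ‖f N.unpair.1 - ∑ i ∈ range (N + 1), b i • g i‖ < _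
    rw [← hb, sub_self, norm_zero]
    exact two_inv_pos _
  have hdense : DenseRange (Prod.map (Pi.map fun _ : ℕ => ratComb 𝕜 f)
      (Pi.map fun _ : ℕ => PointCode.toPoint 𝕜)) :=
    (DenseRange.piMap fun _ => denseRange_ratComb 𝕜 hf).prodMap
      (DenseRange.piMap fun _ => PointCode.denseRange_toPoint 𝕜)
  obtain ⟨⟨w, β⟩, h1, h2, h3, h4⟩ := hdense.mem_nhds (e1.and (e2.and (e3.and e4)))
  simp only [Prod.map, Pi.map_apply, Set.mem_ofPred_eq] at h1 h2 h3 h4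
  have hlen : ((List.range (N + 1)).map w).length = N + 1 := by simp
  have hvec : ∀ i < N + 1, vec 𝕜 f ((List.range (N + 1)).map w) i = ratComb 𝕜 f (w i) :=
    fun i hi => by rw [vec, getD_map_range w [] hi]
  refine ⟨(List.range (N + 1)).map w, hlen, ⟨?_, ?_⟩, ?_, (List.range (N + 1)).map β, ?_⟩
  · rw [hlen]
    intro i hi
    rw [hvec i hi]
    exact h1 i hi
  · rw [hlen]
    intro i hi j hj
    rw [hvec i hi, hvec j hj]
    exact h2 i hi j hj
  · intro i hi
    rw [hvec i (Nat.lt_succ_of_lt hi)]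
    exact h3 i hi
  · rw [← hN]
    convert h4 using 4 with i hi
    have hi' := Finset.mem_range.1 hi
    rw [hvec i hi', coeff_map_range, if_pos hi']

theorem exists_computable_stages (hinf : ¬FiniteDimensional 𝕜 H)
    (hf : IsEffectiveGenerating 𝕜 f) : ∃ W : ℕ → List (List PointCode), Computable W ∧
      ∀ n, (W n).length = n ∧ NearOrthonormal 𝕜 f (W n) ∧ StageStep 𝕜 f (W n) (W (n + 1)) := by
  obtain ⟨W, hW, h0, h⟩ := (semiDec_stageStep hf).exists_computable_run
    (S := fun W W' => StageStep 𝕜 f W W') (G := NearOrthonormal 𝕜 f) (b₀ := [])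
    -- The run starts from the empty family, which is vacuously nearly orthonormal.
    ⟨fun i hi => absurd hi (Nat.not_lt_zero i), fun i hi => absurd hi (Nat.not_lt_zero i)⟩
    (fun W hW => exists_stageStep hinf hf.1 hW) (fun W W' _ h => h.2.1)
  refine ⟨W, hW, fun n => ⟨?_, h n⟩⟩
  induction n with
  | zero => rw [h0]; rfl
  | succ n ih => rw [(h n).2.1, ih]

end StageExists

end LpCat

/-! ### The limit Hilbert basis. -/

namespace LpCat

open Finset Comb Filter Topology

section Limit

variable {𝕜 : Type*} [RCLike 𝕜] {H : Type*} [NormedAddCommGroup H] [InnerProductSpace 𝕜 H]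
  {f : ℕ → H} {W : ℕ → List (List PointCode)}

theorem exists_limit_of_stageStep [CompleteSpace H]
    (hW : ∀ n, (W n).length = n ∧ StageStep 𝕜 f (W n) (W (n + 1))) :
    ∃ g : ℕ → H, ∀ n, ∀ i < n, ‖vec 𝕜 f (W n) i - g i‖ ≤ 2 * (1 / 4) ^ n := by
  -- The `i`th vector is present only from stage `i + 1` on, hence the shift.
  have hstep : ∀ i m, dist (vec 𝕜 f (W (m + (i + 1))) i) (vec 𝕜 f (W (m + 1 + (i + 1))) i) ≤
      (1 / 4) ^ (i + 1) * (1 / 4) ^ m := by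
    intro i m
    have h := (hW (m + (i + 1))).2.2.2.1 i (by rw [(hW _).1]; omega)
    rw [(hW _).1, ← dist_eq_norm, dist_comm] at h
    rw [← pow_add, add_comm (i + 1), Nat.add_right_comm m 1]
    exact h.le
  have hlim : ∀ i, ∃ a, Tendsto (fun m => vec 𝕜 f (W (m + (i + 1))) i) atTop (𝓝 a) := fun i =>
    cauchySeq_tendsto_of_complete
      (cauchySeq_of_le_geometric (1 / 4) ((1 / 4) ^ (i + 1)) (by norm_num) (hstep i))
  choose g hg using hlim
  refine ⟨g, fun n i hi => ?_⟩
  obtain ⟨m, rfl⟩ := Nat.exists_eq_add_of_le' (show i + 1 ≤ n from hi)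
  have h := dist_le_of_le_geometric_of_tendsto (1 / 4) ((1 / 4) ^ (i + 1)) (by norm_num)
    (hstep i) (hg i) m
  rw [dist_eq_norm, ← pow_add, add_comm (i + 1)] at h
  refine h.trans ?_
  have := pow_pos (show (0 : ℝ) < 1 / 4 by norm_num) (m + (i + 1))
  rw [div_le_iff₀ (by norm_num)]
  linarith

theorem tendsto_two_mul_pow : Tendsto (fun n : ℕ => 2 * (1 / 4 : ℝ) ^ n) atTop (𝓝 0) := by
  simpa using (tendsto_pow_atTop_nhds_zero_of_lt_one (r := (1 / 4 : ℝ)) (by norm_num)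
    (by norm_num)).const_mul 2

/-- Each stage is close to an exactly orthonormal family, and these families converge to `g`; inner
products pass to the limit. -/
theorem orthonormal_of_nearOrthonormal (hinf : ¬FiniteDimensional 𝕜 H)
    (hW : ∀ n, (W n).length = n ∧ NearOrthonormal 𝕜 f (W n)) {g : ℕ → H}
    (hg : ∀ n, ∀ i < n, ‖vec 𝕜 f (W n) i - g i‖ ≤ 2 * (1 / 4) ^ n) : Orthonormal 𝕜 g := by
  have h : ∀ n, ∃ u : ℕ → H, (∀ i < n, ∀ j < n, inner 𝕜 (u i) (u j) = if i = j then 1 else 0) ∧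
      ∀ i < n, ‖u i - g i‖ ≤ (1 / 4) ^ n + 2 * (1 / 4) ^ n := by
    intro n
    obtain ⟨u, h1, h2, -⟩ := (hW n).2.exists_orthonormal hinf 0
    rw [(hW n).1] at h1 h2
    refine ⟨u, fun i hi j hj => h1 i (by omega) j (by omega), fun i hi => ?_⟩
    refine (norm_sub_le_norm_sub_add_norm_sub (u i) (vec 𝕜 f (W n) i) (g i)).trans
      (add_le_add ((h2 i hi).trans ?_) (hg n i hi))
    exact pow_le_pow_of_le_one (by norm_num) (by norm_num) (by omega)
  choose u hu hug using h
  have hlim : ∀ i, Tendsto (fun n => u n i) atTop (𝓝 (g i)) := by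
    intro i
    refine tendsto_iff_norm_sub_tendsto_zero.2 (squeeze_zero' (Eventually.of_forall fun n =>
      norm_nonneg _) ((eventually_gt_atTop i).mono fun n hn => hug n i hn) ?_)
    simpa using (tendsto_pow_atTop_nhds_zero_of_lt_one (r := (1 / 4 : ℝ)) (by norm_num)
      (by norm_num)).add tendsto_two_mul_pow
  rw [orthonormal_iff_ite]
  intro i j
  refine tendsto_nhds_unique ((hlim i).inner (hlim j)) (tendsto_const_nhds.congr' ?_)
  filter_upwards [eventually_gt_atTop i, eventually_gt_atTop j] with n hi hj
  exact (hu n i hi j hj).symm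

theorem norm_le_norm_sum {g : ℕ → H} (hg : Orthonormal 𝕜 g) (b : ℕ → 𝕜) {n i : ℕ} (hi : i < n) :
    ‖b i‖ ≤ ‖∑ j ∈ range n, b j • g j‖ := by
  rw [← hg.inner_right_sum b (Finset.mem_range.2 hi)]
  exact (norm_inner_le_norm _ _).trans (by rw [hg.1 i, one_mul])

/-- Orthonormality bounds every coefficient by the norm of the whole sum, so the error is relative
to that norm. This matters because the coefficients found by the search carry no explicit bound. -/
theorem norm_sum_sub_sum_le {g v : ℕ → H} (hg : Orthonormal 𝕜 g) (b : ℕ → 𝕜) {n : ℕ}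
    (hv : ∀ i < n + 1, ‖v i - g i‖ ≤ 2 * (1 / 4) ^ (n + 1)) :
    ‖∑ i ∈ range (n + 1), b i • v i - ∑ i ∈ range (n + 1), b i • g i‖ ≤
      (1 / 2) ^ (n + 1) * ‖∑ i ∈ range (n + 1), b i • g i‖ := by
  set y := ∑ i ∈ range (n + 1), b i • g i with hy
  have h1 : ∀ i ∈ range (n + 1), ‖b i • (v i - g i)‖ ≤ ‖y‖ * (2 * (1 / 4) ^ (n + 1)) := by
    intro i hi
    rw [norm_smul]
    exact mul_le_mul (norm_le_norm_sum hg b (Finset.mem_range.1 hi)) (hv i (Finset.mem_range.1 hi))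
      (norm_nonneg _) (norm_nonneg _)
  rw [hy, ← Finset.sum_sub_distrib, ← hy]
  simp only [← smul_sub]
  refine (norm_sum_le_of_le _ h1).trans ?_
  rw [Finset.sum_const, card_range, nsmul_eq_mul]
  have h2 : ((n + 1 : ℕ) : ℝ) ≤ 2 ^ n := by exact_mod_cast Nat.lt_two_pow_self
  have h3 : (2 : ℝ) ^ n * (2 * (1 / 4) ^ (n + 1)) = (1 / 2) ^ (n + 1) := by
    rw [← mul_assoc, ← pow_succ, ← mul_pow]
    norm_num
  calc ((n + 1 : ℕ) : ℝ) * (‖y‖ * (2 * (1 / 4) ^ (n + 1)))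
      ≤ 2 ^ n * (‖y‖ * (2 * (1 / 4) ^ (n + 1))) := by gcongr
    _ = 2 ^ n * (2 * (1 / 4) ^ (n + 1)) * ‖y‖ := by ring
    _ = _ := by rw [h3]

/-- Stage `Nat.pair m k` brings the span of the approximating vectors within `2⁻¹ ^ k` of `f m`, and
the same coefficients on `g` do nearly as well. -/
theorem span_dense_of_stageStep (hf : IsGenerating 𝕜 f)
    (hW : ∀ n, (W n).length = n ∧ StageStep 𝕜 f (W n) (W (n + 1))) {g : ℕ → H}
    (hgo : Orthonormal 𝕜 g) (hg : ∀ n, ∀ i < n, ‖vec 𝕜 f (W n) i - g i‖ ≤ 2 * (1 / 4) ^ n) :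
    ⊤ ≤ (Submodule.span 𝕜 (Set.range g)).topologicalClosure := by
  rw [← show _ = ⊤ from hf]
  refine Submodule.topologicalClosure_minimal _ (Submodule.span_le.2 ?_)
    (Submodule.isClosed_topologicalClosure _)
  rintro _ ⟨m, rfl⟩
  have h : ∀ k : ℕ, ∃ y ∈ Submodule.span 𝕜 (Set.range g),
      ‖y - f m‖ ≤ (1 / 2) ^ k * (1 + 2 * (‖f m‖ + 1)) := by
    intro k
    set n := Nat.pair m k with hn
    obtain ⟨β, hβ⟩ := (hW n).2.2.2.2
    rw [(hW n).1, hn, Nat.unpair_pair, ← hn] at hβ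
    dsimp only at hβ
    set b : ℕ → 𝕜 := fun i => (coeff β i).toPoint 𝕜 with hb
    set y := ∑ i ∈ range (n + 1), b i • g i with hy
    refine ⟨y, Submodule.sum_mem _ fun i _ => Submodule.smul_mem _ _
      (Submodule.subset_span ⟨i, rfl⟩), ?_⟩
    have h1 := norm_sum_sub_sum_le hgo b (hg (n + 1))
    rw [← hy] at h1
    have h2 : ‖y - f m‖ ≤ (1 / 2) ^ (n + 1) * ‖y‖ + (1 / 2) ^ k := by
      rw [norm_sub_rev y]
      refine (norm_sub_le_norm_sub_add_norm_sub (f m) _ y).trans ((add_le_add hβ.le h1).trans ?_)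
      rw [← one_div, add_comm]
    have hk1 : (1 / 2 : ℝ) ^ k ≤ 1 := pow_le_one₀ (by norm_num) (by norm_num)
    have hk2 : (1 / 2 : ℝ) ^ (n + 1) ≤ (1 / 2) ^ k :=
      pow_le_pow_of_le_one (by norm_num) (by norm_num) ((Nat.right_le_pair m k).trans (by omega))
    have hk3 : (1 / 2 : ℝ) ^ (n + 1) ≤ 1 / 2 := by
      simpa using pow_le_pow_of_le_one (by norm_num : (0 : ℝ) ≤ 1 / 2) (by norm_num)
        (by omega : 1 ≤ n + 1)
    have h3 : ‖y‖ ≤ ‖f m‖ + ‖y - f m‖ := by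
      simpa using norm_add_le (f m) (y - f m)
    have h4 : (1 / 2 : ℝ) ^ (n + 1) * ‖y‖ ≤ 1 / 2 * ‖y‖ := by gcongr
    -- The relative error is at most `‖y‖ / 2` and is absorbed on the left, which bounds `‖y‖`
    -- independently of `k`.
    have h5 : ‖y‖ ≤ 2 * (‖f m‖ + 1) := by linarith
    have h6 : (1 / 2 : ℝ) ^ (n + 1) * ‖y‖ ≤ (1 / 2) ^ k * (2 * (‖f m‖ + 1)) := by gcongr
    linarith
  choose y hy hyf using h
  refine mem_closure_of_tendsto (b := atTop) (f := y) ?_ (Eventually.of_forall hy)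
  refine tendsto_iff_norm_sub_tendsto_zero.2 (squeeze_zero (fun _ => norm_nonneg _) hyf ?_)
  simpa using (tendsto_pow_atTop_nhds_zero_of_lt_one (r := (1 / 2 : ℝ)) (by norm_num)
      (by norm_num)).mul_const (1 + 2 * (‖f m‖ + 1))

theorem exists_computable_hilbertBasis [CompleteSpace H] (hinf : ¬FiniteDimensional 𝕜 H)
    (hf : IsEffectiveGenerating 𝕜 f) : ∃ (b : HilbertBasis ℕ 𝕜 H)
      (W : ℕ → List (List PointCode)), Computable W ∧
      ∀ n, ∀ i < n, ‖vec 𝕜 f (W n) i - b i‖ ≤ 2 * (1 / 4) ^ n := by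
  obtain ⟨W, hWc, hW⟩ := exists_computable_stages hinf hf
  obtain ⟨g, hg⟩ := exists_limit_of_stageStep fun n => ⟨(hW n).1, (hW n).2.2⟩
  have hgo := orthonormal_of_nearOrthonormal hinf (fun n => ⟨(hW n).1, (hW n).2.1⟩) hg
  refine ⟨HilbertBasis.mk hgo (span_dense_of_stageStep hf.1
    (fun n => ⟨(hW n).1, (hW n).2.2⟩) hgo hg), W, hWc, fun n i hi => ?_⟩
  rw [HilbertBasis.coe_mk]
  exact hg n i hi

end Limit

end LpCat

/-! ### Computability of the isometry, and the case `p = 2`. -/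

namespace LpCat

open Finset Comb Filter Topology

/-- A bound of the sum of the absolute values of a coded list of rational points. -/
def sumBound (α : List PointCode) : ℕ := α.foldr (fun z n => z.bound + n) 0

theorem primrec_sumBound : Primrec sumBound := by
  have h : Primrec₂ fun (_ : List PointCode) (x : PointCode × ℕ) => x.1.bound + x.2 :=
    (PointCode.primrec_bound.comp (Primrec.fst.comp Primrec.snd)).nat_add'
      (Primrec.snd.comp Primrec.snd)
  exact Primrec.list_foldr Primrec.id (Primrec.const 0) h

section Isometry

variable {𝕜 : Type*} [RCLike 𝕜] {V : Type*} [NormedAddCommGroup V] [NormedSpace 𝕜 V]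
  {H : Type*} [NormedAddCommGroup H] [NormedSpace 𝕜 H]

theorem norm_ratComb_le {c : ℝ} (α : List PointCode) {d : ℕ → V}
    (hd : ∀ j < α.length, ‖d j‖ ≤ c) : ‖ratComb 𝕜 d α‖ ≤ sumBound α * c := by
  induction α generalizing d with
  | nil => simp [sumBound]
  | cons z α ih =>
    have h1 : ratComb 𝕜 d (z :: α) = z.toPoint 𝕜 • d 0 + ratComb 𝕜 (fun j => d (j + 1)) α := by
      simp [ratComb, Fin.sum_univ_succ]
    have h2 : sumBound (z :: α) = z.bound + sumBound α := rfl
    rw [h1, h2, Nat.cast_add, add_mul]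
    refine (norm_add_le _ _).trans (add_le_add ?_ (ih fun j hj => hd (j + 1) (by simpa using hj)))
    rw [norm_smul]
    exact mul_le_mul (z.norm_toPoint_le 𝕜) (hd 0 (by simp)) (norm_nonneg _) (Nat.cast_nonneg _)

/-- The stage at which a ball is mapped. -/
def imageStage (B : BallCode) : ℕ := B.1.length + (sumBound B.1 * (B.2.2 + 1) + 1)

theorem primrec_imageStage : Primrec imageStage :=
  (Primrec.list_length.comp Primrec.fst).nat_add' (((primrec_sumBound.comp Primrec.fst).nat_mul'
    (Primrec.succ.comp (Primrec.snd.comp Primrec.snd))).nat_add' (Primrec.const 1))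

/-- The image of a ball, under a linear isometry taking generators to the limits of the
families `W s`. -/
def imageBall (ι : ℕ) (W : ℕ → List (List PointCode)) (B : BallCode) : BallCode :=
  (lin ι B.1 (W (imageStage B)) B.1.length, (2 * B.2.1 + 1, B.2.2))

theorem computable_imageBall (ι : ℕ) {W : ℕ → List (List PointCode)} (hW : Computable W) :
    Computable (imageBall ι W) := by
  have h1 : Computable fun B : BallCode => W (imageStage B) := hW.comp primrec_imageStage.to_comp
  have h2 : Computable fun B : BallCode =>
      ((B.1, W (imageStage B)), B.1.length) :=
    (Computable.fst.pair h1).pair (Primrec.list_length.comp Primrec.fst).to_comp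
  have h3 : Computable fun B : BallCode => lin ι B.1 (W (imageStage B)) B.1.length := by
    have h := (primrec_lin ι).to_comp.comp h2
    beta_reduce at h
    exact h
  have h4 : Primrec fun B : BallCode => (2 * B.2.1 + 1, B.2.2) :=
    Primrec.pair (Primrec.succ.comp ((Primrec.const 2).nat_mul'
      (Primrec.fst.comp Primrec.snd))) (Primrec.snd.comp Primrec.snd)
  have h5 := h3.pair h4.to_comp
  beta_reduce at h5
  exact h5

variable {e : ℕ → V} {f : ℕ → H} {g : ℕ → H} {W : ℕ → List (List PointCode)}

/-- The error is at most `sumBound B.1 * (2 * (1 / 4) ^ s)`. The stage `s` exceeds `N = sumBound B.1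
* (B.2.2 + 1)`, and `N ≤ 4 ^ N`. -/
theorem norm_ratComb_imageBall_sub_le (T : V →ₗᵢ[𝕜] H) (hT : ∀ i, T (e i) = g i)
    (hg : ∀ n, ∀ i < n, ‖vec 𝕜 f (W n) i - g i‖ ≤ 2 * (1 / 4) ^ n) (B : BallCode) :
    ‖T (ratComb 𝕜 e B.1) - ratComb 𝕜 f (imageBall (iIndex 𝕜) W B).1‖ ≤ 1 / (B.2.2 + 1) := by
  set s := imageStage B with hs
  have h1 : ratComb 𝕜 f (imageBall (iIndex 𝕜) W B).1 - T (ratComb 𝕜 e B.1) =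
      ratComb 𝕜 (fun j => vec 𝕜 f (W s) j - g j) B.1 := by
    rw [imageBall, ratComb_lin, ratComb_eq_sum 𝕜 e le_rfl, ratComb_eq_sum 𝕜 _ le_rfl, map_sum,
      ← Finset.sum_sub_distrib]
    refine Finset.sum_congr rfl fun j _ => ?_
    rw [map_smul, hT, ← smul_sub, vec]
  rw [norm_sub_rev, h1]
  refine (norm_ratComb_le B.1 (c := 2 * (1 / 4) ^ s) fun j hj => hg s j ?_).trans ?_
  · rw [hs, imageStage]
    omega
  · set N := sumBound B.1 * (B.2.2 + 1) with hN
    have h2 : (1 / 4 : ℝ) ^ s ≤ (1 / 4) ^ (N + 1) :=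
      pow_le_pow_of_le_one (by norm_num) (by norm_num) (by rw [hs, imageStage]; omega)
    have h3 : (N : ℝ) ≤ 4 ^ N := by exact_mod_cast (Nat.lt_pow_self (by norm_num)).le
    rw [le_div_iff₀ (by positivity)]
    have h4 : (sumBound B.1 : ℝ) * (2 * (1 / 4) ^ s) * (B.2.2 + 1) = N * (2 * (1 / 4) ^ s) := by
      rw [hN]
      push_cast
      ring
    rw [h4]
    calc (N : ℝ) * (2 * (1 / 4) ^ s) ≤ 4 ^ N * (2 * (1 / 4) ^ (N + 1)) := by gcongr
      _ = 2 / 4 * (4 * (1 / 4)) ^ N := by rw [mul_pow, pow_succ]; ring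
      _ ≤ 1 := by norm_num

/-- The centre error `1 / (B.2.2 + 1)` is at most the radius, so doubling the radius makes the image
ball contain the image. Small input balls then have small output balls. -/
theorem isComputableMap_of_approx (he : IsGenerating 𝕜 e) (hW : Computable W)
    (hg : ∀ n, ∀ i < n, ‖vec 𝕜 f (W n) i - g i‖ ≤ 2 * (1 / 4) ^ n) (T : V →ₗᵢ[𝕜] H)
    (hT : ∀ i, T (e i) = g i) : IsComputableMap 𝕜 e f T := by
  have hmem : ∀ B, ∀ v ∈ ratBall 𝕜 e B, T v ∈ ratBall 𝕜 f (imageBall (iIndex 𝕜) W B) := by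
    intro B v hv
    rw [ratBall, Metric.mem_ball] at hv ⊢
    have h1 := norm_ratComb_imageBall_sub_le T hT hg B
    rw [← dist_eq_norm] at h1
    have h2 := dist_triangle (T v) (T (ratComb 𝕜 e B.1))
      (ratComb 𝕜 f (imageBall (iIndex 𝕜) W B).1)
    rw [T.dist_map] at h2
    have h3 : (1 : ℝ) / (B.2.2 + 1) ≤ PosRatCode.toReal B.2 := by
      rw [PosRatCode.toReal]
      gcongr
      simp
    have h4 : PosRatCode.toReal (imageBall (iIndex 𝕜) W B).2 = 2 * PosRatCode.toReal B.2 := by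
      simp only [imageBall, PosRatCode.toReal]
      push_cast
      ring
    rw [h4]
    linarith
  refine ⟨fun B => Part.some (imageBall (iIndex 𝕜) W B), computable_imageBall _ hW, ?_, ?_⟩
  · intro B B' hB' v hv
    rw [Part.mem_some_iff.1 hB']
    exact hmem B v hv
  · intro v U hU
    obtain ⟨ε, hε, hεU⟩ := Metric.mem_nhds_iff.1 hU
    -- The output radius is `2 / (b + 1)`, and two points of the output ball are less than twice
    -- that apart.
    obtain ⟨b, hb⟩ := exists_nat_one_div_lt (show (0 : ℝ) < ε / 4 by positivity)
    obtain ⟨α, hα⟩ := (denseRange_ratComb 𝕜 he).exists_dist_lt v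
      (show (0 : ℝ) < 1 / ((b : ℝ) + 1) by positivity)
    have hv : v ∈ ratBall 𝕜 e (α, (0, b)) := by
      simpa [ratBall, PosRatCode.toReal] using hα
    refine ⟨(α, (0, b)), hv, _, Part.mem_some _, fun w hw => hεU ?_⟩
    have h1 := hmem _ _ hv
    rw [ratBall, Metric.mem_ball] at h1 hw
    have h2 : PosRatCode.toReal (imageBall (iIndex 𝕜) W (α, (0, b))).2 = 2 * (1 / (b + 1)) := by
      simp only [imageBall, PosRatCode.toReal]
      push_cast
      ring
    rw [h2] at h1 hw
    rw [Metric.mem_ball]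
    have h3 := dist_triangle_right w (T v) (ratComb 𝕜 f (imageBall (iIndex 𝕜) W (α, (0, b))).1)
    linarith

end Isometry

section Categorical

variable {𝕜 : Type*} [RCLike 𝕜]

theorem isGenerating_stdGen (p : ℝ) [hp : Fact (1 ≤ ENNReal.ofReal p)] :
    IsGenerating 𝕜 (stdGen 𝕜 p) := by
  have h : replaceGen (stdGen 𝕜 p 0) = stdGen 𝕜 p := funext fun j => by cases j <;> rfl
  rw [← h]
  exact isGenerating_replaceGen (by simp [stdGen_apply])

theorem not_finiteDimensional_lp_two : ¬FiniteDimensional 𝕜 (lp (fun _ : ℕ => 𝕜) 2) := by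
  intro h
  have ho : Orthonormal 𝕜 fun i : ℕ => lp.single (E := fun _ : ℕ => 𝕜) 2 i (1 : 𝕜) := by
    rw [orthonormal_iff_ite]
    intro i j
    rw [lp.inner_single_left, lp.single_apply]
    simp [Pi.single_apply]
  exact not_finite_iff_infinite.2 inferInstance ho.linearIndependent.finite_of_isNoetherian

/-- A variable exponent allows substituting the literal `2`, which carries the inner product
structure, for `ENNReal.ofReal 2`. -/
theorem exists_isComputableMap_of_eq_two {q : ENNReal} [Fact (1 ≤ q)] (hq : q = 2)
    (he : IsGenerating 𝕜 fun n => lp.single (E := fun _ : ℕ => 𝕜) q n (1 : 𝕜))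
    {f : ℕ → lp (fun _ : ℕ => 𝕜) q} (hf : IsEffectiveGenerating 𝕜 f) :
    ∃ T : lp (fun _ : ℕ => 𝕜) q ≃ₗᵢ[𝕜] lp (fun _ : ℕ => 𝕜) q,
      IsComputableMap 𝕜 (fun n => lp.single (E := fun _ : ℕ => 𝕜) q n (1 : 𝕜)) f T := by
  subst hq
  obtain ⟨b, W, hW, hb⟩ := exists_computable_hilbertBasis not_finiteDimensional_lp_two hf
  exact ⟨b.repr.symm, isComputableMap_of_approx he hW hb b.repr.symm.toLinearIsometry
    fun i => b.repr_symm_single i⟩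

theorem isComputablyCategorical_two (hp : (1 : ℝ) ≤ 2) : IsComputablyCategorical 𝕜 2 hp := by
  have := fact_one_le_ofReal hp
  intro f hf
  exact exists_isComputableMap_of_eq_two (by simp) (isGenerating_stdGen 2) hf

end Categorical

end LpCat

theorem theorem1 (𝕜 : Type*) [RCLike 𝕜] (p : ℝ) (hp : 1 ≤ p) (hpc : LpCat.IsComputableReal p) :
    LpCat.IsComputablyCategorical 𝕜 p hp ↔ p = 2 := by
  constructor
  · intro h
    by_contra hp2
    have := LpCat.fact_one_le_ofReal hp
    exact LpCat.not_isComputablyCategorical hp hp2 hpc h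
  · rintro rfl
    exact LpCat.isComputablyCategorical_two hp
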